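/- Corollary (Lack of outliers). Let $t \in [0,1]$. For each $n \ge 1$ let $A_{n,t}$ be an $n \times n$ matrix from the Elliptic Ginibre Ensemble with parameter $t$, that is, a random matrix with the law of $$\sqrt{\tfrac{1+t}{2}}\, X_n + i \sqrt{\tfrac{1-t}{2}}\, Y_n ,$$ where $X_n$ and $Y_n$ are independent random matrices from the Gaussian Unitary Ensemble of size $n$ (Hermitian matrices whose diagonal entries are standard real Gaussian, whose entries above the diagonal are complex Gaussian with independent real and imaginary parts that are centred of variance $\tfrac12$, and whose entries on and above the diagonal are independent). Let $E_t = \{x + iy \in \mathbb{C} : (\frac{x}{1+t})^2 + (\frac{y}{1-t})^2 \le 1\}$ if $t < 1$, and let $E_1 = [-2,2] \subset \mathbb{R}$. Let $C \subset \mathbb{C}$ be a closed set disjoint from $E_t$, let $\lambda_1, \dots, \lambda_n$ be the eigenvalues of $A_{n,t}$ counted with algebraic multiplicity, and let $N_n(C) = \#\{ i \in \{1,\dots,n\} : \lambda_i / \sqrt{n} \in C\}$. Then $N_n(C)$ converges to $0$ in probability as $n \to \infty$, that is, $\mathbb{P}(|N_n(C)| \ge \varepsilon) \to 0$ for every $\varepsilon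 > 0$. -/

import Mathlib

open MeasureTheory ProbabilityTheory Filter Topology

noncomputable section

namespace EllipticGinibre

/-- The product (equivalently, Borel) sigma-algebra on square complex matrices. -/
instance instMeasurableSpaceMatrix (n : ℕ) : MeasurableSpace (Matrix (Fin n) (Fin n) ℂ) :=
  inferInstanceAs (MeasurableSpace (Fin n → Fin n → ℂ))

/-- The Hermitian matrix built from a real array `g`: its diagonal entries are `g i i`, and for
`i < j` its `(i, j)` entry is `(g i j + i g j i) / √2`. -/
def hermitianOfArray {n : ℕ} (g : Fin n × Fin n → ℝ) : Matrix (Fin n) (Fin n) ℂ :=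
  Matrix.of fun i j =>
    if i = j then ((g (i, i) : ℝ) : ℂ)
    else if i < j then ((g (i, j) : ℂ) + Complex.I * (g (j, i) : ℂ)) / (√2 : ℝ)
    else ((g (j, i) : ℂ) - Complex.I * (g (i, j) : ℂ)) / (√2 : ℝ)

/-- The law of the Gaussian Unitary Ensemble of size `n`, normalised so that the diagonal entries
are real standard Gaussian and the entries above the diagonal are standard complex Gaussian
(`E |X i j| ^ 2 = 1`), all these entries being independent. -/
def gueLaw (n : ℕ) : Measure (Matrix (Fin n) (Fin n) ℂ) :=
  (Measure.pi fun _ : Fin n × Fin n => gaussianReal 0 1).map hermitianOfArray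

/-- The matrix `√((1 + t) / 2) X + i √((1 - t) / 2) Y`. -/
def ellipticCombination {n : ℕ} (t : ℝ)
    (p : Matrix (Fin n) (Fin n) ℂ × Matrix (Fin n) (Fin n) ℂ) : Matrix (Fin n) (Fin n) ℂ :=
  ((√((1 + t) / 2) : ℝ) : ℂ) • p.1 + (Complex.I * ((√((1 - t) / 2) : ℝ) : ℂ)) • p.2

/-- The law of the Elliptic Ginibre Ensemble of size `n` with parameter `t`: the law of
`√((1 + t) / 2) X + i √((1 - t) / 2) Y` for independent GUE matrices `X` and `Y`. -/
def ellipticGinibreLaw (n : ℕ) (t : ℝ) : Measure (Matrix (Fin n) (Fin n) ℂ) :=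
  ((gueLaw n).prod (gueLaw n)).map (ellipticCombination t)

/-- The support of the limiting eigenvalue distribution: an ellipse with semi-axes `1 + t` and
`1 - t`, degenerating to the real interval `[-2, 2]` at `t = 1`. -/
def limitingEllipse (t : ℝ) : Set ℂ :=
  if t = 1 then {z | z.im = 0 ∧ z.re ∈ Set.Icc (-2) 2}
  else {z | (z.re / (1 + t)) ^ 2 + (z.im / (1 - t)) ^ 2 ≤ 1}

open Classical in
/-- The number of eigenvalues of `A / √n`, counted with algebraic multiplicity, that lie in `C`. -/
def eigenvalueCount {n : ℕ} (A : Matrix (Fin n) (Fin n) ℂ) (C : Set ℂ) : ℕ :=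
  A.charpoly.roots.countP fun z => z / ((√(n : ℝ) : ℝ) : ℂ) ∈ C

theorem measurable_hermitianOfArray (n : ℕ) : Measurable (hermitianOfArray (n := n)) := by
  refine measurable_pi_lambda _ fun i => measurable_pi_lambda _ fun j => ?_
  simp only [hermitianOfArray, Matrix.of_apply]
  split_ifs <;> fun_prop

theorem measurable_ellipticCombination (n : ℕ) (t : ℝ) :
    Measurable (ellipticCombination (n := n) t) := by
  refine measurable_pi_lambda _ fun i => measurable_pi_lambda _ fun j => ?_
  have h1 : Measurable fun p : Matrix (Fin n) (Fin n) ℂ × Matrix (Fin n) (Fin n) ℂ => p.1 i j :=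
    (measurable_pi_apply j).comp ((measurable_pi_apply i).comp measurable_fst)
  have h2 : Measurable fun p : Matrix (Fin n) (Fin n) ℂ × Matrix (Fin n) (Fin n) ℂ => p.2 i j :=
    (measurable_pi_apply j).comp ((measurable_pi_apply i).comp measurable_snd)
  simp only [ellipticCombination, Matrix.add_apply, Matrix.smul_apply, smul_eq_mul]
  exact (h1.const_mul _).add (h2.const_mul _)

instance (n : ℕ) : IsProbabilityMeasure (gueLaw n) :=
  Measure.isProbabilityMeasure_map (measurable_hermitianOfArray n).aemeasurable

instance (n : ℕ) (t : ℝ) : IsProbabilityMeasure (ellipticGinibreLaw n t) :=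
  Measure.isProbabilityMeasure_map (measurable_ellipticCombination n t).aemeasurable

end EllipticGinibre

end

noncomputable section

open MeasureTheory ProbabilityTheory Filter Topology
namespace EllipticGinibre

/-! ### Polynomials in independent standard Gaussian variables -/

/-! The Joukowski map `s ↦ s⁻¹ + t s` sends the punctured unit disc onto the complement of the
ellipse, and a closed set missing the ellipse comes from a smaller disc `‖s‖ ≤ r₀ < 1`
(`exists_radius`). With `M = A / √n`, an eigenvalue of `M` at `s⁻¹ + t s` is a zero of `det((1 + t
s²) - s M)`. It therefore suffices that, with probability close to 1, the entire function `f(s) =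
det((1 + t s²) - s M) exp(-n t s² / 2)` (`normDet`) has no zero in that disc.

Two facts about `f` suffice. First, `E |f(s)|²` is bounded uniformly in `n` on each circle `‖s‖ = r
< 1` (`integral_norm_sq_normDet_le`). The chaos expansion of a Gaussian form (`eq_sum_derivSum`)
turns this moment into a sum over derivatives of the determinant, whose means are Hermite
polynomials; Cauchy's estimate for their generating function and Stirling's bound control the sum
(`sum_hermiteSeq_le`). Second, near `0` one has `-log f(s) = ∑ τ_k s^k / k`, where `τ_k` is the
centred trace of the `k`-th Dickson polynomial of the first kind at `M`, and `E |τ_k|² ≤ 2 k²` for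
large `n` (`centredTrace_second_moment`). The Poincaré inequality bounds its variance by `k²` times
the normalised trace of `U_{k-1}(M) U_{k-1}(M)⋆`, with `U` of the second kind. The loop equations
give the limits of such traces with error `O(1 / n²)`, and the `U_k` are orthonormal in the limit.

Given the two facts, `f(s) exp(∑_{k ≤ K} τ_k s^k / k) - 1` vanishes to order `K + 1` at `0`, and
with high probability its mean modulus on `‖s‖ = r` has a bound independent of `K`. By Cauchy it is
`O((r₀ / r)^(K + 1))` on the smaller disc, hence smaller than 1 once `K` is large, so `f` has no
zero there (`exists_forall_det_ne_zero`). Only finitely many traces are involved, and `K` is fixed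
before `n` tends to infinity. -/

theorem integrable_pow_gaussianReal (k : ℕ) :
    Integrable (fun x : ℝ => x ^ k) (gaussianReal 0 1) := by
  have h := (memLp_id_gaussianReal (μ := 0) (v := 1) (k : NNReal)).integrable_norm_pow'
  refine h.mono (by fun_prop) (ae_of_all _ fun x => ?_)
  simp

theorem hasDerivAt_gaussianPDFReal (x : ℝ) :
    HasDerivAt (gaussianPDFReal 0 1) (-x * gaussianPDFReal 0 1 x) x := by
  unfold gaussianPDFReal
  have h : HasDerivAt (fun x : ℝ => -(x - 0) ^ 2 / (2 * ((1 : NNReal) : ℝ))) (-x) x := by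
    have := (((hasDerivAt_id x).sub_const 0).pow 2).neg.div_const (2 * ((1 : NNReal) : ℝ))
    refine this.congr_deriv ?_
    simp
    ring
  refine (h.exp.const_mul (√(2 * Real.pi * ((1 : NNReal) : ℝ)))⁻¹).congr_deriv ?_
  ring

theorem integrable_pow_mul_gaussianPDFReal (k : ℕ) :
    Integrable (fun x : ℝ => x ^ k * gaussianPDFReal 0 1 x) := by
  have h := integrable_pow_gaussianReal k
  rw [gaussianReal_of_var_ne_zero _ one_ne_zero,
    integrable_withDensity_iff_integrable_smul' (measurable_gaussianPDF 0 1)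
      (ae_of_all _ fun _ => gaussianPDF_lt_top)] at h
  simpa [toReal_gaussianPDF, mul_comm] using h

/-- Integration by parts against the density, whose derivative is `-x` times itself. At `k = 0` the
truncated exponent `k - 1` is harmless because its coefficient is `0`. -/
theorem integral_pow_succ_gaussianReal (k : ℕ) :
    ∫ x, x ^ (k + 1) ∂gaussianReal 0 1 = k * ∫ x, x ^ (k - 1) ∂gaussianReal 0 1 := by
  simp only [integral_gaussianReal_eq_integral_smul one_ne_zero, smul_eq_mul]
  have h := integral_mul_deriv_eq_deriv_mul_of_integrable
    (u := fun x : ℝ => x ^ k) (v := gaussianPDFReal 0 1) (u' := fun x => k * x ^ (k - 1))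
    (v' := fun x => -x * gaussianPDFReal 0 1 x)
    (fun x _ => by simpa using hasDerivAt_pow k x) (fun x _ => hasDerivAt_gaussianPDFReal x)
    ((integrable_pow_mul_gaussianPDFReal (k + 1)).neg.congr
      (ae_of_all _ fun x => by simp; ring))
    (((integrable_pow_mul_gaussianPDFReal (k - 1)).const_mul (k : ℝ)).congr
      (ae_of_all _ fun x => by simp; ring))
    (integrable_pow_mul_gaussianPDFReal k)
  rw [← integral_const_mul]
  have e1 : ∫ x, gaussianPDFReal 0 1 x * x ^ (k + 1) =
      - ∫ x, x ^ k * (-x * gaussianPDFReal 0 1 x) := by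
    rw [← integral_neg]; congr 1; ext x; ring
  rw [e1, h, neg_neg]
  congr 1; ext x; ring

section Expectation
variable {ι : Type*} [Fintype ι]

/-- The law of a family of independent standard Gaussian variables. -/
def stdGaussian (ι : Type*) [Fintype ι] : Measure (ι → ℝ) :=
  Measure.pi fun _ => gaussianReal 0 1

instance : IsProbabilityMeasure (stdGaussian ι) := by
  unfold stdGaussian; infer_instance

/-- The value of a polynomial at a real point. -/
def realEval (g : ι → ℝ) : MvPolynomial ι ℂ →+* ℂ := MvPolynomial.eval fun i => (g i : ℂ)

theorem integral_monomial_gaussian (m : ι →₀ ℕ) (c : ℂ) :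
    Integrable (fun g => realEval g (MvPolynomial.monomial m c)) (stdGaussian ι) ∧
    ∫ g, realEval g (MvPolynomial.monomial m c) ∂(stdGaussian ι) =
      c * ∏ i, ((∫ x, x ^ m i ∂gaussianReal 0 1 : ℝ) : ℂ) := by
  have e : ∀ g : ι → ℝ, realEval g (MvPolynomial.monomial m c) = c * ∏ i, ((g i : ℝ) : ℂ) ^ m i := by
    intro g
    simp [realEval, MvPolynomial.eval_monomial, Finsupp.prod_fintype]
  simp only [e]
  constructor
  · refine Integrable.const_mul ?_ c
    refine Integrable.fintype_prod (f := fun i (x : ℝ) => ((x : ℝ) : ℂ) ^ m i) fun i => ?_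
    have := (integrable_pow_gaussianReal (m i)).ofReal (𝕜 := ℂ)
    simpa using this
  · rw [integral_const_mul]
    congr 1
    rw [stdGaussian, integral_fintype_prod_eq_prod (fun i (x : ℝ) => ((x : ℝ) : ℂ) ^ m i)]
    refine Finset.prod_congr rfl fun i _ => ?_
    rw [← integral_complex_ofReal]
    simp

theorem integrable_realEval (p : MvPolynomial ι ℂ) :
    Integrable (fun g => realEval g p) (stdGaussian ι) := by
  induction p using MvPolynomial.induction_on' with
  | monomial m c => exact (integral_monomial_gaussian m c).1
  | add p q hp hq =>
    simp only [map_add]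
    exact hp.add hq

/-- The expectation of a polynomial in independent standard Gaussian variables. -/
def gexp : MvPolynomial ι ℂ →ₗ[ℂ] ℂ where
  toFun p := ∫ g, realEval g p ∂(stdGaussian ι)
  map_add' p q := by
    simp only [map_add]
    exact integral_add (integrable_realEval p) (integrable_realEval q)
  map_smul' c p := by
    simp only [realEval, MvPolynomial.smul_eval, RingHom.id_apply, smul_eq_mul]
    exact integral_const_mul _ _

theorem gexp_apply (p : MvPolynomial ι ℂ) : gexp p = ∫ g, realEval g p ∂(stdGaussian ι) := rfl

theorem gexp_one : gexp (1 : MvPolynomial ι ℂ) = 1 := by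
  simp [gexp_apply]

/-- Gaussian integration by parts, on which the later moment identities rest. On a monomial only the
factor of the coordinate `i` changes. -/
theorem gexp_X_mul [DecidableEq ι] (i : ι) (p : MvPolynomial ι ℂ) :
    gexp (MvPolynomial.X i * p) = gexp (MvPolynomial.pderiv i p) := by
  induction p using MvPolynomial.induction_on' with
  | add p q hp hq => simp [mul_add, hp, hq]
  | monomial m c =>
    rw [MvPolynomial.X, MvPolynomial.monomial_mul, MvPolynomial.pderiv_monomial, gexp_apply,
      gexp_apply, (integral_monomial_gaussian _ _).2, (integral_monomial_gaussian _ _).2,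
      ← Finset.mul_prod_erase _ _ (Finset.mem_univ i),
      ← Finset.mul_prod_erase _ _ (Finset.mem_univ i)]
    have e : ∀ j ∈ Finset.univ.erase i,
        ((∫ x, x ^ ((Finsupp.single i 1 + m : ι →₀ ℕ) j) ∂gaussianReal 0 1 : ℝ) : ℂ) =
        ((∫ x, x ^ ((m - Finsupp.single i 1 : ι →₀ ℕ) j) ∂gaussianReal 0 1 : ℝ) : ℂ) := by
      intro j hj
      have : i ≠ j := (Finset.ne_of_mem_erase hj).symm
      simp [this]
    rw [Finset.prod_congr rfl e]
    simp only [Finsupp.add_apply, Finsupp.single_eq_same, Finsupp.tsub_apply]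
    rw [add_comm 1 (m i), integral_pow_succ_gaussianReal]
    push_cast
    ring

end Expectation

end EllipticGinibre

namespace EllipticGinibre

/-! ### Sesquilinear forms satisfying Gaussian integration by parts -/

section GaussianForm

open MvPolynomial ComplexConjugate

variable {σ : Type*}

theorem pderiv_comm (i j : σ) (p : MvPolynomial σ ℂ) :
    pderiv i (pderiv j p) = pderiv j (pderiv i p) := by
  classical
  induction p using MvPolynomial.induction_on with
  | C a => simp
  | add p q hp hq => simp [hp, hq]
  | mul_X p k hp =>
    simp only [Derivation.leibniz, smul_eq_mul, map_add, hp, pderiv_X, Pi.single_apply]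
    split_ifs <;> simp <;> ring

variable [Fintype σ]

/-- The form `(p, q) ↦ E p(Z) conj q(Z)` of a complex Gaussian vector `Z` with mean `ζ`, relation
`E (Z s - ζ s) (Z r - ζ r) = α [r = sw s]` and covariance `E |Z s - ζ s| ^ 2 = β`, described by
its integration by parts formula. -/
structure IsGaussianForm (B : MvPolynomial σ ℂ →ₗ[ℂ] MvPolynomial σ ℂ →ₗ⋆[ℂ] ℂ)
    (sw : σ → σ) (ζ : σ → ℂ) (α β : ℂ) : Prop where
  one_one : B 1 1 = 1
  X_mul : ∀ s p q, B (X s * p) q =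
    ζ s * B p q + α * B (pderiv (sw s) p) q + β * B p (pderiv s q)
  symm : ∀ p q, B p q = conj (B q p)

/-- The Ornstein–Uhlenbeck (number) operator of a Gaussian form. -/
def numOp (sw : σ → σ) (ζ : σ → ℂ) (α : ℂ) : MvPolynomial σ ℂ →ₗ[ℂ] MvPolynomial σ ℂ where
  toFun p := ∑ s, ((X s - C (ζ s)) * pderiv s p - C α * pderiv (sw s) (pderiv s p))
  map_add' p q := by
    rw [← Finset.sum_add_distrib]
    refine Finset.sum_congr rfl fun s _ => ?_
    simp only [map_add]; ring
  map_smul' c p := by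
    rw [RingHom.id_apply, Finset.smul_sum]
    refine Finset.sum_congr rfl fun s _ => ?_
    simp only [MvPolynomial.smul_eq_C_mul, pderiv_C_mul]; ring

theorem numOp_apply (sw : σ → σ) (ζ : σ → ℂ) (α : ℂ) (p : MvPolynomial σ ℂ) :
    numOp sw ζ α p = ∑ s, ((X s - C (ζ s)) * pderiv s p - C α * pderiv (sw s) (pderiv s p)) := rfl

/-- The commutation relation `[∂ᵢ, N] = ∂ᵢ`: each derivative lowers the eigenvalue of the number
operator by one. This is why `N` acts on `derivSum` of order `k` as multiplication by `k`. -/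
theorem pderiv_numOp (sw : σ → σ) (ζ : σ → ℂ) (α : ℂ) (i : σ) (p : MvPolynomial σ ℂ) :
    pderiv i (numOp sw ζ α p) = numOp sw ζ α (pderiv i p) + pderiv i p := by
  classical
  simp only [numOp_apply, map_sum]
  have : ∀ s, pderiv i ((X s - C (ζ s)) * pderiv s p - C α * pderiv (sw s) (pderiv s p)) =
      ((X s - C (ζ s)) * pderiv s (pderiv i p) - C α * pderiv (sw s) (pderiv s (pderiv i p)))
        + (if s = i then pderiv s p else 0) := by
    intro s
    rw [map_sub, pderiv_mul, pderiv_C_mul, pderiv_comm i s, pderiv_comm i (sw s), pderiv_comm i s]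
    simp only [map_sub, pderiv_X, pderiv_C, sub_zero, Pi.single_apply]
    split_ifs <;> simp
    ring
  simp only [this, Finset.sum_add_distrib]
  simp

omit [Fintype σ] in
theorem degree_tsub_single [DecidableEq σ] {m : σ →₀ ℕ} {s : σ} (h : m s ≠ 0) :
    (m - Finsupp.single s 1).degree + 1 = m.degree := by
  have h1 : Finsupp.single s 1 ≤ m := by
    rw [Finsupp.single_le_iff]; exact Nat.one_le_iff_ne_zero.mpr h
  conv_rhs => rw [← tsub_add_cancel_of_le h1]
  simp

/-- By Euler's identity `N` multiplies a monomial by its degree, up to terms of lower degree.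
Induction on the degree therefore inverts `N` modulo constants. -/
theorem monomial_mem_range_numOp (sw : σ → σ) (ζ : σ → ℂ) (α : ℂ) (d : ℕ) :
    ∀ (m : σ →₀ ℕ) (c : ℂ), m.degree ≤ d →
      monomial m c ∈ LinearMap.range (numOp sw ζ α) ⊔ Submodule.span ℂ {1} := by
  classical
  have h0 : ∀ (m : σ →₀ ℕ) (c : ℂ), m.degree = 0 →
      monomial m c ∈ LinearMap.range (numOp sw ζ α) ⊔ Submodule.span ℂ {1} := by
    intro m c hm
    rw [Finsupp.degree_eq_zero_iff] at hm
    subst hm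
    refine Submodule.mem_sup_right ?_
    rw [Submodule.mem_span_singleton]
    exact ⟨c, by rw [smul_eq_C_mul, mul_one, C_apply]⟩
  induction d with
  | zero => exact fun m c hm => h0 m c (by omega)
  | succ d ih =>
    intro m c hm
    by_cases hm0 : m.degree = 0
    · exact h0 m c hm0
    set W := LinearMap.range (numOp sw ζ α) ⊔ Submodule.span ℂ {(1 : MvPolynomial σ ℂ)}
    have key : ∀ s (e : σ →₀ ℕ) (b : ℂ), e.degree ≤ d + 1 →
        ∃ (e' : σ →₀ ℕ) (b' : ℂ), e'.degree ≤ d ∧ pderiv s (monomial e b) = monomial e' b' := by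
      intro s e b he
      rw [pderiv_monomial]
      by_cases hs : e s = 0
      · exact ⟨0, 0, by simp, by simp [hs]⟩
      · have := degree_tsub_single hs
        exact ⟨_, _, by omega, rfl⟩
    have hN : m.degree • monomial m c = numOp sw ζ α (monomial m c) +
        ∑ s, (ζ s • pderiv s (monomial m c) + α • pderiv (sw s) (pderiv s (monomial m c))) := by
      rw [numOp_apply, ← Finset.sum_add_distrib, Finsupp.degree_eq_sum, Finset.sum_smul]
      refine Finset.sum_congr rfl fun s _ => ?_
      rw [← X_mul_pderiv_monomial]
      simp only [smul_eq_C_mul]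
      ring
    have hmem : m.degree • monomial m c ∈ W := by
      rw [hN]
      refine add_mem (Submodule.mem_sup_left ⟨_, rfl⟩) (sum_mem fun s _ => ?_)
      obtain ⟨e, b, he, hb⟩ := key s m c hm
      obtain ⟨e', b', he', hb'⟩ := key (sw s) e b (by omega)
      rw [hb, hb']
      exact add_mem (W.smul_mem _ (ih _ _ he)) (W.smul_mem _ (ih _ _ he'))
    have : monomial m c = ((m.degree : ℂ)⁻¹) • (m.degree • monomial m c) := by
      rw [← Nat.cast_smul_eq_nsmul ℂ, smul_smul, inv_mul_cancel₀ (by exact_mod_cast hm0), one_smul]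
    rw [this]
    exact W.smul_mem _ hmem

theorem exists_eq_numOp_add_C (sw : σ → σ) (ζ : σ → ℂ) (α : ℂ) (p : MvPolynomial σ ℂ) :
    ∃ r c, p = numOp sw ζ α r + C c := by
  have : p ∈ LinearMap.range (numOp sw ζ α) ⊔ Submodule.span ℂ {1} := by
    induction p using MvPolynomial.induction_on' with
    | monomial m c => exact monomial_mem_range_numOp sw ζ α _ m c le_rfl
    | add p q hp hq => exact add_mem hp hq
  obtain ⟨y, ⟨r, rfl⟩, z, hz, rfl⟩ := Submodule.mem_sup.mp this
  obtain ⟨c, rfl⟩ := Submodule.mem_span_singleton.mp hz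
  exact ⟨r, c, by rw [smul_eq_C_mul, mul_one]⟩

/-- `IsPolyDeg d p`: all partial derivatives of `p` of order `d + 1` vanish. -/
def IsPolyDeg : ℕ → MvPolynomial σ ℂ → Prop
  | 0, p => ∀ s, pderiv s p = 0
  | d + 1, p => ∀ s, IsPolyDeg d (pderiv s p)

omit [Fintype σ] in
theorem isPolyDeg_zero (d : ℕ) : IsPolyDeg d (0 : MvPolynomial σ ℂ) := by
  induction d with
  | zero => intro s; simp
  | succ d ih => intro s; simpa using ih

omit [Fintype σ] in
theorem IsPolyDeg.add {d : ℕ} : ∀ {p q : MvPolynomial σ ℂ}, IsPolyDeg d p → IsPolyDeg d q →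
    IsPolyDeg d (p + q) := by
  induction d with
  | zero => intro p q hp hq s; rw [map_add, hp s, hq s, add_zero]
  | succ d ih => intro p q hp hq s; rw [map_add]; exact ih (hp s) (hq s)

omit [Fintype σ] in
theorem IsPolyDeg.succ {d : ℕ} : ∀ {p : MvPolynomial σ ℂ}, IsPolyDeg d p →
    IsPolyDeg (d + 1) p := by
  induction d with
  | zero => intro p hp s; rw [hp s]; exact isPolyDeg_zero 0
  | succ d ih => intro p hp s; exact ih (hp s)

omit [Fintype σ] in
theorem IsPolyDeg.mono {d e : ℕ} {p : MvPolynomial σ ℂ} (h : IsPolyDeg d p) (hde : d ≤ e) :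
    IsPolyDeg e p := by
  induction e, hde using Nat.le_induction with
  | base => exact h
  | succ e _ ih => exact ih.succ

omit [Fintype σ] in
theorem isPolyDeg_of_isHomogeneous {d : ℕ} : ∀ {p : MvPolynomial σ ℂ}, p.IsHomogeneous d →
    IsPolyDeg d p := by
  induction d with
  | zero =>
    intro p hp s
    rw [totalDegree_eq_zero_iff_eq_C.mp (Nat.le_zero.mp hp.totalDegree_le), pderiv_C]
  | succ d ih => intro p hp s; exact ih hp.pderiv

theorem exists_isPolyDeg (p : MvPolynomial σ ℂ) : ∃ d, IsPolyDeg d p := by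
  induction p using MvPolynomial.induction_on' with
  | monomial m c => exact ⟨m.degree, isPolyDeg_of_isHomogeneous (isHomogeneous_monomial c rfl)⟩
  | add p q hp hq =>
    obtain ⟨d, hd⟩ := hp
    obtain ⟨e, he⟩ := hq
    exact ⟨max d e, (hd.mono (le_max_left _ _)).add (he.mono (le_max_right _ _))⟩

/-- The sum over all derivatives of order `k` of `E (∂ p) conj (E (∂ q))`, where
`E p = B p 1`. -/
def derivSum (B : MvPolynomial σ ℂ →ₗ[ℂ] MvPolynomial σ ℂ →ₗ⋆[ℂ] ℂ) :
    ℕ → MvPolynomial σ ℂ → MvPolynomial σ ℂ → ℂ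
  | 0, p, q => B p 1 * conj (B q 1)
  | k + 1, p, q => ∑ s, derivSum B k (pderiv s p) (pderiv s q)

variable {B : MvPolynomial σ ℂ →ₗ[ℂ] MvPolynomial σ ℂ →ₗ⋆[ℂ] ℂ}

theorem derivSum_add_left (k : ℕ) : ∀ p p' q, derivSum B k (p + p') q =
    derivSum B k p q + derivSum B k p' q := by
  induction k with
  | zero => intro p p' q; simp [derivSum, add_mul]
  | succ k ih => intro p p' q; simp [derivSum, ih, Finset.sum_add_distrib]

open ComplexOrder in
theorem derivSum_self_nonneg (k : ℕ) : ∀ p, 0 ≤ derivSum B k p p := by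
  induction k with
  | zero => intro p; simp only [derivSum]; rw [Complex.mul_conj]; exact_mod_cast Complex.normSq_nonneg _
  | succ k ih => intro p; exact Finset.sum_nonneg fun s _ => ih _

namespace IsGaussianForm

variable {sw : σ → σ} {ζ : σ → ℂ} {α β : ℂ} (h : IsGaussianForm B sw ζ α β)
include h

/-- When `X_mul` is applied to `∂ₛ p`, the mean and the `α` term are exactly what `numOp` subtracts;
only the `β` term survives. -/
theorem numOp_left (p q : MvPolynomial σ ℂ) :
    B (numOp sw ζ α p) q = β * ∑ s, B (pderiv s p) (pderiv s q) := by
  rw [numOp_apply, map_sum, LinearMap.sum_apply, Finset.mul_sum]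
  refine Finset.sum_congr rfl fun s _ => ?_
  rw [sub_mul, ← smul_eq_C_mul, ← smul_eq_C_mul]
  simp only [map_sub, map_smul, LinearMap.sub_apply, LinearMap.smul_apply, h.X_mul, smul_eq_mul]
  ring

theorem exp_numOp (p : MvPolynomial σ ℂ) : B (numOp sw ζ α p) 1 = 0 := by
  rw [h.numOp_left]; simp

theorem derivSum_numOp (k : ℕ) : ∀ p q,
    derivSum B k (numOp sw ζ α p) q = k * derivSum B k p q := by
  induction k with
  | zero => intro p q; simp [derivSum, h.exp_numOp]
  | succ k ih =>
    intro p q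
    simp only [derivSum, pderiv_numOp, derivSum_add_left, ih, Finset.mul_sum]
    refine Finset.sum_congr rfl fun s _ => ?_
    push_cast; ring

/-- Stroock's formula: the chaos expansion of a Gaussian form. -/
theorem eq_sum_derivSum (d : ℕ) : ∀ q, IsPolyDeg d q → ∀ p,
    B p q = ∑ k ∈ Finset.range (d + 1), β ^ k / (k.factorial : ℂ) * derivSum B k p q := by
  -- Solve `p = N r + c`. The constant gives the product of means and `N r` gives a sum over first
  -- derivatives, to which the induction on the degree of `q` applies. Since `N` multiplies the sum
  -- of order `k + 1` by `k + 1`, trading `r` back for `p` builds up the factor `1 / k!`.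
  have base : ∀ p q, ∃ r, B p q = derivSum B 0 p q + β * ∑ s, B (pderiv s r) (pderiv s q) ∧
      ∀ k, derivSum B (k + 1) p q = (k + 1 : ℂ) * derivSum B (k + 1) r q := by
    intro p q
    obtain ⟨r, c, rfl⟩ := exists_eq_numOp_add_C sw ζ α p
    refine ⟨r, ?_, fun k => ?_⟩
    · have hC : ∀ q', B (C c) q' = c * B 1 q' := by
        intro q'
        rw [← mul_one (C c), ← smul_eq_C_mul]; simp
      simp only [map_add, LinearMap.add_apply, derivSum, h.numOp_left, hC, h.one_one]
      rw [h.symm 1 q]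
      simp; ring
    · rw [derivSum_add_left, h.derivSum_numOp]
      have : ∀ s, pderiv s (C c : MvPolynomial σ ℂ) = 0 := fun s => pderiv_C
      have h0 : ∀ k q', derivSum B k 0 q' = 0 := by
        intro k q'
        have := derivSum_add_left (B := B) k 0 0 q'
        simpa using this
      simp [derivSum, h0]
  induction d with
  | zero =>
    intro q hq p
    obtain ⟨r, hr, -⟩ := base p q
    rw [hr]
    have : ∀ s, pderiv s q = 0 := hq
    simp [this]
  | succ d ih =>
    intro q hq p
    obtain ⟨r, hr, hk⟩ := base p q
    rw [hr, Finset.sum_range_succ', add_comm]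
    congr 1
    · rw [Finset.sum_congr rfl fun s _ => ih _ (hq s) _, Finset.sum_comm, Finset.mul_sum]
      refine Finset.sum_congr rfl fun k _ => ?_
      rw [← Finset.mul_sum, hk, Nat.factorial_succ]
      have : (k.factorial : ℂ) ≠ 0 := by exact_mod_cast k.factorial_ne_zero
      have : (k + 1 : ℂ) ≠ 0 := by exact_mod_cast k.succ_ne_zero
      simp only [derivSum]
      push_cast
      field_simp
      ring
    · simp

open ComplexOrder in
/-- The Gaussian Poincaré inequality for holomorphic polynomials. -/
theorem poincare (hβ : 0 ≤ β) (p : MvPolynomial σ ℂ) :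
    B p p - B p 1 * conj (B p 1) ≤ β * ∑ s, B (pderiv s p) (pderiv s p) := by
  obtain ⟨d, hd⟩ := exists_isPolyDeg p
  rw [h.eq_sum_derivSum _ p hd.succ, Finset.sum_range_succ',
    Finset.sum_congr rfl fun s _ => h.eq_sum_derivSum d _ (hd.succ s) _, Finset.sum_comm,
    Finset.mul_sum]
  have e0 : β ^ 0 / ((Nat.factorial 0 : ℕ) : ℂ) * derivSum B 0 p p = B p 1 * conj (B p 1) := by
    simp [derivSum]
  rw [e0, add_sub_cancel_right]
  -- Compare chaos by chaos: order `k + 1` carries `β^(k+1) / (k+1)!` on the left and `β * β^k / k!`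
  -- on the right, times the same nonnegative sum.
  refine Finset.sum_le_sum fun k _ => ?_
  rw [← Finset.mul_sum]
  have e1 : ∑ s, derivSum B k (pderiv s p) (pderiv s p) = derivSum B (k + 1) p p := rfl
  rw [e1, ← mul_assoc]
  refine mul_le_mul_of_nonneg_right ?_ (derivSum_self_nonneg _ _)
  rw [pow_succ', mul_div_assoc]
  refine mul_le_mul_of_nonneg_left ?_ hβ
  refine div_le_div_of_nonneg_left (pow_nonneg hβ k) ?_ ?_
  · exact_mod_cast k.factorial_pos
  · exact_mod_cast Nat.factorial_le k.le_succ

end IsGaussianForm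

end GaussianForm
end EllipticGinibre

namespace EllipticGinibre

/-! ### Second moment of the determinant of a Gaussian matrix -/

section Determinant

open MvPolynomial ComplexConjugate

theorem derivation_prod {R A κ : Type*} [CommRing R] [CommRing A] [Algebra R A] [DecidableEq κ]
    (D : Derivation R A A) (s : Finset κ) (f : κ → A) :
    D (∏ i ∈ s, f i) = ∑ i ∈ s, D (f i) * ∏ j ∈ s.erase i, f j := by
  induction s using Finset.induction_on with
  | empty => simp
  | insert a s ha ih =>
    rw [Finset.prod_insert ha, Derivation.leibniz, ih, Finset.sum_insert ha,
      Finset.erase_insert ha, smul_eq_mul, smul_eq_mul, Finset.mul_sum, add_comm]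
    congr 1
    · ring
    · refine Finset.sum_congr rfl fun i hi => ?_
      have hai : a ≠ i := fun h => ha (h ▸ hi)
      rw [Finset.erase_insert_of_ne hai, Finset.prod_insert (by simp [ha])]
      ring

/-- Jacobi's formula for derivations. -/
theorem derivation_det {R A κ : Type*} [CommRing R] [CommRing A] [Algebra R A] [Fintype κ]
    [DecidableEq κ] (D : Derivation R A A) (M : Matrix κ κ A) :
    D M.det = ∑ i, (M.updateRow i fun j => D (M i j)).det := by
  have hdet : ∀ N : Matrix κ κ A, N.det =
      ∑ π : Equiv.Perm κ, ((Equiv.Perm.sign π : ℤ) : A) * ∏ i, N i (π i) := by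
    intro N
    rw [← Matrix.det_transpose, Matrix.det_apply']
    rfl
  rw [hdet M, map_sum, Finset.sum_congr rfl fun i _ => hdet _, Finset.sum_comm]
  refine Finset.sum_congr rfl fun π _ => ?_
  rw [Derivation.leibniz, Derivation.map_intCast, smul_zero, add_zero, smul_eq_mul,
    derivation_prod, Finset.mul_sum]
  refine Finset.sum_congr rfl fun i _ => ?_
  rw [← Finset.mul_prod_erase _ _ (Finset.mem_univ i)]
  simp only [Matrix.updateRow_self]
  congr 2
  refine Finset.prod_congr rfl fun j hj => ?_
  rw [Matrix.updateRow_ne (Finset.ne_of_mem_erase hj)]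

variable {n : ℕ}

/-- The generic matrix in which row `l` is replaced by the unit vector `e j` when
`f l = some j`. -/
def partialGeneric (f : Fin n → Option (Fin n)) :
    Matrix (Fin n) (Fin n) (MvPolynomial (Fin n × Fin n) ℂ) :=
  fun l => match f l with
    | none => fun m => X (l, m)
    | some j => Pi.single j 1

theorem partialGeneric_none {f : Fin n → Option (Fin n)} {l : Fin n} (h : f l = none) :
    partialGeneric f l = fun m => X (l, m) := by simp [partialGeneric, h]

theorem partialGeneric_some {f : Fin n → Option (Fin n)} {l j : Fin n} (h : f l = some j) :
    partialGeneric f l = Pi.single j 1 := by simp [partialGeneric, h]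

/-- The determinant is linear in each row, so a derivative turns a generic row into a unit vector
and kills a row that is already constant. All iterated derivatives of the generic determinant thus
stay in this family. -/
theorem pderiv_det_partialGeneric (f : Fin n → Option (Fin n)) (s : Fin n × Fin n) :
    pderiv s (partialGeneric f).det =
      if f s.1 = none then (partialGeneric (Function.update f s.1 (some s.2))).det else 0 := by
  obtain ⟨i, j⟩ := s
  rw [derivation_det, Finset.sum_eq_single i]
  · split_ifs with h
    · dsimp only at h ⊢
      congr 1
      refine Matrix.ext fun l m => ?_
      by_cases hl : l = i
      · subst hl
        rw [Matrix.updateRow_self, partialGeneric_none h, partialGeneric_some (j := j) (by simp)]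
        simp [pderiv_X, Pi.single_apply, eq_comm]
      · rw [Matrix.updateRow_ne hl]
        simp [partialGeneric, hl]
    · obtain ⟨j', hj'⟩ := Option.ne_none_iff_exists'.mp h
      refine Matrix.det_eq_zero_of_row_eq_zero i fun m => ?_
      rw [Matrix.updateRow_self, partialGeneric_some hj']
      by_cases hm : m = j' <;> simp [hm]
  · intro l _ hl
    refine Matrix.det_eq_zero_of_row_eq_zero l fun m => ?_
    rw [Matrix.updateRow_self]
    cases hf : f l with
    | none =>
      rw [partialGeneric_none hf]
      exact pderiv_X_of_ne (by simp [hl])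
    | some j' =>
      rw [partialGeneric_some hf]
      by_cases hm : m = j' <;> simp [hm]
  · simp

/-- The determinant of the generic matrix. -/
def genDet (n : ℕ) : MvPolynomial (Fin n × Fin n) ℂ := (partialGeneric fun _ => none).det

theorem genDet_isHomogeneous (n : ℕ) : (genDet n).IsHomogeneous n := by
  rw [genDet, Matrix.det_apply]
  refine IsHomogeneous.sum _ _ _ fun π _ => ?_
  have : (∏ i, partialGeneric (fun _ : Fin n => none) (π i) i).IsHomogeneous n := by
    have := IsHomogeneous.prod Finset.univ
      (fun i => partialGeneric (fun _ : Fin n => none) (π i) i) (fun _ => 1)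
      (fun i _ => by rw [partialGeneric_none rfl]; exact isHomogeneous_X _ _)
    simpa using this
  rcases Int.units_eq_one_or (Equiv.Perm.sign π) with h | h <;> rw [h]
  · simpa using this
  · simpa using this.neg

/-- The derivative in the direction of the identity matrix. -/
def idDeriv (p : MvPolynomial (Fin n × Fin n) ℂ) : MvPolynomial (Fin n × Fin n) ℂ :=
  ∑ i, pderiv (i, i) p

/-- The two sides have the unit vectors in rows `i` and `j` exchanged, hence the sign; for `i = j`
both vanish. Through this antisymmetry the correlation of the entries `(i, j)` and `(j, i)` only
acts by the square of `idDeriv`. -/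
theorem pderiv_pderiv_swap_genDet (i j : Fin n) :
    pderiv (j, i) (pderiv (i, j) (genDet n)) = - pderiv (i, i) (pderiv (j, j) (genDet n)) := by
  simp only [genDet, pderiv_det_partialGeneric, if_true]
  by_cases h : i = j
  · subst h; simp
  · rw [if_pos (by simp [Ne.symm h]), if_pos (by simp [h])]
    have := Matrix.det_permute (Equiv.swap i j)
      (partialGeneric (Function.update (Function.update (fun _ => none) j (some j)) i (some i)))
    rw [Equiv.Perm.sign_swap h] at this
    simp only [Units.val_neg, Units.val_one, Int.cast_neg, Int.cast_one, neg_mul, one_mul] at this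
    rw [← this]
    congr 1
    refine Matrix.ext fun l m => ?_
    rw [Matrix.submatrix_apply, id]
    by_cases hj : l = j
    · subst hj
      rw [Equiv.swap_apply_right, partialGeneric_some (j := i) (by simp),
        partialGeneric_some (j := i) (by simp)]
    · by_cases hi : l = i
      · subst hi
        rw [Equiv.swap_apply_left, partialGeneric_some (j := j) (by simp [h]),
          partialGeneric_some (j := j) (by simp [Ne.symm h])]
      · rw [Equiv.swap_apply_of_ne_of_ne hi hj, partialGeneric_none (by simp [hi, hj]),
          partialGeneric_none (by simp [hi, hj])]

/-- Homogeneous polynomials of degree `j` satisfying the differential equation of the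
determinant. -/
structure IsDetLike (j : ℕ) (p : MvPolynomial (Fin n × Fin n) ℂ) : Prop where
  homog : p.IsHomogeneous j
  swap : ∑ s : Fin n × Fin n, pderiv s.swap (pderiv s p) = - idDeriv (idDeriv p)

theorem idDeriv_pderiv (s : Fin n × Fin n) (p : MvPolynomial (Fin n × Fin n) ℂ) :
    idDeriv (pderiv s p) = pderiv s (idDeriv p) := by
  simp [idDeriv, pderiv_comm s]

theorem IsDetLike.pderiv {j : ℕ} {p : MvPolynomial (Fin n × Fin n) ℂ} (hp : IsDetLike (j + 1) p)
    (s : Fin n × Fin n) : IsDetLike j (pderiv s p) where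
  homog := hp.homog.pderiv
  swap := by
    rw [idDeriv_pderiv, idDeriv_pderiv, ← map_neg, ← hp.swap, map_sum]
    refine Finset.sum_congr rfl fun r _ => ?_
    rw [pderiv_comm r s, pderiv_comm r.swap s]

theorem IsDetLike.idDeriv {j : ℕ} {p : MvPolynomial (Fin n × Fin n) ℂ}
    (hp : IsDetLike (j + 1) p) : IsDetLike j (idDeriv p) where
  homog := IsHomogeneous.sum _ _ _ fun i _ => (hp.pderiv (i, i)).homog
  swap := by
    have e : ∀ s, MvPolynomial.pderiv s (EllipticGinibre.idDeriv p) =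
      ∑ i, MvPolynomial.pderiv s (MvPolynomial.pderiv (i, i) p) := by
      intro s; simp [EllipticGinibre.idDeriv]
    simp only [e, map_sum]
    rw [Finset.sum_comm, Finset.sum_congr rfl fun i _ => (hp.pderiv (i, i)).swap]
    simp only [idDeriv_pderiv, Finset.sum_neg_distrib]
    simp [EllipticGinibre.idDeriv]

theorem isDetLike_genDet (n : ℕ) : IsDetLike n (genDet n) where
  homog := genDet_isHomogeneous n
  swap := by
    rw [Fintype.sum_prod_type]
    simp only [Prod.swap, pderiv_pderiv_swap_genDet, idDeriv, map_sum, Finset.sum_neg_distrib]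

/-- The rescaled Hermite recursion. -/
def hermiteSeq (z α : ℂ) : ℕ → ℂ
  | 0 => 1
  | 1 => z
  | m + 2 => z * hermiteSeq z α (m + 1) - α * (m + 1) * hermiteSeq z α m

/-- Evaluation at the identity matrix. -/
def evalOne (p : MvPolynomial (Fin n × Fin n) ℂ) : ℂ :=
  eval (fun s => if s.1 = s.2 then 1 else 0) p

theorem IsDetLike.evalOne_idDeriv {j : ℕ} {p : MvPolynomial (Fin n × Fin n) ℂ}
    (hp : IsDetLike j p) : evalOne (EllipticGinibre.idDeriv p) = j * evalOne p := by
  have h := congrArg evalOne hp.homog.sum_X_mul_pderiv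
  simp only [evalOne, map_sum, map_mul, eval_X, nsmul_eq_mul, map_natCast,
    Fintype.sum_prod_type] at h
  rw [← evalOne] at h
  rw [evalOne, ← h, EllipticGinibre.idDeriv]
  simp

variable {B : MvPolynomial (Fin n × Fin n) ℂ →ₗ[ℂ] MvPolynomial (Fin n × Fin n) ℂ →ₗ⋆[ℂ] ℂ}
  {z α β : ℂ}

theorem IsDetLike.eq_C {p : MvPolynomial (Fin n × Fin n) ℂ} (hp : IsDetLike 0 p) :
    p = C (coeff 0 p) :=
  totalDegree_eq_zero_iff_eq_C.mp (Nat.le_zero.mp hp.homog.totalDegree_le)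

/-- The mean of a derivative of the determinant is a multiple of a Hermite polynomial. -/
theorem IsGaussianForm.exp_detLike
    (h : IsGaussianForm B Prod.swap (fun s => if s.1 = s.2 then z else 0) α β) (j : ℕ) :
    ∀ p, IsDetLike j p → B p 1 = evalOne p * hermiteSeq z α j := by
  have h0 : ∀ p, IsDetLike 0 p → B p 1 = evalOne p := by
    intro p hp
    rw [hp.eq_C]
    have : B (C (coeff 0 p)) 1 = coeff 0 p * B 1 1 := by
      rw [← mul_one (C (coeff 0 p)), ← smul_eq_C_mul]; simp
    rw [this, h.one_one, evalOne]; simp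
  -- Euler's identity for a homogeneous polynomial, then integration by parts: the mean contributes
  -- `z D p` and, by `hp.swap`, the relation contributes `-α D² p`, with `D = idDeriv`. At the
  -- identity matrix the two applications of `D` pick up the factors `j` and `j - 1`, which yields
  -- the Hermite recursion.
  have step : ∀ j p, IsDetLike j p →
      (j : ℂ) * B p 1 = z * B (idDeriv p) 1 - α * B (idDeriv (idDeriv p)) 1 := by
    intro j p hp
    have e := congrArg (fun q => B q 1) hp.homog.sum_X_mul_pderiv
    simp only [map_sum, LinearMap.sum_apply, h.X_mul, pderiv_one, map_zero, mul_zero, add_zero,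
      map_nsmul, LinearMap.smul_apply, Finset.sum_add_distrib] at e
    rw [← nsmul_eq_mul, ← e, sub_eq_add_neg]
    congr 1
    · rw [Fintype.sum_prod_type]
      simp [idDeriv, Finset.mul_sum]
    · rw [← Finset.mul_sum, ← mul_neg]
      congr 1
      rw [← LinearMap.neg_apply, ← map_neg, ← hp.swap]
      simp
  induction j using Nat.twoStepInduction with
  | zero => intro p hp; rw [h0 p hp, hermiteSeq, mul_one]
  | one =>
    intro p hp
    have := step 1 p hp
    have hI : idDeriv (idDeriv p) = 0 := by
      rw [hp.idDeriv.eq_C]; simp [idDeriv]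
    rw [hI, h0 _ hp.idDeriv, hp.evalOne_idDeriv] at this
    simp at this
    rw [this, hermiteSeq, mul_comm]
  | more j ih0 ih1 =>
    intro p hp
    have := step (j + 2) p hp
    rw [ih1 _ hp.idDeriv, ih0 _ hp.idDeriv.idDeriv, hp.idDeriv.evalOne_idDeriv,
      hp.evalOne_idDeriv] at this
    have hj : ((j + 2 : ℕ) : ℂ) ≠ 0 := by exact_mod_cast (j + 1).succ_ne_zero
    apply mul_left_cancel₀ hj
    rw [this, hermiteSeq]
    push_cast; ring

/-- The sum of `|∂ p (1)| ^ 2` over all derivatives of order `k`. -/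
def evalSum : ℕ → MvPolynomial (Fin n × Fin n) ℂ → ℝ
  | 0, p => ‖evalOne p‖ ^ 2
  | k + 1, p => ∑ s, evalSum k (pderiv s p)

theorem IsGaussianForm.derivSum_detLike
    (h : IsGaussianForm B Prod.swap (fun s => if s.1 = s.2 then z else 0) α β) (k : ℕ) :
    ∀ j p, IsDetLike (j + k) p →
      derivSum B k p p = ((‖hermiteSeq z α j‖ ^ 2 * evalSum k p : ℝ) : ℂ) := by
  induction k with
  | zero =>
    intro j p hp
    rw [derivSum, h.exp_detLike _ p hp, Complex.mul_conj, Complex.normSq_eq_norm_sq, norm_mul,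
      evalSum, mul_pow, mul_comm]
    rfl
  | succ k ih =>
    intro j p hp
    simp only [derivSum, evalSum, Finset.mul_sum, Complex.ofReal_sum]
    exact Finset.sum_congr rfl fun s _ => ih j _ (hp.pderiv s)

/-- Iterated partial derivatives. -/
def iterPderiv : ∀ {k : ℕ}, (Fin k → Fin n × Fin n) → MvPolynomial (Fin n × Fin n) ℂ →
    MvPolynomial (Fin n × Fin n) ℂ
  | 0, _, p => p
  | _ + 1, v, p => iterPderiv (Fin.tail v) (pderiv (v 0) p)

theorem iterPderiv_zero {k : ℕ} : ∀ v : Fin k → Fin n × Fin n, iterPderiv v 0 = 0 := by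
  induction k with
  | zero => intro v; rfl
  | succ k ih => intro v; simp [iterPderiv, ih]

theorem evalSum_eq_sum (k : ℕ) : ∀ p : MvPolynomial (Fin n × Fin n) ℂ,
    evalSum k p = ∑ v : Fin k → Fin n × Fin n, ‖evalOne (iterPderiv v p)‖ ^ 2 := by
  induction k with
  | zero => intro p; simp [evalSum, iterPderiv]
  | succ k ih =>
    intro p
    rw [← (Fin.consEquiv fun _ => Fin n × Fin n).sum_comp, Fintype.sum_prod_type, evalSum]
    refine Finset.sum_congr rfl fun s _ => ?_
    rw [ih]
    refine Finset.sum_congr rfl fun v _ => ?_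
    simp [iterPderiv, Fin.consEquiv]

theorem evalOne_det_partialGeneric (f : Fin n → Option (Fin n)) :
    evalOne (partialGeneric f).det =
      (Matrix.of fun l m => if (f l).getD l = m then (1 : ℂ) else 0).det := by
  rw [evalOne, RingHom.map_det]
  congr 1
  ext l m
  rw [RingHom.mapMatrix_apply, Matrix.map_apply, Matrix.of_apply]
  cases hf : f l with
  | none => rw [partialGeneric_none hf]; simp
  | some j => rw [partialGeneric_some hf]; by_cases hm : m = j <;> simp [hm, eq_comm]

/-- At the identity matrix every row has become a unit vector, so the determinant is the sign of a
permutation `φ` or `0`. A nonzero value requires the differentiated rows to be distinct and the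
prescribed columns to extend to `φ`; rows without a prescription are fixed by `φ`. -/
theorem evalOne_iterPderiv {k : ℕ} : ∀ (v : Fin k → Fin n × Fin n) (f : Fin n → Option (Fin n)),
    ‖evalOne (iterPderiv v (partialGeneric f).det)‖ ≤ 1 ∧
    (evalOne (iterPderiv v (partialGeneric f).det) ≠ 0 →
      Function.Injective (fun l => (v l).1) ∧ (∀ l, f (v l).1 = none) ∧
      ∃ φ : Equiv.Perm (Fin n), (∀ l, φ (v l).1 = (v l).2) ∧
        ∀ x, (∀ l, (v l).1 ≠ x) → φ x = (f x).getD x) := by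
  induction k with
  | zero =>
    intro v f
    simp only [iterPderiv, evalOne_det_partialGeneric]
    by_cases hinj : Function.Injective fun l => (f l).getD l
    · let φ : Equiv.Perm (Fin n) := Equiv.ofBijective _ (Finite.injective_iff_bijective.mp hinj)
      have : (Matrix.of fun l m => if (f l).getD l = m then (1 : ℂ) else 0) =
          φ.toPEquiv.toMatrix := by
        ext l m
        simp [PEquiv.toMatrix_apply, φ, eq_comm]
      rw [this]
      refine ⟨?_, fun _ => ⟨fun l => l.elim0, fun l => l.elim0, φ, fun l => l.elim0, fun x _ => rfl⟩⟩
      rw [Matrix.det_permutation]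
      rcases Int.units_eq_one_or (Equiv.Perm.sign φ) with h | h <;> simp [h]
    · have : (Matrix.of fun l m => if (f l).getD l = m then (1 : ℂ) else 0).det = 0 := by
        simp only [Function.Injective, not_forall] at hinj
        obtain ⟨a, b, hab, hne⟩ := hinj
        refine Matrix.det_zero_of_row_eq hne ?_
        ext m
        simp [hab]
      simp [this]
  | succ k ih =>
    intro v f
    simp only [iterPderiv, pderiv_det_partialGeneric]
    split_ifs with hf
    · obtain ⟨h1, h2⟩ := ih (Fin.tail v) (Function.update f (v 0).1 (some (v 0).2))
      refine ⟨h1, fun hne => ?_⟩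
      obtain ⟨hi, hn, φ, hφ1, hφ2⟩ := h2 hne
      have hne0 : ∀ l : Fin k, (Fin.tail v l).1 ≠ (v 0).1 := by
        intro l hl
        have := hn l
        rw [hl] at this
        simp at this
      refine ⟨?_, ?_, φ, ?_, ?_⟩
      · intro a b hab
        induction a using Fin.cases with
        | zero =>
          induction b using Fin.cases with
          | zero => rfl
          | succ b => exact absurd hab.symm (hne0 b)
        | succ a =>
          induction b using Fin.cases with
          | zero => exact absurd hab (hne0 a)
          | succ b => exact congrArg Fin.succ (hi hab)
      · intro l
        induction l using Fin.cases with
        | zero => exact hf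
        | succ l =>
          have := hn l
          rwa [Function.update_of_ne (hne0 l)] at this
      · intro l
        induction l using Fin.cases with
        | zero => rw [hφ2 _ hne0]; simp
        | succ l => exact hφ1 l
      · intro x hx
        rw [hφ2 x fun l => hx l.succ, Function.update_of_ne (hx 0).symm]
    · rw [iterPderiv_zero]; simp [evalOne]

theorem evalSum_genDet_le (k : ℕ) :
    evalSum k (genDet n) ≤ (n.descFactorial k : ℝ) * k.factorial := by
  classical
  rw [evalSum_eq_sum]
  set S : Finset (Fin k → Fin n × Fin n) :=
    Finset.univ.filter fun v => evalOne (iterPderiv v (genDet n)) ≠ 0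
  have h1 : ∑ v : Fin k → Fin n × Fin n, ‖evalOne (iterPderiv v (genDet n))‖ ^ 2 ≤ S.card := by
    rw [← Finset.sum_filter_add_sum_filter_not Finset.univ
      (fun v => evalOne (iterPderiv v (genDet n)) ≠ 0)]
    have : ∑ v : Fin k → Fin n × Fin n with ¬ evalOne (iterPderiv v (genDet n)) ≠ 0,
        ‖evalOne (iterPderiv v (genDet n))‖ ^ 2 = 0 := by
      refine Finset.sum_eq_zero fun v hv => ?_
      have := (Finset.mem_filter.mp hv).2
      simp only [not_not] at this
      simp [this]
    rw [this, add_zero]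
    calc _ ≤ ∑ v ∈ S, (1 : ℝ) := Finset.sum_le_sum fun v _ =>
          pow_le_one₀ (norm_nonneg _) (evalOne_iterPderiv v _).1
      _ = S.card := by simp
  refine h1.trans ?_
  -- Here `φ` fixes all rows that are not differentiated, so it permutes the `k` differentiated
  -- ones: the columns are the rows rearranged by some `π`. Counting pairs (injection, `π`) gives
  -- the bound; its `k!` later cancels the `1 / k!` of the chaos expansion.
  have h2 : S ⊆ Finset.univ.image
      fun p : (Fin k ↪ Fin n) × Equiv.Perm (Fin k) => fun l => (p.1 l, p.1 (p.2 l)) := by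
    intro v hv
    obtain ⟨hi, -, φ, hφ1, hφ2⟩ := (evalOne_iterPderiv v _).2 (Finset.mem_filter.mp hv).2
    have hr : ∀ l, ∃ l', (v l').1 = (v l).2 := by
      intro l
      by_contra hcon
      push Not at hcon
      have := hφ2 _ hcon
      rw [← hφ1 l] at this
      have h3 := φ.injective (this.trans rfl)
      exact hcon l (by rw [← hφ1 l]; exact h3.symm)
    choose π hπ using hr
    have hπi : Function.Injective π := by
      intro a b hab
      have : (v a).2 = (v b).2 := by rw [← hπ a, ← hπ b, hab]
      rw [← hφ1, ← hφ1] at this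
      exact hi (φ.injective this)
    refine Finset.mem_image.mpr ⟨(⟨_, hi⟩,
      Equiv.ofBijective π (Finite.injective_iff_bijective.mp hπi)), Finset.mem_univ _, ?_⟩
    ext1 l
    exact Prod.ext rfl (hπ l)
  have h3 := (Finset.card_le_card h2).trans Finset.card_image_le
  rw [Finset.card_univ, Fintype.card_prod, Fintype.card_embedding_eq, Fintype.card_perm] at h3
  simp only [Fintype.card_fin] at h3
  exact_mod_cast h3

/-- The second moment of the determinant of a Gaussian matrix with mean `z • 1`. -/
theorem IsGaussianForm.det_le {b : ℝ} (hb : 0 ≤ b)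
    (h : IsGaussianForm B Prod.swap (fun s => if s.1 = s.2 then z else 0) α b) :
    (B (genDet n) (genDet n)).re ≤
      ∑ k ∈ Finset.range (n + 1), b ^ k * n.descFactorial k * ‖hermiteSeq z α (n - k)‖ ^ 2 := by
  rw [h.eq_sum_derivSum n _ (isPolyDeg_of_isHomogeneous (genDet_isHomogeneous n)), Complex.re_sum]
  refine Finset.sum_le_sum fun k hk => ?_
  have hkn : n - k + k = n := Nat.sub_add_cancel (by simpa [Nat.lt_succ_iff] using hk)
  rw [h.derivSum_detLike k (n - k) _ (by rw [hkn]; exact isDetLike_genDet n)]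
  have : ((b : ℂ) ^ k / (k.factorial : ℂ) *
      ((‖hermiteSeq z α (n - k)‖ ^ 2 * evalSum k (genDet n) : ℝ) : ℂ)).re =
      b ^ k / k.factorial * (‖hermiteSeq z α (n - k)‖ ^ 2 * evalSum k (genDet n)) := by
    rw [← Complex.ofReal_re (b ^ k / k.factorial * _)]
    push_cast
    rfl
  rw [this]
  have hf : (0 : ℝ) < k.factorial := by exact_mod_cast k.factorial_pos
  calc _ ≤ b ^ k / k.factorial *
        (‖hermiteSeq z α (n - k)‖ ^ 2 * ((n.descFactorial k : ℝ) * k.factorial)) := by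
        gcongr; exact evalSum_genDet_le k
    _ = _ := by field_simp

end Determinant
end EllipticGinibre

namespace EllipticGinibre

/-! ### Hermite asymptotics outside the ellipse -/

section HermiteBound

open Real

/-- Cauchy's estimate with the mean over the circle instead of the maximum. The mean keeps the decay
in `θ` that the Hermite bound needs, and for the random determinant it is a quantity whose
expectation is controlled by Tonelli. -/
theorem norm_iteratedDeriv_le_circle {f : ℂ → ℂ} (hf : Differentiable ℂ f) {ρ : ℝ} (hρ : 0 < ρ)
    (m : ℕ) : ‖iteratedDeriv m f 0‖ / m.factorial ≤
      ((2 * π)⁻¹ * ∫ θ in 0..2 * π, ‖f (circleMap 0 ρ θ)‖) * ρ⁻¹ ^ m := by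
  lift ρ to NNReal using hρ.le
  have h := hf.hasFPowerSeriesOnBall 0 (R := ρ) (by exact_mod_cast hρ)
  have h1 := h.factorial_smul (1 : ℂ) m
  rw [iteratedDeriv_eq_iteratedFDeriv, ← h1, nsmul_eq_mul, norm_mul, Complex.norm_natCast,
    mul_div_cancel_left₀ _ (by exact_mod_cast m.factorial_ne_zero)]
  refine le_trans ?_ ((norm_cauchyPowerSeries_le f 0 ρ m).trans_eq ?_)
  · refine ((cauchyPowerSeries f 0 ρ m).le_opNorm fun _ => (1 : ℂ)).trans_eq ?_
    simp
  · rw [abs_of_pos (by exact_mod_cast hρ)]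

theorem integral_exp_neg_one_sub_cos_le {l : ℝ} (hl : 0 < l) :
    ∫ θ in 0..2 * π, exp (-(l * (1 - cos θ))) ≤ π * √(π / (2 * l)) := by
  have hper : Function.Periodic (fun θ => exp (-(l * (1 - cos θ)))) (2 * π) := by
    intro θ; simp
  have h1 : ∫ θ in 0..2 * π, exp (-(l * (1 - cos θ))) =
      ∫ θ in (-π)..π, exp (-(l * (1 - cos θ))) := by
    have := hper.intervalIntegral_add_eq 0 (-π)
    rw [zero_add] at this
    rw [this]; congr 1; ring
  have hb : 0 < 2 * l / π ^ 2 := by positivity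
  rw [h1, intervalIntegral.integral_of_le (by linarith [pi_pos])]
  calc ∫ θ in Set.Ioc (-π) π, exp (-(l * (1 - cos θ)))
      ≤ ∫ θ in Set.Ioc (-π) π, exp (-(2 * l / π ^ 2) * θ ^ 2) := by
        refine setIntegral_mono_on ?_ (integrable_exp_neg_mul_sq hb).integrableOn
          measurableSet_Ioc fun θ hθ => ?_
        · exact (Continuous.integrableOn_Icc (by fun_prop)).mono_set Set.Ioc_subset_Icc_self
        -- The bound `1 - cos θ ≥ 2 θ² / π²` on `[-π, π]` reduces the integral to a Gaussian one.
        · have := cos_le_one_sub_mul_cos_sq (abs_le.mpr ⟨hθ.1.le, hθ.2⟩)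
          apply exp_le_exp.mpr
          have h2 : 2 / π ^ 2 * θ ^ 2 ≤ 1 - cos θ := by linarith
          have h3 := mul_le_mul_of_nonneg_left h2 hl.le
          have : -(2 * l / π ^ 2) * θ ^ 2 = -(l * (2 / π ^ 2 * θ ^ 2)) := by ring
          linarith
    _ ≤ ∫ θ, exp (-(2 * l / π ^ 2) * θ ^ 2) :=
        setIntegral_le_integral (integrable_exp_neg_mul_sq hb) (ae_of_all _ fun _ => (exp_pos _).le)
    _ = π * √(π / (2 * l)) := by
        rw [integral_gaussian]
        have : π / (2 * l / π ^ 2) = π ^ 2 * (π / (2 * l)) := by field_simp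
        rw [this, sqrt_mul (by positivity), sqrt_sq pi_pos.le]

theorem hasDerivAt_hermiteSeq (α : ℂ) (m : ℕ) : ∀ z, HasDerivAt (fun z => hermiteSeq z α m)
    (m * hermiteSeq z α (m - 1)) z := by
  induction m using Nat.twoStepInduction with
  | zero => intro z; simpa [hermiteSeq] using hasDerivAt_const z (1 : ℂ)
  | one => intro z; simpa [hermiteSeq] using hasDerivAt_id' z
  | more m ih0 ih1 =>
    intro z
    simp only [hermiteSeq]
    refine (((hasDerivAt_id z).mul (ih1 z)).sub
      ((ih0 z).const_mul (α * (m + 1)))).congr_deriv ?_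
    cases m with
    | zero => simp [hermiteSeq]; ring
    | succ m => simp [hermiteSeq]; ring

/-- The exponential generating function of the rescaled Hermite polynomials. -/
def hermiteGen (n : ℕ) (a y : ℂ) : ℂ := Complex.exp (n * ((1 + a) * y - a * y ^ 2 / 2))

theorem hasDerivAt_hermiteGen (n : ℕ) (a y : ℂ) :
    HasDerivAt (hermiteGen n a) (n * (1 + a - a * y) * hermiteGen n a y) y := by
  unfold hermiteGen
  have h : HasDerivAt (fun y : ℂ => n * ((1 + a) * y - a * y ^ 2 / 2))
      (n * (1 + a - a * y)) y := by
    refine ((((hasDerivAt_id' y).const_mul (1 + a)).sub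
      ((((hasDerivAt_id' y).pow 2).const_mul a).div_const 2)).const_mul (n : ℂ)).congr_deriv ?_
    push_cast
    ring
  exact h.cexp.congr_deriv (by ring)

/-- Only `y = 0` is used: there it exhibits the Hermite value at `1 + a` as a Taylor coefficient,
open to Cauchy's estimate. A general `y` is needed for the induction. -/
theorem iteratedDeriv_hermiteGen {n : ℕ} (hn : n ≠ 0) (a : ℂ) (m : ℕ) :
    iteratedDeriv m (hermiteGen n a) =
      fun y => n ^ m * hermiteSeq (1 + a - a * y) (a / n) m * hermiteGen n a y := by
  have hn' : (n : ℂ) ≠ 0 := by exact_mod_cast hn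
  induction m with
  | zero => ext y; simp [hermiteSeq]
  | succ m ih =>
    rw [iteratedDeriv_succ, ih]
    ext y
    have h1 : HasDerivAt (fun y : ℂ => 1 + a - a * y) (-a) y := by
      refine (((hasDerivAt_id y).const_mul a).const_sub (1 + a)).congr_deriv ?_
      simp
    have h2 := (hasDerivAt_hermiteSeq (a / n) m (1 + a - a * y)).comp y h1
    have h3 := (h2.const_mul ((n : ℂ) ^ m)).mul (hasDerivAt_hermiteGen n a y)
    refine (h3.congr_deriv ?_).deriv
    simp only [Function.comp]
    cases m with
    | zero => simp [hermiteSeq]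
    | succ m =>
      simp only [hermiteSeq, Nat.add_sub_cancel]
      push_cast
      field_simp
      ring

/-- Complete the square: `(1 + a) y - a y² / 2 = y - a (1 - y)² / 2 + a / 2`, and the factor `exp(-n
Re a / 2)` removes the last term. Since `‖1 - y‖² = (1 - ρ)² + 2ρ(1 - cos θ)`, the quadratic term
costs at most a fraction `‖a‖` of the decay `ρ(1 - cos θ)` contained in `Re y`. -/
theorem norm_hermiteGen_circle_le (n : ℕ) (a : ℂ) {ρ : ℝ} (hρ : 0 ≤ ρ) (θ : ℝ) :
    ‖hermiteGen n a (circleMap 0 ρ θ)‖ * exp (-(n * a.re / 2)) ≤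
      exp (n * (ρ + ‖a‖ * (1 - ρ) ^ 2 / 2)) *
        exp (-(n * (1 - ‖a‖) * ρ * (1 - cos θ))) := by
  rw [hermiteGen, Complex.norm_exp, ← exp_add, ← exp_add, exp_le_exp]
  set y := circleMap 0 ρ θ with hy
  have hyre : y.re = ρ * cos θ := by simp [hy, circleMap, Complex.exp_ofReal_mul_I_re]
  have hyim : y.im = ρ * sin θ := by simp [hy, circleMap, Complex.exp_ofReal_mul_I_im]
  have e1 : ((n : ℂ) * ((1 + a) * y - a * y ^ 2 / 2)).re + -(n * a.re / 2) =
      n * (y.re - (a * (1 - y) ^ 2).re / 2) := by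
    have : (n : ℂ) * ((1 + a) * y - a * y ^ 2 / 2) - ((n : ℝ) : ℂ) * a / 2 =
        ((n : ℝ) : ℂ) * (y - a * (1 - y) ^ 2 / 2) := by push_cast; ring
    have h2 := congrArg Complex.re this
    simp only [Complex.sub_re, Complex.re_ofReal_mul, Complex.div_ofNat_re] at h2
    linarith
  rw [e1]
  have h3 : ‖(1 : ℂ) - y‖ ^ 2 = (1 - ρ) ^ 2 + 2 * ρ * (1 - cos θ) := by
    rw [← Complex.normSq_eq_norm_sq, Complex.normSq_apply]
    simp only [Complex.sub_re, Complex.sub_im, Complex.one_re, Complex.one_im, hyre, hyim]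
    nlinarith [sin_sq_add_cos_sq θ]
  have h4 : -(a * (1 - y) ^ 2).re ≤ ‖a‖ * ((1 - ρ) ^ 2 + 2 * ρ * (1 - cos θ)) := by
    rw [← h3]
    calc -(a * (1 - y) ^ 2).re ≤ |(a * (1 - y) ^ 2).re| := neg_le_abs _
      _ ≤ ‖a * (1 - y) ^ 2‖ := Complex.abs_re_le_norm _
      _ = _ := by rw [norm_mul, norm_pow]
  have hn : (0 : ℝ) ≤ n := Nat.cast_nonneg n
  have h5 : y.re - (a * (1 - y) ^ 2).re / 2 ≤
      (ρ + ‖a‖ * (1 - ρ) ^ 2 / 2) - (1 - ‖a‖) * ρ * (1 - cos θ) := by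
    rw [hyre]; nlinarith
  have := mul_le_mul_of_nonneg_left h5 hn
  linarith

theorem norm_hermiteSeq_le {n m : ℕ} (hn : n ≠ 0) (hm : m ≠ 0) {a : ℂ} (ha : ‖a‖ < 1) :
    ‖hermiteSeq (1 + a) (a / n) m‖ ^ 2 * exp (-(n * a.re)) ≤
      (m.factorial : ℝ) ^ 2 / (n : ℝ) ^ (2 * m) * ((n : ℝ) / m) ^ m * exp (n + m) *
        (π / (8 * (1 - ‖a‖) * √(n * m))) := by
  have hn' : (0 : ℝ) < n := by exact_mod_cast Nat.pos_of_ne_zero hn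
  have hm' : (0 : ℝ) < m := by exact_mod_cast Nat.pos_of_ne_zero hm
  have ha' : 0 < 1 - ‖a‖ := by linarith
  -- This radius minimises `exp(n (1 + ρ²)) ρ^(-2m)`, the exponential part of the squared Cauchy
  -- bound.
  set ρ : ℝ := √(m / n) with hρdef
  have hρ : 0 < ρ := sqrt_pos.mpr (by positivity)
  have hρ2 : ρ ^ 2 = m / n := sq_sqrt (by positivity)
  set l : ℝ := n * (1 - ‖a‖) * ρ with hl
  have hl0 : 0 < l := by positivity
  have hdiff : Differentiable ℂ (hermiteGen n a) := fun y =>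
    (hasDerivAt_hermiteGen n a y).differentiableAt
  have h1 := norm_iteratedDeriv_le_circle hdiff hρ m
  rw [iteratedDeriv_hermiteGen hn] at h1
  simp only [hermiteGen, mul_zero, sub_zero, ne_eq, OfNat.ofNat_ne_zero, not_false_eq_true,
    zero_pow, zero_div, Complex.exp_zero, mul_one, norm_mul, norm_pow, Complex.norm_natCast] at h1
  set E : ℝ := exp (-(n * a.re / 2)) with hE
  have hE0 : 0 < E := exp_pos _
  set D : ℝ := exp (n * (ρ + ‖a‖ * (1 - ρ) ^ 2 / 2)) with hD
  have h2 : (∫ θ in 0..2 * π, ‖hermiteGen n a (circleMap 0 ρ θ)‖) * E ≤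
      D * (π * √(π / (2 * l))) := by
    rw [← intervalIntegral.integral_mul_const]
    calc _ ≤ ∫ θ in 0..2 * π, D * exp (-(l * (1 - cos θ))) := by
          refine intervalIntegral.integral_mono_on (by positivity) ?_ ?_ fun θ _ => ?_
          · refine Continuous.intervalIntegrable ?_ _ _
            exact ((hdiff.continuous.comp (continuous_circleMap 0 ρ)).norm).mul continuous_const
          · exact Continuous.intervalIntegrable (by fun_prop) _ _
          · exact norm_hermiteGen_circle_le n a hρ.le θ
      _ ≤ _ := by
          rw [intervalIntegral.integral_const_mul]
          gcongr
          exact integral_exp_neg_one_sub_cos_le hl0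
  have h3 : ‖hermiteSeq (1 + a) (a / n) m‖ * E ≤
      m.factorial / (n : ℝ) ^ m * ρ⁻¹ ^ m * D * (√(π / (2 * l)) / 2) := by
    have hf : (0 : ℝ) < m.factorial := by exact_mod_cast m.factorial_pos
    have h4 : ‖hermiteSeq (1 + a) (a / n) m‖ ≤ m.factorial / (n : ℝ) ^ m *
        (((2 * π)⁻¹ * ∫ θ in 0..2 * π, ‖hermiteGen n a (circleMap 0 ρ θ)‖) * ρ⁻¹ ^ m) := by
      rw [div_le_iff₀ hf] at h1
      rw [div_mul_eq_mul_div, le_div_iff₀ (by positivity)]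
      calc _ = (n : ℝ) ^ m * ‖hermiteSeq (1 + a) (a / n) m‖ := mul_comm _ _
        _ ≤ _ := h1
        _ = _ := by simp only [hermiteGen]; ring
    calc _ ≤ m.factorial / (n : ℝ) ^ m *
        (((2 * π)⁻¹ * ∫ θ in 0..2 * π, ‖hermiteGen n a (circleMap 0 ρ θ)‖) * ρ⁻¹ ^ m) * E := by
          gcongr
      _ = m.factorial / (n : ℝ) ^ m * ρ⁻¹ ^ m * (2 * π)⁻¹ *
          ((∫ θ in 0..2 * π, ‖hermiteGen n a (circleMap 0 ρ θ)‖) * E) := by ring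
      _ ≤ m.factorial / (n : ℝ) ^ m * ρ⁻¹ ^ m * (2 * π)⁻¹ * (D * (π * √(π / (2 * l)))) := by
          gcongr
      _ = _ := by field_simp
  have h5 := pow_le_pow_left₀ (by positivity) h3 2
  have hE2 : E ^ 2 = exp (-(n * a.re)) := by
    rw [hE, ← exp_nat_mul]; congr 1; push_cast; ring
  have hD2 : D ^ 2 ≤ exp (n + m) := by
    rw [hD, ← exp_nat_mul, exp_le_exp]
    -- After this `2ρ + (1 - ρ)² = 1 + ρ²`, and `n ρ² = m`.
    have : ‖a‖ * (1 - ρ) ^ 2 ≤ 1 * (1 - ρ) ^ 2 := by gcongr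
    have h6 : (m : ℝ) = n * ρ ^ 2 := by rw [hρ2]; field_simp
    rw [h6]
    push_cast
    nlinarith
  have hnρ : n * ρ = √(n * m) := by
    rw [← sqrt_sq (by positivity : 0 ≤ n * ρ), mul_pow, hρ2]
    congr 1; field_simp
  rw [mul_pow, hE2] at h5
  refine h5.trans ?_
  have e1 : (m.factorial / (n : ℝ) ^ m * ρ⁻¹ ^ m * D * (√(π / (2 * l)) / 2)) ^ 2 =
      (m.factorial : ℝ) ^ 2 / (n : ℝ) ^ (2 * m) * (ρ ^ 2)⁻¹ ^ m * D ^ 2 *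
        (√(π / (2 * l)) ^ 2 / 4) := by
    rw [mul_pow, mul_pow, mul_pow, div_pow, div_pow, ← pow_mul, mul_comm m 2, ← pow_mul, ← inv_pow,
      ← pow_mul, mul_comm m 2]
    norm_num
  rw [e1, hρ2, inv_div, sq_sqrt (by positivity)]
  have e2 : π / (2 * l) / 4 = π / (8 * (1 - ‖a‖) * √(n * m)) := by
    rw [hl, ← hnρ]; field_simp; ring
  rw [e2]
  gcongr

/-- The Stirling sequence decreases from its value `e / √2` at `1`. -/
theorem factorial_le_stirling {m : ℕ} (hm : m ≠ 0) :
    (m.factorial : ℝ) ≤ exp 1 * √m * (m : ℝ) ^ m * exp (-m) := by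
  obtain ⟨k, rfl⟩ := Nat.exists_eq_succ_of_ne_zero hm
  have h := Stirling.stirlingSeq'_antitone (Nat.zero_le k)
  simp only [Function.comp, Nat.succ_eq_add_one, zero_add, Stirling.stirlingSeq_one] at h
  rw [Stirling.stirlingSeq, div_le_iff₀ (by positivity)] at h
  refine h.trans_eq ?_
  rw [sqrt_mul (by norm_num), div_pow, ← exp_nat_mul, exp_neg]
  field_simp

/-- The second moment of the normalised characteristic polynomial is bounded outside the
ellipse. -/
theorem sum_hermiteSeq_le {r : ℝ} (hr0 : 0 ≤ r) (hr : r < 1) : ∃ K : ℝ, ∀ n : ℕ, n ≠ 0 →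
    ∀ a : ℂ, ‖a‖ ≤ r ^ 2 →
      (∑ k ∈ Finset.range (n + 1), (r ^ 2 / n) ^ k * n.descFactorial k *
        ‖hermiteSeq (1 + a) (a / n) (n - k)‖ ^ 2) * exp (-(n * a.re)) ≤ K := by
  have hr2 : r ^ 2 < 1 := by nlinarith
  have hr2' : 0 < 1 - r ^ 2 := by linarith
  -- The first summand bounds the terms `k < n` by a geometric series. The second bounds `k = n`,
  -- where the Hermite estimate does not apply (degree `0`) and `n r^(2n) ≤ (1 - r²)⁻¹` is used
  -- instead.
  refine ⟨exp 2 * (π / (8 * (1 - r ^ 2))) * (1 - r ^ 2)⁻¹ + exp 1 * (1 - r ^ 2)⁻¹, ?_⟩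
  intro n hn a ha
  have hn' : (0 : ℝ) < n := by exact_mod_cast Nat.pos_of_ne_zero hn
  have ha1 : ‖a‖ < 1 := ha.trans_lt hr2
  rw [Finset.sum_range_succ, add_mul]
  refine add_le_add ?_ ?_
  · rw [Finset.sum_mul]
    calc _ ≤ ∑ k ∈ Finset.range n, exp 2 * (π / (8 * (1 - r ^ 2))) * (r ^ 2) ^ k := by
          refine Finset.sum_le_sum fun k hk => ?_
          have hkn : k < n := Finset.mem_range.mp hk
          set m := n - k with hmdef
          have hm : m ≠ 0 := by omega
          have hm' : (0 : ℝ) < m := by exact_mod_cast Nat.pos_of_ne_zero hm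
          have hnk : n = m + k := by omega
          have hdf : (n.descFactorial k : ℝ) = n.factorial / m.factorial := by
            rw [eq_div_iff (by exact_mod_cast m.factorial_ne_zero), mul_comm]
            exact_mod_cast Nat.factorial_mul_descFactorial hkn.le
          have h1 := norm_hermiteSeq_le hn hm ha1
          have hfm := factorial_le_stirling hm
          have hfn := factorial_le_stirling hn
          have hf0 : (0 : ℝ) < m.factorial := by exact_mod_cast m.factorial_pos
          have hpa : π / (8 * (1 - ‖a‖) * √(n * m)) ≤
              π / (8 * (1 - r ^ 2)) / √(n * m) := by
            rw [div_div]; gcongr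
          calc (r ^ 2 / n) ^ k * n.descFactorial k * ‖hermiteSeq (1 + a) (a / n) m‖ ^ 2 *
                exp (-(n * a.re))
              = (r ^ 2 / n) ^ k * (n.factorial / m.factorial) *
                (‖hermiteSeq (1 + a) (a / n) m‖ ^ 2 * exp (-(n * a.re))) := by rw [hdf]; ring
            _ ≤ (r ^ 2 / n) ^ k * (n.factorial / m.factorial) *
                ((m.factorial : ℝ) ^ 2 / (n : ℝ) ^ (2 * m) * ((n : ℝ) / m) ^ m * exp (n + m) *
                (π / (8 * (1 - r ^ 2)) / √(n * m))) := by
                refine mul_le_mul_of_nonneg_left (h1.trans ?_) (by positivity)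
                gcongr
            _ = (r ^ 2) ^ k * (n.factorial * m.factorial) * ((n : ℝ) ^ n)⁻¹ * ((m : ℝ) ^ m)⁻¹ *
                exp (n + m) * (π / (8 * (1 - r ^ 2)) / √(n * m)) := by
                have hpow : (n : ℝ) ^ n = (n : ℝ) ^ m * (n : ℝ) ^ k := by
                  rw [← pow_add, ← hnk]
                rw [hpow, div_pow, div_pow, two_mul, pow_add]
                field_simp
            _ ≤ (r ^ 2) ^ k * ((exp 1 * √n * (n : ℝ) ^ n * exp (-n)) *
                (exp 1 * √m * (m : ℝ) ^ m * exp (-m))) * ((n : ℝ) ^ n)⁻¹ * ((m : ℝ) ^ m)⁻¹ *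
                exp (n + m) * (π / (8 * (1 - r ^ 2)) / √(n * m)) := by
                gcongr
            -- The factors `√n √m` from the two Stirling bounds cancel the `√(n m)` gained from the
            -- integral over `θ`.
            _ = exp 2 * (π / (8 * (1 - r ^ 2))) * (r ^ 2) ^ k := by
                rw [sqrt_mul hn'.le, exp_add, exp_neg, exp_neg,
                  show (2 : ℝ) = 1 + 1 by norm_num, exp_add]
                have := sqrt_pos.mpr hn'
                have := sqrt_pos.mpr hm'
                field_simp
      _ = exp 2 * (π / (8 * (1 - r ^ 2))) * ∑ k ∈ Finset.range n, (r ^ 2) ^ k := by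
          rw [Finset.mul_sum]
      _ ≤ _ := by
          gcongr
          rw [← tsum_geometric_of_lt_one (by positivity) hr2]
          exact (summable_geometric_of_lt_one (by positivity) hr2).sum_le_tsum _
            fun _ _ => by positivity
  · have hgeo : n * (r ^ 2) ^ n ≤ (1 - r ^ 2)⁻¹ := by
      calc n * (r ^ 2) ^ n = ∑ k ∈ Finset.range n, (r ^ 2) ^ n := by simp
        _ ≤ ∑ k ∈ Finset.range n, (r ^ 2) ^ k := by
            refine Finset.sum_le_sum fun k hk => ?_
            exact pow_le_pow_of_le_one (by positivity) hr2.le (Finset.mem_range.mp hk).le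
        _ ≤ _ := by
          rw [← tsum_geometric_of_lt_one (by positivity) hr2]
          exact (summable_geometric_of_lt_one (by positivity) hr2).sum_le_tsum _
            fun _ _ => by positivity
    have hfn := factorial_le_stirling hn
    have hexp : exp (-(n * a.re)) ≤ exp n := by
      apply exp_le_exp.mpr
      have : -a.re ≤ 1 := by
        have := Complex.abs_re_le_norm a
        linarith [neg_le_abs a.re]
      nlinarith
    have hsq : √(n : ℝ) ≤ n := by
      rw [sqrt_le_left hn'.le]
      have : (1 : ℝ) ≤ n := by exact_mod_cast Nat.one_le_iff_ne_zero.mpr hn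
      nlinarith
    simp only [Nat.sub_self, hermiteSeq, norm_one, one_pow, mul_one, Nat.descFactorial_self]
    calc (r ^ 2 / n) ^ n * n.factorial * exp (-(n * a.re))
        ≤ (r ^ 2 / n) ^ n * (exp 1 * n * (n : ℝ) ^ n * exp (-n)) * exp n := by
          gcongr
          exact hfn.trans (by gcongr)
      _ = exp 1 * (n * (r ^ 2) ^ n) := by
          rw [div_pow, exp_neg]; field_simp
      _ ≤ _ := by gcongr

end HermiteBound
end EllipticGinibre

namespace EllipticGinibre

/-! ### The elliptic Ginibre ensemble as a linear image of a standard Gaussian vector -/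

section Coefficients

open ComplexConjugate

variable {n : ℕ}

/-- The coefficient of `g p` in the `(i, j)` entry of `hermitianOfArray g`. -/
def gueCoef (i j : Fin n) (p : Fin n × Fin n) : ℂ :=
  if i = j then (if p = (i, j) then 1 else 0)
  else if i < j then ((if p = (i, j) then 1 else 0) + Complex.I * (if p = (j, i) then 1 else 0)) /
    (√2 : ℝ)
  else ((if p = (j, i) then 1 else 0) - Complex.I * (if p = (i, j) then 1 else 0)) / (√2 : ℝ)

theorem hermitianOfArray_eq_sum (g : Fin n × Fin n → ℝ) (i j : Fin n) :
    hermitianOfArray g i j = ∑ p, gueCoef i j p * (g p : ℂ) := by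
  simp only [hermitianOfArray, gueCoef, Matrix.of_apply]
  split_ifs with h1 h2
  · subst h1; simp
  · simp [add_div, add_mul, Finset.sum_add_distrib, ite_div, ite_mul, mul_ite]
    ring
  · simp [sub_div, sub_mul, Finset.sum_sub_distrib, ite_div, ite_mul, mul_ite]
    ring

theorem conj_gueCoef (i j : Fin n) (p : Fin n × Fin n) :
    conj (gueCoef i j p) = gueCoef j i p := by
  rcases lt_trichotomy i j with h | h | h
  · simp only [gueCoef, h.ne, h.ne', h, h.not_gt, if_true, if_false, map_div₀, map_add, map_mul,
      Complex.conj_I, Complex.conj_ofReal, apply_ite conj, map_one, map_zero]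
    ring
  · subst h; simp [gueCoef, apply_ite conj]
  · simp only [gueCoef, h.ne, h.ne', h, h.not_gt, if_true, if_false, map_div₀, map_sub, map_mul,
      Complex.conj_I, Complex.conj_ofReal, apply_ite conj, map_one, map_zero]
    ring

/-- The sum is `E X_ij X_kl` for the GUE. An off-diagonal entry involves only `g (i, j)` and `g (j,
i)`; the two contributions cancel for equal positions, because `I² = -1`, and add up for transposed
ones. -/
theorem sum_gueCoef_mul (i j k l : Fin n) :
    ∑ p, gueCoef i j p * gueCoef k l p = if i = l ∧ j = k then 1 else 0 := by
  have h2 : ((√2 : ℝ) : ℂ) ^ 2 = 2 := by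
    rw [← Complex.ofReal_pow, Real.sq_sqrt (by norm_num)]; norm_num
  have h2' : ((√2 : ℝ) : ℂ) ≠ 0 := by
    intro h; rw [h] at h2; norm_num at h2
  have key : ∀ (f : Fin n × Fin n → ℂ), ∑ p, gueCoef i j p * f p =
      if i = j then f (i, j) else if i < j then (f (i, j) + Complex.I * f (j, i)) / (√2 : ℝ)
      else (f (j, i) - Complex.I * f (i, j)) / (√2 : ℝ) := by
    intro f
    simp only [gueCoef]
    split_ifs with h1 h2
    · simp
    · simp [add_div, add_mul, Finset.sum_add_distrib, ite_div, ite_mul, mul_ite]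
      ring
    · simp [sub_div, sub_mul, Finset.sum_sub_distrib, ite_div, ite_mul, mul_ite]
      ring
  rw [key]
  by_cases hA : i = k ∧ j = l
  · obtain ⟨rfl, rfl⟩ := hA
    rcases lt_trichotomy i j with h | h | h
    · simp only [gueCoef, h.ne, h.ne', h, if_true, if_false, Prod.mk.injEq, and_self]
      simp
      field_simp
      simp
    · subst h; simp [gueCoef]
    · simp only [gueCoef, h.ne', h.not_gt, if_true, if_false, Prod.mk.injEq]
      simp [h.ne]
      field_simp
      simp
  · by_cases hB : i = l ∧ j = k
    · obtain ⟨rfl, rfl⟩ := hB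
      rcases lt_trichotomy i j with h | h | h
      · simp only [gueCoef, h.ne, h.ne', h, h.not_gt, if_true, if_false, Prod.mk.injEq, and_self]
        simp
        field_simp
        rw [h2, Complex.I_sq]; norm_num
      · subst h; simp [gueCoef]
      · simp only [gueCoef, h.ne, h.ne', h, h.not_gt, if_true, if_false, Prod.mk.injEq, and_self]
        simp
        field_simp
        rw [h2, Complex.I_sq]; norm_num
    · have e1 : gueCoef k l (i, j) = 0 := by
        have h1 : (i, j) ≠ (k, l) := fun h => hA (Prod.mk.inj h)
        have h2 : (i, j) ≠ (l, k) := fun h => hB (Prod.mk.inj h)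
        simp [gueCoef, h1, h2]
      have e2 : gueCoef k l (j, i) = 0 := by
        have h1 : (j, i) ≠ (k, l) := fun h => hB ⟨(Prod.mk.inj h).2, (Prod.mk.inj h).1⟩
        have h2 : (j, i) ≠ (l, k) := fun h => hA ⟨(Prod.mk.inj h).2, (Prod.mk.inj h).1⟩
        simp [gueCoef, h1, h2]
      simp [e1, e2, hB]

/-- The coefficients of the entries of the elliptic Ginibre matrix. -/
def ellCoef (t : ℝ) (s : Fin n × Fin n) : (Fin n × Fin n) ⊕ (Fin n × Fin n) → ℂ :=
  Sum.elim (fun p => ((√((1 + t) / 2) : ℝ) : ℂ) * gueCoef s.1 s.2 p)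
    (fun p => Complex.I * ((√((1 - t) / 2) : ℝ) : ℂ) * gueCoef s.1 s.2 p)

/-- The squared weights `(1 + t) / 2` and `(1 - t) / 2` are subtracted here because of `I²`, giving
`t`; with a conjugate on one factor they are added, giving `1`. -/
theorem sum_ellCoef_mul {t : ℝ} (ht : t ∈ Set.Icc (0 : ℝ) 1) (s r : Fin n × Fin n) :
    ∑ p, ellCoef t s p * ellCoef t r p = if r = s.swap then (t : ℂ) else 0 := by
  have ha : ((√((1 + t) / 2) : ℝ) : ℂ) ^ 2 = (1 + t) / 2 := by
    rw [← Complex.ofReal_pow, Real.sq_sqrt (by linarith [ht.1])]; push_cast; ring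
  have hb : ((√((1 - t) / 2) : ℝ) : ℂ) ^ 2 = (1 - t) / 2 := by
    rw [← Complex.ofReal_pow, Real.sq_sqrt (by linarith [ht.2])]; push_cast; ring
  have : ∑ p, ellCoef t s p * ellCoef t r p = (((√((1 + t) / 2) : ℝ) : ℂ) ^ 2 +
      Complex.I ^ 2 * ((√((1 - t) / 2) : ℝ) : ℂ) ^ 2) *
        ∑ p, gueCoef s.1 s.2 p * gueCoef r.1 r.2 p := by
    rw [Fintype.sum_sum_type, add_mul, Finset.mul_sum, Finset.mul_sum]
    congr 1 <;> refine Finset.sum_congr rfl fun p _ => ?_ <;>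
      simp only [ellCoef, Sum.elim_inl, Sum.elim_inr] <;> ring
  rw [this, sum_gueCoef_mul, ha, hb, Complex.I_sq]
  have e : (s.1 = r.2 ∧ s.2 = r.1) ↔ r = s.swap := by
    rw [Prod.ext_iff]; simp only [Prod.fst_swap, Prod.snd_swap]; tauto
  simp only [e]
  split_ifs <;> ring

theorem sum_ellCoef_mul_conj {t : ℝ} (ht : t ∈ Set.Icc (0 : ℝ) 1) (s r : Fin n × Fin n) :
    ∑ p, ellCoef t s p * conj (ellCoef t r p) = if r = s then 1 else 0 := by
  have ha : ((√((1 + t) / 2) : ℝ) : ℂ) ^ 2 = (1 + t) / 2 := by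
    rw [← Complex.ofReal_pow, Real.sq_sqrt (by linarith [ht.1])]; push_cast; ring
  have hb : ((√((1 - t) / 2) : ℝ) : ℂ) ^ 2 = (1 - t) / 2 := by
    rw [← Complex.ofReal_pow, Real.sq_sqrt (by linarith [ht.2])]; push_cast; ring
  have : ∑ p, ellCoef t s p * conj (ellCoef t r p) = (((√((1 + t) / 2) : ℝ) : ℂ) ^ 2 -
      Complex.I ^ 2 * ((√((1 - t) / 2) : ℝ) : ℂ) ^ 2) *
        ∑ p, gueCoef s.1 s.2 p * gueCoef r.2 r.1 p := by
    rw [Fintype.sum_sum_type, sub_mul, Finset.mul_sum, Finset.mul_sum, sub_eq_add_neg,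
      ← Finset.sum_neg_distrib]
    congr 1 <;> refine Finset.sum_congr rfl fun p _ => ?_ <;>
      simp only [ellCoef, Sum.elim_inl, Sum.elim_inr, map_mul, conj_gueCoef, Complex.conj_ofReal,
        Complex.conj_I] <;> ring
  rw [this, sum_gueCoef_mul, ha, hb, Complex.I_sq]
  have e : (s.1 = r.1 ∧ s.2 = r.2) ↔ r = s := by
    rw [Prod.ext_iff]; tauto
  simp only [e]
  split_ifs <;> ring

theorem ellipticCombination_eq_sum (t : ℝ) (g : (Fin n × Fin n) ⊕ (Fin n × Fin n) → ℝ)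
    (i j : Fin n) :
    ellipticCombination t (hermitianOfArray (g ∘ Sum.inl), hermitianOfArray (g ∘ Sum.inr)) i j =
      ∑ p, ellCoef t (i, j) p * (g p : ℂ) := by
  rw [Fintype.sum_sum_type]
  simp only [ellipticCombination, Matrix.add_apply, Matrix.smul_apply, smul_eq_mul,
    hermitianOfArray_eq_sum, Finset.mul_sum, ellCoef, Sum.elim_inl, Sum.elim_inr, Function.comp]
  congr 1 <;> refine Finset.sum_congr rfl fun p _ => ?_ <;> ring

end Coefficients

/-! ### Integration by parts for affine images of a Gaussian vector -/

section LinearForm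

open MvPolynomial ComplexConjugate

variable {σ ι : Type*}

/-- The polynomial with conjugate coefficients. -/
def conjPoly : MvPolynomial ι ℂ →+* MvPolynomial ι ℂ := MvPolynomial.map (starRingEnd ℂ)

theorem realEval_conjPoly (g : ι → ℝ) (p : MvPolynomial ι ℂ) :
    realEval g (conjPoly p) = conj (realEval g p) := by
  induction p using MvPolynomial.induction_on with
  | C a => simp [realEval, conjPoly]
  | add p q hp hq => simp [hp, hq]
  | mul_X p k hp => simp only [map_mul, hp]; simp [realEval, conjPoly]

variable [Fintype ι]

/-- The derivation in the direction of a complex vector. -/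
def dirDeriv (v : ι → ℂ) : Derivation ℂ (MvPolynomial ι ℂ) (MvPolynomial ι ℂ) :=
  ∑ i, v i • pderiv i

theorem dirDeriv_apply (v : ι → ℂ) (p : MvPolynomial ι ℂ) :
    dirDeriv v p = ∑ i, v i • pderiv i p := by
  simp only [dirDeriv]
  induction (Finset.univ : Finset ι) using Finset.cons_induction with
  | empty => simp
  | cons a s ha ih => rw [Finset.sum_cons, Finset.sum_cons, Derivation.add_apply, ih]; rfl

/-- The linear polynomial with coefficient vector `v`. -/
def linPoly (v : ι → ℂ) : MvPolynomial ι ℂ := ∑ i, v i • X i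

theorem conjPoly_linPoly (v : ι → ℂ) : conjPoly (linPoly v) = linPoly (fun i => conj (v i)) := by
  simp [conjPoly, linPoly, smul_eq_C_mul]

theorem realEval_linPoly (g : ι → ℝ) (v : ι → ℂ) :
    realEval g (linPoly v) = ∑ i, v i * (g i : ℂ) := by
  simp [realEval, linPoly]

theorem dirDeriv_linPoly (v w : ι → ℂ) : dirDeriv v (linPoly w) = C (∑ i, v i * w i) := by
  classical
  rw [dirDeriv_apply, map_sum]
  refine Finset.sum_congr rfl fun i _ => ?_
  simp [linPoly, pderiv_X, Pi.single_apply, smul_eq_C_mul]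

theorem gexp_linPoly_mul (v : ι → ℂ) (p : MvPolynomial ι ℂ) :
    gexp (linPoly v * p) = gexp (dirDeriv v p) := by
  classical
  rw [linPoly, Finset.sum_mul, dirDeriv_apply, map_sum, map_sum]
  refine Finset.sum_congr rfl fun i _ => ?_
  rw [smul_mul_assoc, map_smul, map_smul, gexp_X_mul]

/-- Substitution of the Gaussian variables `ζ s + ∑ i, L s i g i`. -/
def linSubst (L : σ → ι → ℂ) (ζ : σ → ℂ) : MvPolynomial σ ℂ →ₐ[ℂ] MvPolynomial ι ℂ :=
  aeval fun s => C (ζ s) + linPoly (L s)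

theorem realEval_linSubst (L : σ → ι → ℂ) (ζ : σ → ℂ) (g : ι → ℝ) (p : MvPolynomial σ ℂ) :
    realEval g (linSubst L ζ p) = eval (fun s => ζ s + ∑ i, L s i * (g i : ℂ)) p := by
  induction p using MvPolynomial.induction_on with
  | C a => simp [realEval, linSubst]
  | add p q hp hq => simp [hp, hq]
  | mul_X p k hp =>
    simp only [map_mul, hp, eval_X]
    congr 1
    rw [linSubst, aeval_X, map_add, realEval_linPoly]
    simp [realEval]

/-- The form `(p, q) ↦ E p(Z) conj q(Z)` of the Gaussian vector `Z s = ζ s + ∑ i, L s i g i`. -/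
def gaussianForm (L : σ → ι → ℂ) (ζ : σ → ℂ) :
    MvPolynomial σ ℂ →ₗ[ℂ] MvPolynomial σ ℂ →ₗ⋆[ℂ] ℂ :=
  LinearMap.mk₂'ₛₗ (RingHom.id ℂ) (starRingEnd ℂ)
    (fun p q => gexp (linSubst L ζ p * conjPoly (linSubst L ζ q)))
    (fun p p' q => by simp [add_mul])
    (fun c p q => by simp)
    (fun p q q' => by simp [mul_add])
    (fun c p q => by
      have : conjPoly (linSubst L ζ (c • q)) = conj c • conjPoly (linSubst L ζ q) := by
        simp [smul_eq_C_mul, conjPoly]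
      rw [this, mul_smul_comm, map_smul])

theorem gaussianForm_apply (L : σ → ι → ℂ) (ζ : σ → ℂ) (p q : MvPolynomial σ ℂ) :
    gaussianForm L ζ p q = gexp (linSubst L ζ p * conjPoly (linSubst L ζ q)) := rfl

theorem gaussianForm_eq_integral (L : σ → ι → ℂ) (ζ : σ → ℂ) (p q : MvPolynomial σ ℂ) :
    gaussianForm L ζ p q = ∫ g, eval (fun s => ζ s + ∑ i, L s i * (g i : ℂ)) p *
      conj (eval (fun s => ζ s + ∑ i, L s i * (g i : ℂ)) q) ∂(stdGaussian ι) := by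
  simp only [gaussianForm_apply, gexp_apply, map_mul, realEval_conjPoly, realEval_linSubst]

/-- By the chain rule, the derivative along `L s` acts as `α ∂` in the direction `sw s` on the
holomorphic factor (by `h1`) and as `β ∂ₛ` on the conjugate factor (by `h2`). -/
theorem isGaussianForm_gaussianForm [Fintype σ] [DecidableEq σ] {L : σ → ι → ℂ} {ζ : σ → ℂ}
    {sw : σ → σ} {α β : ℂ} (h1 : ∀ s r, ∑ i, L s i * L r i = if r = sw s then α else 0)
    (h2 : ∀ s r, ∑ i, L s i * conj (L r i) = if r = s then β else 0) :
    IsGaussianForm (gaussianForm L ζ) sw ζ α β where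
  one_one := by simp [gaussianForm_apply, gexp_one]
  symm p q := by
    rw [gaussianForm_eq_integral, gaussianForm_eq_integral, ← integral_conj]
    simp [mul_comm]
  X_mul s p q := by
    have d1 : ∀ p, dirDeriv (L s) (linSubst L ζ p) = C α * linSubst L ζ (pderiv (sw s) p) := by
      intro p
      induction p using MvPolynomial.induction_on with
      | C a => simp [linSubst]
      | add p q hp hq => simp [hp, hq, mul_add]
      | mul_X p k hp =>
        have hX : linSubst L ζ (X k) = C (ζ k) + linPoly (L k) := by simp [linSubst]
        simp only [map_mul, Derivation.leibniz, map_add, smul_eq_mul, hp, hX, dirDeriv_linPoly, h1,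
          pderiv_X, Pi.single_apply, mul_add]
        split_ifs <;> simp <;> ring
    have d2 : ∀ p, dirDeriv (L s) (conjPoly (linSubst L ζ p)) =
        C β * conjPoly (linSubst L ζ (pderiv s p)) := by
      intro p
      induction p using MvPolynomial.induction_on with
      | C a => simp [linSubst, conjPoly]
      | add p q hp hq => simp [hp, hq, mul_add]
      | mul_X p k hp =>
        have hX : conjPoly (linSubst L ζ (X k)) =
            C (conj (ζ k)) + linPoly (fun i => conj (L k i)) := by
          simp only [linSubst, aeval_X, map_add, conjPoly_linPoly]
          simp [conjPoly]
        simp only [map_mul, Derivation.leibniz, map_add, smul_eq_mul, hp, hX, dirDeriv_linPoly, h2,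
          pderiv_X, Pi.single_apply, mul_add]
        split_ifs <;> simp <;> ring
    simp only [gaussianForm_apply, map_mul]
    have hX : linSubst L ζ (X s) = C (ζ s) + linPoly (L s) := by simp [linSubst]
    rw [hX, add_mul, add_mul, map_add, mul_assoc, mul_assoc, ← smul_eq_C_mul, map_smul,
      gexp_linPoly_mul, Derivation.leibniz, d1, d2, map_add]
    have e1 : linSubst L ζ p • (C β * conjPoly (linSubst L ζ (pderiv s q))) =
        β • (linSubst L ζ p * conjPoly (linSubst L ζ (pderiv s q))) := by
      simp only [smul_eq_mul, smul_eq_C_mul]; ring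
    have e2 : conjPoly (linSubst L ζ q) • (C α * linSubst L ζ (pderiv (sw s) p)) =
        α • (linSubst L ζ (pderiv (sw s) p) * conjPoly (linSubst L ζ q)) := by
      simp only [smul_eq_mul, smul_eq_C_mul]; ring
    rw [e1, e2, map_smul, map_smul]
    simp only [smul_eq_mul]
    ring

end LinearForm
end EllipticGinibre

namespace EllipticGinibre

/-! ### Asymptotic factorisation of mixed moments -/

section Words

open MvPolynomial ComplexConjugate

variable {n : ℕ} {t : ℝ}

/-- The coefficients of the entries of `A / √n` (`x = true`) and of its adjoint (`x = false`). -/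
def letterCoef (n : ℕ) (t : ℝ) (x : Bool) (i j : Fin n) :
    (Fin n × Fin n) ⊕ (Fin n × Fin n) → ℂ := fun p =>
  (if x then ellCoef t (i, j) p else conj (ellCoef t (j, i) p)) / (√(n : ℝ) : ℝ)

/-- The matrix `A / √n` or its adjoint, as a matrix of polynomials. -/
def letter (n : ℕ) (t : ℝ) (x : Bool) :
    Matrix (Fin n) (Fin n) (MvPolynomial ((Fin n × Fin n) ⊕ (Fin n × Fin n)) ℂ) :=
  Matrix.of fun i j => linPoly (letterCoef n t x i j)

/-- The covariance of two letters. -/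
def letterCov (t : ℝ) (x y : Bool) : ℂ := if x = y then t else 1

theorem sum_letterCoef_mul (ht : t ∈ Set.Icc (0 : ℝ) 1) (x y : Bool) (i j k l : Fin n) :
    ∑ p, letterCoef n t x i j p * letterCoef n t y k l p =
      if i = l ∧ j = k then letterCov t x y / n else 0 := by
  have hs : ((√(n : ℝ) : ℝ) : ℂ) * ((√(n : ℝ) : ℝ) : ℂ) = n := by
    rw [← Complex.ofReal_mul, Real.mul_self_sqrt (Nat.cast_nonneg n)]; simp
  have h1 : ∀ f g : (Fin n × Fin n) ⊕ (Fin n × Fin n) → ℂ,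
      ∑ p, f p / ((√(n : ℝ) : ℝ) : ℂ) * (g p / ((√(n : ℝ) : ℝ) : ℂ)) = (∑ p, f p * g p) / n := by
    intro f g
    rw [Finset.sum_div]
    refine Finset.sum_congr rfl fun p _ => ?_
    rw [div_mul_div_comm, hs]
  simp only [letterCoef, h1]
  have hconj : ∀ s r : Fin n × Fin n, ∑ p, conj (ellCoef t s p) * ellCoef t r p =
      if r = s then 1 else 0 := by
    intro s r
    have h := sum_ellCoef_mul_conj ht r s
    simp only [mul_comm (ellCoef t r _)] at h
    rw [h]
    simp only [eq_comm]
  have hconj2 : ∀ s r : Fin n × Fin n, ∑ p, conj (ellCoef t s p) * conj (ellCoef t r p) =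
      if r = s.swap then (t : ℂ) else 0 := by
    intro s r
    have := congrArg conj (sum_ellCoef_mul ht s r)
    rw [map_sum] at this
    simpa [apply_ite conj] using this
  cases x <;> cases y <;>
    simp only [if_true, if_false, Bool.false_eq_true, letterCov, reduceCtorEq]
  · rw [hconj2]
    simp only [Prod.swap, Prod.mk.injEq]
    by_cases h : l = i ∧ k = j
    · simp [h.1, h.2]
    · rw [if_neg h, if_neg (fun h' => h ⟨h'.1.symm, h'.2.symm⟩), zero_div]
  · rw [hconj]
    simp only [Prod.mk.injEq]
    by_cases h : k = j ∧ l = i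
    · simp [h.1, h.2]
    · rw [if_neg h, if_neg (fun h' => h ⟨h'.2.symm, h'.1.symm⟩), zero_div]
  · rw [sum_ellCoef_mul_conj ht]
    simp only [Prod.mk.injEq]
    by_cases h : l = i ∧ k = j
    · simp [h.1, h.2]
    · rw [if_neg h, if_neg (fun h' => h ⟨h'.1.symm, h'.2.symm⟩), zero_div]
  · rw [sum_ellCoef_mul ht]
    simp only [Prod.swap, Prod.mk.injEq]
    by_cases h : k = j ∧ l = i
    · simp [h.1, h.2]
    · rw [if_neg h, if_neg (fun h' => h ⟨h'.2.symm, h'.1.symm⟩), zero_div]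

/-- The derivation adjoint to multiplication by an entry of a letter. -/
def letterDeriv (n : ℕ) (t : ℝ) (x : Bool) (i j : Fin n) :
    Derivation ℂ (MvPolynomial ((Fin n × Fin n) ⊕ (Fin n × Fin n)) ℂ)
      (MvPolynomial ((Fin n × Fin n) ⊕ (Fin n × Fin n)) ℂ) :=
  dirDeriv (letterCoef n t x i j)

theorem gexp_letter_mul (x : Bool) (i j : Fin n)
    (P : MvPolynomial ((Fin n × Fin n) ⊕ (Fin n × Fin n)) ℂ) :
    gexp (letter n t x i j * P) = gexp (letterDeriv n t x i j P) :=
  gexp_linPoly_mul _ _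

theorem letterDeriv_letter (ht : t ∈ Set.Icc (0 : ℝ) 1) (x y : Bool) (i j k l : Fin n) :
    letterDeriv n t x i j (letter n t y k l) =
      if i = l ∧ j = k then C (letterCov t x y / n) else 0 := by
  rw [letterDeriv, letter, Matrix.of_apply, dirDeriv_linPoly, sum_letterCoef_mul ht]
  split_ifs <;> simp

/-- The product of the letters of a word. -/
def wordMat (n : ℕ) (t : ℝ) (w : List Bool) :
    Matrix (Fin n) (Fin n) (MvPolynomial ((Fin n × Fin n) ⊕ (Fin n × Fin n)) ℂ) :=
  (w.map (letter n t)).prod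

@[simp] theorem wordMat_nil : wordMat n t [] = 1 := rfl

@[simp] theorem wordMat_cons (x : Bool) (w : List Bool) :
    wordMat n t (x :: w) = letter n t x * wordMat n t w := by simp [wordMat]

@[simp] theorem wordMat_append (w w' : List Bool) :
    wordMat n t (w ++ w') = wordMat n t w * wordMat n t w' := by simp [wordMat]

/-- Leibniz's rule deletes one letter at a time, and the transposed index pattern of the covariance
cuts the word at the gap. -/
theorem letterDeriv_wordMat (ht : t ∈ Set.Icc (0 : ℝ) 1) (x : Bool) (i j : Fin n)
    (w : List Bool) : ∀ k l, letterDeriv n t x i j (wordMat n t w k l) =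
      ∑ m : Fin w.length, C (letterCov t x (w.get m) / n) *
        (wordMat n t (w.take m) k j * wordMat n t (w.drop (m + 1)) i l) := by
  induction w with
  | nil =>
    intro k l
    simp [Matrix.one_apply, apply_ite (letterDeriv n t x i j)]
  | cons y w ih =>
    intro k l
    rw [wordMat_cons, Matrix.mul_apply, map_sum]
    simp only [Derivation.leibniz, smul_eq_mul, ih, letterDeriv_letter ht, Finset.sum_add_distrib]
    refine Eq.trans ?_ (Fin.sum_univ_succ _).symm
    rw [add_comm]
    congr 1
    · rw [Finset.sum_eq_single i]
      · simp only [true_and, mul_ite, mul_zero, List.get_eq_getElem, Fin.val_zero,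
          List.getElem_cons_zero, List.take_zero, wordMat_nil, zero_add, List.drop_succ_cons,
          List.drop_zero, Matrix.one_apply, eq_comm (a := j)]
        split_ifs <;> ring
      · intro m _ hm
        simp [hm.symm]
      · simp
    · simp only [Finset.mul_sum]
      rw [Finset.sum_comm]
      refine Finset.sum_congr rfl fun m _ => ?_
      simp [Matrix.mul_apply, Finset.sum_mul, Finset.mul_sum]
      refine Finset.sum_congr rfl fun r _ => ?_
      ring

/-- The normalised trace of a word. -/
def wordTrace (n : ℕ) (t : ℝ) (w : List Bool) :
    MvPolynomial ((Fin n × Fin n) ⊕ (Fin n × Fin n)) ℂ :=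
  C ((n : ℂ)⁻¹) * (wordMat n t w).trace

/-- The product of the normalised traces of a family of words. -/
def wordProd (n : ℕ) (t : ℝ) (ws : List (List Bool)) :
    MvPolynomial ((Fin n × Fin n) ⊕ (Fin n × Fin n)) ℂ :=
  (ws.map (wordTrace n t)).prod

theorem letterDeriv_wordTrace (ht : t ∈ Set.Icc (0 : ℝ) 1) (x : Bool) (i j : Fin n)
    (w : List Bool) : letterDeriv n t x i j (wordTrace n t w) =
      ∑ m : Fin w.length, C (letterCov t x (w.get m) / n ^ 2) *
        wordMat n t (w.drop (m + 1) ++ w.take m) i j := by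
  rw [wordTrace, ← smul_eq_C_mul, Derivation.map_smul, Matrix.trace, map_sum]
  simp only [Matrix.diag_apply, letterDeriv_wordMat ht]
  rw [Finset.sum_comm, Finset.smul_sum]
  refine Finset.sum_congr rfl fun m _ => ?_
  rw [← Finset.mul_sum, smul_eq_C_mul, ← mul_assoc, ← C_mul, wordMat_append, Matrix.mul_apply]
  congr 1
  · congr 1
    rw [sq]; field_simp
  · refine Finset.sum_congr rfl fun _ _ => ?_
    ring

theorem letterDeriv_wordProd (x : Bool) (i j : Fin n) (ws : List (List Bool)) :
    letterDeriv n t x i j (wordProd n t ws) =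
      ∑ l : Fin ws.length, letterDeriv n t x i j (wordTrace n t (ws.get l)) *
        wordProd n t (ws.eraseIdx l) := by
  induction ws with
  | nil => simp [wordProd]
  | cons w ws ih =>
    have : wordProd n t (w :: ws) = wordTrace n t w * wordProd n t ws := by simp [wordProd]
    rw [this, Derivation.leibniz, ih]
    refine Eq.trans ?_ (Fin.sum_univ_succ _).symm
    rw [add_comm]
    congr 1
    · simp [mul_comm]
    · rw [smul_eq_mul, Finset.mul_sum]
      refine Finset.sum_congr rfl fun l _ => ?_
      simp [wordProd]
      ring

/-- The loop equation. -/
theorem gexp_wordProd_cons (ht : t ∈ Set.Icc (0 : ℝ) 1) (hn : n ≠ 0) (x : Bool) (w : List Bool)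
    (ws : List (List Bool)) :
    gexp (wordProd n t ((x :: w) :: ws)) =
      ∑ m : Fin w.length, letterCov t x (w.get m) *
        gexp (wordProd n t (w.take m :: w.drop (m + 1) :: ws)) +
      ((n : ℂ) ^ 2)⁻¹ * ∑ l : Fin ws.length, ∑ m : Fin (ws.get l).length,
        letterCov t x ((ws.get l).get m) *
        gexp (wordProd n t
          ((w ++ ((ws.get l).drop (m + 1) ++ (ws.get l).take m)) :: ws.eraseIdx l)) := by
  have hn' : (n : ℂ) ≠ 0 := by exact_mod_cast hn
  have hcons : ∀ (w : List Bool) ws, wordProd n t (w :: ws) = wordTrace n t w * wordProd n t ws :=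
    fun w ws => by simp [wordProd]
  have e1 : wordProd n t ((x :: w) :: ws) = (n : ℂ)⁻¹ •
      ∑ i, ∑ j, letter n t x i j * (wordMat n t w j i * wordProd n t ws) := by
    rw [hcons, wordTrace, wordMat_cons, Matrix.trace, smul_eq_C_mul, mul_assoc, Finset.sum_mul]
    congr 1
    refine Finset.sum_congr rfl fun i _ => ?_
    rw [Matrix.diag_apply, Matrix.mul_apply, Finset.sum_mul]
    exact Finset.sum_congr rfl fun j _ => by ring
  have e2 : ∀ i j, letterDeriv n t x i j (wordMat n t w j i * wordProd n t ws) =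
      (∑ m : Fin w.length, (letterCov t x (w.get m) / n) •
        (wordMat n t (w.take m) j j * wordMat n t (w.drop (m + 1)) i i * wordProd n t ws)) +
      ∑ l : Fin ws.length, ∑ m : Fin (ws.get l).length,
        (letterCov t x ((ws.get l).get m) / n ^ 2) •
        (wordMat n t w j i * wordMat n t ((ws.get l).drop (m + 1) ++ (ws.get l).take m) i j *
          wordProd n t (ws.eraseIdx l)) := by
    intro i j
    rw [Derivation.leibniz, letterDeriv_wordMat ht, letterDeriv_wordProd, add_comm, smul_eq_mul,
      smul_eq_mul, Finset.mul_sum, Finset.mul_sum]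
    congr 1
    · refine Finset.sum_congr rfl fun m _ => ?_
      rw [smul_eq_C_mul]; ring
    · refine Finset.sum_congr rfl fun l _ => ?_
      rw [letterDeriv_wordTrace ht, Finset.sum_mul, Finset.mul_sum]
      refine Finset.sum_congr rfl fun m _ => ?_
      rw [smul_eq_C_mul]; ring
  -- A derivative hitting the same word splits it into two traces, of weight `n²`; one hitting
  -- another trace merges the two words into one, of weight `n` (`e4`). With the prefactors `1/n ·
  -- 1/n` and `1/n · 1/n²`, splitting has weight `1` and merging `1 / n²`.
  have e3 : ∀ u v : List Bool, ∀ Q,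
      ∑ i, ∑ j, wordMat n t u j j * wordMat n t v i i * Q =
        ((n : ℂ) ^ 2) • (wordTrace n t u * (wordTrace n t v * Q)) := by
    intro u v Q
    have : ((n : ℂ) ^ 2) • (wordTrace n t u * (wordTrace n t v * Q)) =
        (wordMat n t u).trace * ((wordMat n t v).trace * Q) := by
      rw [wordTrace, wordTrace, ← smul_eq_C_mul, ← smul_eq_C_mul, smul_mul_assoc, smul_mul_assoc,
        mul_smul_comm, smul_smul, smul_smul]
      have : (n : ℂ) ^ 2 * (n : ℂ)⁻¹ * (n : ℂ)⁻¹ = 1 := by field_simp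
      rw [← mul_assoc, this, one_smul]
    rw [this, Matrix.trace, Matrix.trace, Finset.sum_mul, Finset.sum_comm]
    refine Finset.sum_congr rfl fun j _ => ?_
    rw [Finset.sum_mul, Finset.mul_sum]
    exact Finset.sum_congr rfl fun i _ => by simp only [Matrix.diag_apply]; ring
  have e4 : ∀ u v : List Bool, ∀ Q,
      ∑ i, ∑ j, wordMat n t u j i * wordMat n t v i j * Q =
        (n : ℂ) • (wordTrace n t (u ++ v) * Q) := by
    intro u v Q
    rw [wordTrace, ← smul_eq_C_mul, smul_mul_assoc, smul_smul, mul_inv_cancel₀ hn', one_smul,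
      wordMat_append, Matrix.trace, Finset.sum_mul, Finset.sum_comm]
    refine Finset.sum_congr rfl fun j _ => ?_
    rw [Matrix.diag_apply, Matrix.mul_apply, Finset.sum_mul]
  rw [e1, map_smul]
  simp only [map_sum, gexp_letter_mul, e2, map_add, Finset.sum_add_distrib, map_smul]
  rw [smul_add]
  congr 1
  · have : ∀ m : Fin w.length, ∑ i, ∑ j, (letterCov t x (w.get m) / n) •
        gexp (wordMat n t (w.take m) j j * wordMat n t (w.drop (m + 1)) i i * wordProd n t ws) =
        (letterCov t x (w.get m) * n) * gexp (wordProd n t (w.take m :: w.drop (m + 1) :: ws)) := by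
      intro m
      simp only [← map_smul, ← map_sum, ← Finset.smul_sum]
      rw [e3, map_smul, map_smul, hcons, hcons, smul_smul, smul_eq_mul]
      congr 1
      field_simp
    rw [Finset.sum_congr rfl fun i _ => Finset.sum_comm, Finset.sum_comm,
      Finset.sum_congr rfl fun m _ => this m, Finset.smul_sum]
    refine Finset.sum_congr rfl fun m _ => ?_
    rw [smul_eq_mul]; field_simp
  · have : ∀ (l : Fin ws.length) (m : Fin (ws.get l).length), ∑ i, ∑ j,
        (letterCov t x ((ws.get l).get m) / n ^ 2) •
        gexp (wordMat n t w j i * wordMat n t ((ws.get l).drop (m + 1) ++ (ws.get l).take m) i j *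
          wordProd n t (ws.eraseIdx l)) =
        (letterCov t x ((ws.get l).get m) / n) * gexp (wordProd n t
          ((w ++ ((ws.get l).drop (m + 1) ++ (ws.get l).take m)) :: ws.eraseIdx l)) := by
      intro l m
      simp only [← map_smul, ← map_sum, ← Finset.smul_sum]
      rw [e4, map_smul, map_smul, hcons, smul_smul, smul_eq_mul]
      congr 1
      field_simp
    have swap : ∀ F : Fin n → Fin n → ∀ l : Fin ws.length, Fin (ws.get l).length → ℂ,
        ∑ i, ∑ j, ∑ l, ∑ m, F i j l m = ∑ l, ∑ m, ∑ i, ∑ j, F i j l m := by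
      intro F
      rw [Finset.sum_congr rfl fun i _ => Finset.sum_comm, Finset.sum_comm]
      refine Finset.sum_congr rfl fun l _ => ?_
      rw [Finset.sum_congr rfl fun i _ => Finset.sum_comm, Finset.sum_comm]
    rw [swap, Finset.smul_sum, Finset.mul_sum]
    refine Finset.sum_congr rfl fun l _ => ?_
    rw [Finset.smul_sum, Finset.mul_sum]
    refine Finset.sum_congr rfl fun m _ => ?_
    rw [this, smul_eq_mul]; field_simp

/-- The limiting normalised trace of a word. -/
def limitTrace (t : ℝ) : List Bool → ℂ
  | [] => 1
  | x :: w => ∑ m : Fin w.length, letterCov t x (w.get m) *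
      (limitTrace t (w.take m) * limitTrace t (w.drop (m + 1)))
  termination_by w => w.length
  decreasing_by all_goals grind

theorem sum_map_eraseIdx {α : Type*} (f : α → ℕ) (l : List α) (i : ℕ) (hi : i < l.length) :
    f l[i] + ((l.eraseIdx i).map f).sum = (l.map f).sum := by
  induction l generalizing i with
  | nil => simp at hi
  | cons a l ih =>
    cases i with
    | zero => simp
    | succ i =>
      have := ih i (by simpa using hi)
      simp only [List.getElem_cons_succ, List.eraseIdx_cons_succ, List.map_cons, List.sum_cons]
      omega

/-- Mixed moments factorise asymptotically, with error `O(1 / n ^ 2)`. -/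
theorem gexp_wordProd_sub_isBigO (ht : t ∈ Set.Icc (0 : ℝ) 1) (N : ℕ) :
    ∀ ws : List (List Bool), (ws.map fun w => w.length + 1).sum ≤ N →
      (fun n : ℕ => gexp (wordProd n t ws) - (ws.map (limitTrace t)).prod)
        =O[atTop] fun n : ℕ => ((n : ℝ) ^ 2)⁻¹ := by
  -- The `+ 1` per word makes the measure drop at each move: by one when an empty word is discarded
  -- or a word is split, by three when two words merge. For the merged terms only boundedness is
  -- needed, since they carry the factor `1 / n²`.
  induction N with
  | zero =>
    intro ws hws
    cases ws with
    | nil => simpa [wordProd, gexp_one] using Asymptotics.isBigO_zero _ _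
    | cons w ws => simp at hws
  | succ N ih =>
    intro ws hws
    cases ws with
    | nil => simpa [wordProd, gexp_one] using Asymptotics.isBigO_zero _ _
    | cons w ws =>
      simp only [List.map_cons, List.sum_cons] at hws
      cases w with
      | nil =>
        refine (ih ws (by simp only [List.length_nil] at hws; omega)).congr' ?_ EventuallyEq.rfl
        filter_upwards [eventually_ne_atTop 0] with n hn
        have : wordTrace n t [] = 1 := by
          rw [wordTrace, wordMat_nil, Matrix.trace_one, Fintype.card_fin, ← map_natCast C, ← C_mul,
            inv_mul_cancel₀ (by exact_mod_cast hn), C_1]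
        simp [wordProd, this, limitTrace]
      | cons x w =>
        have hlen : (x :: w).length = w.length + 1 := rfl
        rw [hlen] at hws
        have h1 : (fun n : ℕ => ∑ m : Fin w.length, letterCov t x (w.get m) *
            (gexp (wordProd n t (w.take m :: w.drop (m + 1) :: ws)) -
              ((w.take m :: w.drop (m + 1) :: ws).map (limitTrace t)).prod))
            =O[atTop] fun n : ℕ => ((n : ℝ) ^ 2)⁻¹ := by
          refine Asymptotics.IsBigO.fun_sum fun m _ => (ih _ ?_).const_mul_left _
          have := m.2
          simp only [List.map_cons, List.sum_cons, List.length_drop, List.length_take]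
          omega
        have h2 : (fun n : ℕ => ((n : ℂ) ^ 2)⁻¹ * ∑ l : Fin ws.length, ∑ m : Fin (ws.get l).length,
            letterCov t x ((ws.get l).get m) * gexp (wordProd n t
            ((w ++ ((ws.get l).drop (m + 1) ++ (ws.get l).take m)) :: ws.eraseIdx l)))
            =O[atTop] fun n : ℕ => ((n : ℝ) ^ 2)⁻¹ := by
          have h3 : (fun n : ℕ => ∑ l : Fin ws.length, ∑ m : Fin (ws.get l).length,
            letterCov t x ((ws.get l).get m) * gexp (wordProd n t
            ((w ++ ((ws.get l).drop (m + 1) ++ (ws.get l).take m)) :: ws.eraseIdx l)))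
            =O[atTop] fun _ : ℕ => (1 : ℝ) := by
            refine Asymptotics.IsBigO.fun_sum fun l _ => Asymptotics.IsBigO.fun_sum fun m _ =>
              Asymptotics.IsBigO.const_mul_left ?_ _
            have hbd : ((((w ++ ((ws.get l).drop (m + 1) ++ (ws.get l).take m)) ::
                ws.eraseIdx l)).map fun w => w.length + 1).sum ≤ N := by
              have e := sum_map_eraseIdx (fun w : List Bool => w.length + 1) ws l l.2
              have := m.2
              simp only [List.map_cons, List.sum_cons, List.length_append, List.length_drop,
                List.length_take, List.get_eq_getElem] at this ⊢
              omega
            have h4 := ih _ hbd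
            have h5 : (fun n : ℕ => ((n : ℝ) ^ 2)⁻¹) =O[atTop] fun _ : ℕ => (1 : ℝ) := by
              refine Asymptotics.IsBigO.of_bound 1 ?_
              filter_upwards [eventually_ge_atTop 1] with n hn
              have : (1 : ℝ) ≤ n := by exact_mod_cast hn
              rw [norm_inv, norm_pow, Real.norm_natCast, norm_one, one_mul]
              exact inv_le_one_of_one_le₀ (one_le_pow₀ this)
            have h6 := (h4.trans h5).add (Asymptotics.isBigO_const_const
              ((((w ++ ((ws.get l).drop (m + 1) ++ (ws.get l).take m)) ::
                ws.eraseIdx l).map (limitTrace t)).prod) (one_ne_zero (α := ℝ)) atTop)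
            simpa using h6
          have h4 : (fun n : ℕ => ((n : ℂ) ^ 2)⁻¹) =O[atTop] fun n : ℕ => ((n : ℝ) ^ 2)⁻¹ :=
            Asymptotics.isBigO_of_le _ fun n => by simp
          simpa using h4.mul h3
        refine (h1.add h2).congr' ?_ EventuallyEq.rfl
        filter_upwards [eventually_ne_atTop 0] with n hn
        rw [gexp_wordProd_cons ht hn, List.map_cons, List.prod_cons, limitTrace]
        simp only [mul_sub, Finset.sum_sub_distrib, Finset.sum_mul, List.map_cons, List.prod_cons]
        have : ∀ m : Fin w.length, letterCov t x (w.get m) * (limitTrace t (w.take m) *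
          (limitTrace t (w.drop (m + 1)) * (ws.map (limitTrace t)).prod)) =
          letterCov t x (w.get m) * (limitTrace t (w.take m) *
          limitTrace t (w.drop (m + 1))) * (ws.map (limitTrace t)).prod := fun m => by ring
        simp only [this]
        ring

end Words
end EllipticGinibre

namespace EllipticGinibre

/-! ### Dickson polynomials -/

section Dickson

open Polynomial

variable {R : Type*} [CommRing R]

theorem dickson_one_add_two (a : R) (k : ℕ) :
    dickson 1 a (k + 2) = dickson 2 a (k + 2) - C a * dickson 2 a k := by
  induction k using Nat.twoStepInduction with
  | zero => simp only [zero_add, dickson_two, dickson_zero]; push_cast; ring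
  | one =>
    rw [dickson_add_two 1, dickson_add_two 2, dickson_two, dickson_two, dickson_one, dickson_one]
    push_cast; ring
  | more k h0 h1 =>
    rw [dickson_add_two 1, h0, h1, dickson_add_two 2 a (k + 2), dickson_add_two 2 a k]
    ring

/-- The first kind arises from power sums in the logarithm of the determinant, while the second kind
is orthonormal for the limiting moments. This identity links them when a trace is differentiated. -/
theorem derivative_dickson_one (a : R) (k : ℕ) :
    derivative (dickson 1 a (k + 1)) = ((k + 1 : ℕ) : R[X]) * dickson 2 a k := by
  induction k using Nat.twoStepInduction with
  | zero => simp only [zero_add, dickson_zero, dickson_one, derivative_X]; push_cast; ring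
  | one =>
    have : dickson 1 a 2 = X ^ 2 - C (a * 2) := by
      rw [dickson_two, C_mul, C_ofNat]; push_cast; ring
    rw [this, dickson_one, derivative_sub, derivative_C, derivative_X_sq, C_ofNat]
    push_cast; ring
  | more k h0 h1 =>
    rw [dickson_add_two 1, derivative_sub, derivative_mul, derivative_C_mul, h0, h1, derivative_X,
      dickson_one_add_two, dickson_add_two 2 a k]
    push_cast
    ring

theorem eval_dickson_one (a w v : R) (h : w * v = a) (k : ℕ) :
    (dickson 1 a k).eval (w + v) = w ^ k + v ^ k := by
  induction k using Nat.twoStepInduction with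
  | zero => simp only [dickson_zero]; simp; norm_num
  | one => simp
  | more k h0 h1 =>
    rw [dickson_add_two, eval_sub, eval_mul, eval_mul, eval_X, eval_C, h0, h1, ← h]
    ring

end Dickson

/-! ### Limiting moments of polynomials -/

section Moments

open Polynomial

variable {V : Type*} [AddCommGroup V] [Module ℂ V]

/-- The linear map on polynomials with prescribed values on the powers of `X`. -/
def powerMap (f : ℕ → V) : ℂ[X] →ₗ[ℂ] V := (basisMonomials ℂ).constr ℂ f

@[simp] theorem powerMap_X_pow (f : ℕ → V) (i : ℕ) : powerMap f (X ^ i) = f i := by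
  have := (basisMonomials ℂ).constr_basis ℂ f i
  simp only [coe_basisMonomials, ← X_pow_eq_monomial] at this
  exact this

theorem linearMap_ext_X_pow {F G : ℂ[X] →ₗ[ℂ] V} (h : ∀ i, F (X ^ i) = G (X ^ i)) : F = G := by
  refine (basisMonomials ℂ).ext fun i => ?_
  simpa [← X_pow_eq_monomial] using h i

/-- The contraction of the divided difference of a polynomial with a bilinear form. -/
def divDiff (F : ℂ[X] →ₗ[ℂ] ℂ[X] →ₗ[ℂ] ℂ) : ℂ[X] →ₗ[ℂ] ℂ :=
  powerMap fun i => ∑ m : Fin i, F (X ^ (m : ℕ)) (X ^ (i - 1 - m))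

theorem divDiff_X_mul (F : ℂ[X] →ₗ[ℂ] ℂ[X] →ₗ[ℂ] ℂ) (p : ℂ[X]) :
    divDiff F (X * p) = F 1 p + divDiff (F ∘ₗ LinearMap.mulLeft ℂ X) p := by
  suffices h : divDiff F ∘ₗ LinearMap.mulLeft ℂ X =
      F 1 + divDiff (F ∘ₗ LinearMap.mulLeft ℂ X) from LinearMap.congr_fun h p
  refine linearMap_ext_X_pow fun i => ?_
  simp only [LinearMap.comp_apply, LinearMap.mulLeft_apply, LinearMap.add_apply, divDiff,
    ← pow_succ', powerMap_X_pow]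
  rw [Fin.sum_univ_succ]
  simp [Nat.sub_sub, Nat.add_comm]

theorem divDiff_add (F G : ℂ[X] →ₗ[ℂ] ℂ[X] →ₗ[ℂ] ℂ) (p : ℂ[X]) :
    divDiff (F + G) p = divDiff F p + divDiff G p := by
  suffices h : divDiff (F + G) = divDiff F + divDiff G from LinearMap.congr_fun h p
  refine linearMap_ext_X_pow fun i => ?_
  simp [divDiff, Finset.sum_add_distrib]

theorem divDiff_smul (c : ℂ) (F : ℂ[X] →ₗ[ℂ] ℂ[X] →ₗ[ℂ] ℂ) (p : ℂ[X]) :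
    divDiff (c • F) p = c * divDiff F p := by
  suffices h : divDiff (c • F) = c • divDiff F from LinearMap.congr_fun h p
  refine linearMap_ext_X_pow fun i => ?_
  simp [divDiff, Finset.mul_sum]

/-- The divided difference of the second kind is a convolution of the same family, which makes the
loop equations triangular in this basis. All `F` are treated together since `divDiff_X_mul` replaces
`F` by its composition with multiplication by `X`. -/
theorem divDiff_dickson (a : ℂ) (k : ℕ) : ∀ F : ℂ[X] →ₗ[ℂ] ℂ[X] →ₗ[ℂ] ℂ,
    divDiff F (dickson 2 a k) =
      ∑ m ∈ Finset.range k, F (dickson 2 a m) (dickson 2 a (k - 1 - m)) := by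
  have h0 : dickson 2 a 0 = 1 := by rw [dickson_zero]; push_cast; ring
  have h1 : ∀ F : ℂ[X] →ₗ[ℂ] ℂ[X] →ₗ[ℂ] ℂ, divDiff F 1 = 0 := fun F => by
    rw [← pow_zero X, divDiff, powerMap_X_pow]; simp
  induction k using Nat.twoStepInduction with
  | zero => intro F; rw [h0, h1]; simp
  | one => intro F; rw [dickson_one, ← mul_one X, divDiff_X_mul, h1]; simp [h0]
  | more k ih0 ih1 =>
    intro F
    have hX : ∀ m q, F (X * dickson 2 a (m + 1)) q =
        F (dickson 2 a (m + 2)) q + a * F (dickson 2 a m) q := by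
      intro m q
      rw [dickson_add_two, map_sub, LinearMap.sub_apply, ← smul_eq_C_mul, map_smul]
      simp
    rw [dickson_add_two 2 a k, map_sub, ← smul_eq_C_mul, map_smul, divDiff_X_mul, ih0, ih1,
      Finset.sum_range_succ', Finset.sum_range_succ' _ (k + 1), Finset.sum_range_succ' _ k]
    simp only [LinearMap.comp_apply, LinearMap.mulLeft_apply, hX, Finset.sum_add_distrib,
      ← Finset.mul_sum, smul_eq_mul, h0, mul_one]
    have e : ∀ m, k - 1 - m = k - (m + 1) := fun m => by omega
    have e' : ∀ m, k + 1 - (m + 1 + 1) = k - (m + 1) := fun m => by omega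
    have e2 : k + 2 - 1 = k + 1 := rfl
    simp only [Nat.add_sub_cancel, e2, e', Nat.sub_zero, zero_add, dickson_one, e]
    ring

/-- The limiting normalised trace of a polynomial in the matrix (`x = true`) or its adjoint. -/
def limitMoment (t : ℝ) (x : Bool) : ℂ[X] →ₗ[ℂ] ℂ :=
  powerMap fun i => limitTrace t (List.replicate i x)

/-- The limiting normalised trace of `p(A) q(A⋆)`. -/
def limitPair (t : ℝ) : ℂ[X] →ₗ[ℂ] ℂ[X] →ₗ[ℂ] ℂ :=
  powerMap fun i => powerMap fun j =>
    limitTrace t (List.replicate i true ++ List.replicate j false)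

theorem limitMoment_X_mul (t : ℝ) (x : Bool) (p : ℂ[X]) :
    limitMoment t x (X * p) = t * divDiff ((LinearMap.mul ℂ ℂ).compl₁₂ (limitMoment t x)
      (limitMoment t x)) p := by
  suffices h : limitMoment t x ∘ₗ LinearMap.mulLeft ℂ X =
      (t : ℂ) • divDiff ((LinearMap.mul ℂ ℂ).compl₁₂ (limitMoment t x) (limitMoment t x)) from
    LinearMap.congr_fun h p
  refine linearMap_ext_X_pow fun i => ?_
  simp only [LinearMap.comp_apply, LinearMap.mulLeft_apply, LinearMap.smul_apply, divDiff,
    ← pow_succ', powerMap_X_pow, limitMoment, List.replicate_succ, limitTrace,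
    LinearMap.compl₁₂_apply, LinearMap.mul_apply', smul_eq_mul, Finset.mul_sum]
  refine Fintype.sum_equiv (finCongr (by simp)) _ _ fun m => ?_
  have hm : (m : ℕ) < i := by simpa using m.2
  simp [letterCov, Nat.sub_sub, Nat.add_comm, min_eq_left hm.le]

/-- In the convolution for `X U_{k+1}` only `m = 0` survives by induction; it contributes `t` times
the moment of `U_k`, which the recursion subtracts again. -/
theorem limitMoment_dickson (t : ℝ) (x : Bool) (k : ℕ) :
    limitMoment t x (dickson 2 (t : ℂ) k) = if k = 0 then 1 else 0 := by
  have h0 : dickson 2 (t : ℂ) 0 = 1 := by rw [dickson_zero]; push_cast; ring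
  have h1 : limitMoment t x 1 = 1 := by
    rw [← pow_zero X, limitMoment, powerMap_X_pow]; simp [limitTrace]
  induction k using Nat.strong_induction_on with
  | _ k ih =>
    match k with
    | 0 => simp [h0, h1]
    | 1 =>
      rw [dickson_one, ← mul_one X, limitMoment_X_mul, ← h0, divDiff_dickson]; simp
    | k + 2 =>
      rw [dickson_add_two, map_sub, ← smul_eq_C_mul, map_smul, limitMoment_X_mul, divDiff_dickson,
        Finset.sum_range_succ', Finset.sum_eq_zero]
      · simp [h0, h1]
      · intro m hm
        rw [Finset.mem_range] at hm
        simp [ih (m + 1) (by omega)]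

/-- The limiting loop equation for the first letter, which pairs either with another copy of the
matrix (covariance `t`) or with a copy of its adjoint (covariance `1`). -/
theorem limitPair_X_mul (t : ℝ) (p q : ℂ[X]) :
    limitPair t (X * p) q =
      t * divDiff ((LinearMap.mul ℂ ℂ).compl₁₂ (limitMoment t true) ((limitPair t).flip q)) p +
      divDiff ((LinearMap.mul ℂ ℂ).compl₁₂ (limitPair t p) (limitMoment t false)) q := by
  induction p using Polynomial.induction_on' with
  | add p p' h h' =>
    have : (LinearMap.mul ℂ ℂ).compl₁₂ (limitPair t (p + p')) (limitMoment t false) =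
        (LinearMap.mul ℂ ℂ).compl₁₂ (limitPair t p) (limitMoment t false) +
        (LinearMap.mul ℂ ℂ).compl₁₂ (limitPair t p') (limitMoment t false) := by
      ext; simp
    rw [mul_add, map_add, LinearMap.add_apply, h, h', this, divDiff_add, map_add]
    ring
  | monomial i c =>
    rw [← C_mul_X_pow_eq_monomial, ← smul_eq_C_mul]
    have : (LinearMap.mul ℂ ℂ).compl₁₂ (limitPair t (c • X ^ i)) (limitMoment t false) =
        c • (LinearMap.mul ℂ ℂ).compl₁₂ (limitPair t (X ^ i)) (limitMoment t false) := by
      ext; simp [mul_assoc]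
    rw [mul_smul_comm, map_smul, LinearMap.smul_apply, this, divDiff_smul, map_smul,
      smul_eq_mul, smul_eq_mul, mul_left_comm, ← mul_add]
    congr 1
    clear this
    induction q using Polynomial.induction_on' with
    | add q q' h h' =>
      have : (LinearMap.mul ℂ ℂ).compl₁₂ (limitMoment t true) ((limitPair t).flip (q + q')) =
          (LinearMap.mul ℂ ℂ).compl₁₂ (limitMoment t true) ((limitPair t).flip q) +
          (LinearMap.mul ℂ ℂ).compl₁₂ (limitMoment t true) ((limitPair t).flip q') := by
        ext; simp [mul_add]
      rw [map_add, h, h', this, divDiff_add, map_add]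
      ring
    | monomial j d =>
      rw [← C_mul_X_pow_eq_monomial, ← smul_eq_C_mul]
      have : (LinearMap.mul ℂ ℂ).compl₁₂ (limitMoment t true) ((limitPair t).flip (d • X ^ j)) =
          d • (LinearMap.mul ℂ ℂ).compl₁₂ (limitMoment t true) ((limitPair t).flip (X ^ j)) := by
        ext; simp [mul_left_comm]
      rw [map_smul, this, divDiff_smul, map_smul,
        smul_eq_mul, smul_eq_mul, mul_left_comm, ← mul_add]
      congr 1
      clear this
      rw [← pow_succ']
      simp only [limitPair, divDiff, powerMap_X_pow, List.replicate_succ, List.cons_append,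
        limitTrace, LinearMap.compl₁₂_apply, LinearMap.mul_apply', LinearMap.flip_apply,
        limitMoment]
      have hl : (List.replicate i true ++ List.replicate j false).length = i + j := by simp
      rw [Fintype.sum_equiv (finCongr hl) _ (fun m => letterCov t true
          ((List.replicate i true ++ List.replicate j false).get ((finCongr hl).symm m)) *
          (limitTrace t ((List.replicate i true ++ List.replicate j false).take m) *
          limitTrace t ((List.replicate i true ++ List.replicate j false).drop (m + 1))))
          (fun m => by simp), Fin.sum_univ_add, Finset.mul_sum]
      congr 1
      · refine Finset.sum_congr rfl fun m _ => ?_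
        have hm := m.2
        simp [letterCov, List.take_append, List.drop_append, Nat.sub_sub,
          Nat.add_comm, Nat.sub_eq_zero_of_le hm.le,
          Nat.sub_eq_zero_of_le (Nat.succ_le_of_lt hm)]
      · refine Finset.sum_congr rfl fun m _ => ?_
        have hm := m.2
        have e : i + (m : ℕ) + 1 - i = m + 1 := by omega
        have e' : i - (i + (m : ℕ) + 1) = 0 := by omega
        simp [letterCov, List.take_append, List.drop_append, e, e', Nat.sub_sub, Nat.add_comm]

/-- Pairings within the first block give `t` times the pairing of `U_k` with `U_l`, cancelled by the
recursion for `U_{k+2}`. Pairings across the blocks give that of `U_{k+1}` with `U_{l-1}`, so both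
indices descend together. -/
theorem limitPair_dickson (t : ℝ) (k l : ℕ) :
    limitPair t (dickson 2 (t : ℂ) k) (dickson 2 (t : ℂ) l) = if k = l then 1 else 0 := by
  have h0 : dickson 2 (t : ℂ) 0 = 1 := by rw [dickson_zero]; push_cast; ring
  have h1 : ∀ q, limitPair t 1 q = limitMoment t false q := by
    intro q
    suffices h : limitPair t 1 = limitMoment t false by rw [h]
    refine linearMap_ext_X_pow fun i => ?_
    rw [← pow_zero X, limitPair, limitMoment, powerMap_X_pow, powerMap_X_pow, powerMap_X_pow]; simp
  have hD1 : ∀ k q, divDiff ((LinearMap.mul ℂ ℂ).compl₁₂ (limitMoment t true)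
      ((limitPair t).flip q)) (dickson 2 (t : ℂ) (k + 1)) = limitPair t (dickson 2 (t : ℂ) k) q := by
    intro k q
    rw [divDiff_dickson, Finset.sum_eq_single 0]
    · simp [-dickson_zero, limitMoment_dickson]
    · intro m _ hm; simp [limitMoment_dickson, hm]
    · simp
  have hD2 : ∀ p l, divDiff ((LinearMap.mul ℂ ℂ).compl₁₂ (limitPair t p) (limitMoment t false))
      (dickson 2 (t : ℂ) (l + 1)) = limitPair t p (dickson 2 (t : ℂ) l) := by
    intro p l
    rw [divDiff_dickson, Finset.sum_eq_single l]
    · simp [-dickson_zero, limitMoment_dickson]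
    · intro m hm hml
      rw [Finset.mem_range] at hm
      simp [limitMoment_dickson, show l - m ≠ 0 by omega]
    · simp
  have hD0 : ∀ F, divDiff F (dickson 2 (t : ℂ) 0) = 0 := fun F => by
    rw [divDiff_dickson]; simp
  induction k using Nat.strong_induction_on generalizing l with
  | _ k ih =>
    match k with
    | 0 => rw [h0, h1, limitMoment_dickson]; simp [eq_comm]
    | 1 =>
      rw [dickson_one, ← mul_one X, limitPair_X_mul]
      nth_rewrite 1 [← h0]
      rw [hD0]
      match l with
      | 0 => rw [hD0]; simp
      | l + 1 => rw [hD2, h1, limitMoment_dickson]; simp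
    | k + 2 =>
      rw [dickson_add_two, map_sub, ← smul_eq_C_mul, LinearMap.sub_apply, map_smul,
        limitPair_X_mul, hD1]
      match l with
      | 0 => rw [hD0]; simp
      | l + 1 => rw [hD2, ih (k + 1) (by omega)]; simp

end Moments
end EllipticGinibre

namespace EllipticGinibre

/-! ### Second moments of traces of Dickson polynomials -/

section TraceDerivative

open Polynomial

variable {R : Type*} [CommRing R] [Algebra ℂ R] {n : ℕ}

theorem trace_pow_mul_derivation_pow (D : Derivation ℂ R R) (M : Matrix (Fin n) (Fin n) R)
    (m : ℕ) : ∀ k, (M ^ k * (M ^ m).map D).trace = m * (M ^ (k + m - 1) * M.map D).trace := by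
  have hmul : ∀ A B : Matrix (Fin n) (Fin n) R, (A * B).map D = A * B.map D + A.map D * B := by
    intro A B
    ext i j
    simp [Matrix.mul_apply, Finset.sum_add_distrib, mul_comm]
  induction m with
  | zero =>
    intro k
    have : ((1 : Matrix (Fin n) (Fin n) R).map D) = 0 := by
      ext i j; simp [Matrix.one_apply, apply_ite D]
    simp [this]
  | succ m ih =>
    intro k
    rw [pow_succ', hmul, mul_add, ← mul_assoc, ← pow_succ, Matrix.trace_add, ih, ← mul_assoc,
      Matrix.trace_mul_comm (M ^ k * M.map D), ← mul_assoc, ← pow_add, show k + 1 + m - 1 = m + k by omega,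
      show k + (m + 1) - 1 = m + k by omega]
    push_cast
    ring

theorem derivation_trace_aeval (D : Derivation ℂ R R) (M : Matrix (Fin n) (Fin n) R) (p : ℂ[X]) :
    D (aeval M p).trace = (aeval M (derivative p) * M.map D).trace := by
  induction p using Polynomial.induction_on' with
  | add p q hp hq => simp [hp, hq, add_mul]
  | monomial m c =>
    have h := trace_pow_mul_derivation_pow D M m 0
    rw [pow_zero, one_mul, zero_add] at h
    have h1 : D (M ^ m).trace = ((M ^ m).map D).trace := by simp [Matrix.trace]
    rw [derivative_monomial, aeval_monomial, aeval_monomial, ← Algebra.smul_def,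
      ← Algebra.smul_def, Matrix.trace_smul, Derivation.map_smul, h1, h, smul_mul_assoc,
      Matrix.trace_smul, mul_smul, ← nsmul_eq_mul, Nat.cast_smul_eq_nsmul]

end TraceDerivative

section TraceMoments

open MvPolynomial ComplexConjugate

variable {n : ℕ} {t : ℝ}

theorem wordMat_replicate (x : Bool) (i : ℕ) :
    wordMat n t (List.replicate i x) = letter n t x ^ i := by
  simp [wordMat]

theorem isBigO_moment (ht : t ∈ Set.Icc (0 : ℝ) 1) (x : Bool) (p : Polynomial ℂ) :
    (fun n : ℕ => gexp (C ((n : ℂ)⁻¹) * (Polynomial.aeval (letter n t x) p).trace) -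
      limitMoment t x p) =O[atTop] fun n : ℕ => ((n : ℝ) ^ 2)⁻¹ := by
  induction p using Polynomial.induction_on' with
  | add p q hp hq =>
    refine (hp.add hq).congr_left fun n => ?_
    simp only [map_add, Matrix.trace_add, mul_add]
    ring
  | monomial i c =>
    have h := (gexp_wordProd_sub_isBigO ht _ [List.replicate i x] le_rfl).const_mul_left c
    refine h.congr_left fun n => ?_
    rw [← Polynomial.C_mul_X_pow_eq_monomial, ← Polynomial.smul_eq_C_mul, map_smul, map_smul,
      Matrix.trace_smul, mul_smul_comm, map_smul, limitMoment, powerMap_X_pow]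
    simp [wordProd, wordTrace, wordMat_replicate, mul_sub]

theorem isBigO_pair (ht : t ∈ Set.Icc (0 : ℝ) 1) (p q : Polynomial ℂ) :
    (fun n : ℕ => gexp (C ((n : ℂ)⁻¹) * (Polynomial.aeval (letter n t true) p *
      Polynomial.aeval (letter n t false) q).trace) - limitPair t p q)
      =O[atTop] fun n : ℕ => ((n : ℝ) ^ 2)⁻¹ := by
  induction p using Polynomial.induction_on' with
  | add p p' hp hp' =>
    refine (hp.add hp').congr_left fun n => ?_
    simp only [map_add, Matrix.trace_add, mul_add, add_mul, LinearMap.add_apply]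
    ring
  | monomial i c =>
    induction q using Polynomial.induction_on' with
    | add p q hp hq =>
      refine (hp.add hq).congr_left fun n => ?_
      simp only [map_add, Matrix.trace_add, mul_add]
      ring
    | monomial j d =>
      have h := (gexp_wordProd_sub_isBigO ht _
        [List.replicate i true ++ List.replicate j false] le_rfl).const_mul_left (c * d)
      refine h.congr_left fun n => ?_
      simp only [← Polynomial.C_mul_X_pow_eq_monomial, ← Polynomial.smul_eq_C_mul, map_smul,
        LinearMap.smul_apply, smul_mul_assoc, mul_smul_comm, Matrix.trace_smul, limitPair,
        powerMap_X_pow]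
      simp only [wordProd, wordTrace, wordMat_append, wordMat_replicate, List.map_cons,
        List.map_nil, List.prod_cons, List.prod_nil, mul_one, map_pow, Polynomial.aeval_X,
        smul_eq_mul]
      ring

/-- The matrix `A / √n` of the elliptic Ginibre ensemble as a function of its Gaussian
coordinates. -/
def ellMat (n : ℕ) (t : ℝ) (g : (Fin n × Fin n) ⊕ (Fin n × Fin n) → ℝ) :
    Matrix (Fin n) (Fin n) ℂ :=
  Matrix.of fun i j => ∑ p, letterCoef n t true i j p * (g p : ℂ)

/-- The generic matrix. -/
def genericMat (n : ℕ) : Matrix (Fin n) (Fin n) (MvPolynomial (Fin n × Fin n) ℂ) :=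
  Matrix.of fun i j => X (i, j)

theorem pderiv_trace_aeval_genericMat (s : Fin n × Fin n) (p : Polynomial ℂ) :
    pderiv s (Polynomial.aeval (genericMat n) p).trace =
      Polynomial.aeval (genericMat n) (Polynomial.derivative p) s.2 s.1 := by
  have h := derivation_trace_aeval (pderiv s) (genericMat n) p
  rw [h]
  simp [Matrix.trace, Matrix.mul_apply, genericMat, pderiv_X, Pi.single_apply, Prod.ext_iff,
    ite_and]

theorem map_aeval_matrix {R S : Type*} [CommRing R] [CommRing S] [Algebra ℂ R] [Algebra ℂ S]
    (f : R →ₐ[ℂ] S) (M : Matrix (Fin n) (Fin n) R) (p : Polynomial ℂ) :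
    (Polynomial.aeval M p).map f = Polynomial.aeval (M.map f) p :=
  (Polynomial.aeval_algHom_apply f.mapMatrix M p).symm

/-- The Dickson polynomial has real coefficients because `t` is real, so the adjoint passes to its
argument. -/
theorem conjPoly_aeval_letter (k : ℕ) (i j : Fin n) :
    conjPoly (Polynomial.aeval (letter n t true) (Polynomial.dickson 2 (t : ℂ) k) i j) =
      Polynomial.aeval (letter n t false) (Polynomial.dickson 2 (t : ℂ) k) j i := by
  induction k using Nat.twoStepInduction generalizing i j with
  | zero =>
    rw [Polynomial.dickson_zero]
    have : (3 - ((2 : ℕ) : Polynomial ℂ)) = 1 := by push_cast; ring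
    rw [this, map_one, map_one, Matrix.one_apply, Matrix.one_apply, apply_ite conjPoly]
    simp [eq_comm]
  | one =>
    rw [Polynomial.dickson_one, Polynomial.aeval_X, Polynomial.aeval_X, letter, letter,
      Matrix.of_apply, Matrix.of_apply, conjPoly_linPoly]
    congr 1
    ext p
    simp [letterCoef]
  | more k h0 h1 =>
    have e : ∀ M : Matrix (Fin n) (Fin n)
        (MvPolynomial ((Fin n × Fin n) ⊕ (Fin n × Fin n)) ℂ),
        Polynomial.aeval M (Polynomial.dickson 2 (t : ℂ) (k + 2)) =
        M * Polynomial.aeval M (Polynomial.dickson 2 (t : ℂ) (k + 1)) -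
        (t : ℂ) • Polynomial.aeval M (Polynomial.dickson 2 (t : ℂ) k) := by
      intro M
      rw [Polynomial.dickson_add_two, ← Polynomial.smul_eq_C_mul, map_sub, map_smul, map_mul,
        Polynomial.aeval_X]
    have hc : ∀ M : Matrix (Fin n) (Fin n)
        (MvPolynomial ((Fin n × Fin n) ⊕ (Fin n × Fin n)) ℂ), ∀ p : Polynomial ℂ,
        M * Polynomial.aeval M p = Polynomial.aeval M p * M := by
      intro M p
      have := congrArg (Polynomial.aeval M) (mul_comm Polynomial.X p)
      simpa only [map_mul, Polynomial.aeval_X] using this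
    have h2 : ∀ l, conjPoly (letter n t true i l) = letter n t false l i := by
      intro l
      rw [letter, letter, Matrix.of_apply, Matrix.of_apply, conjPoly_linPoly]
      congr 1
      ext p
      simp [letterCoef]
    rw [e, e, hc (letter n t false), Matrix.sub_apply, Matrix.sub_apply, map_sub,
      Matrix.smul_apply, Matrix.smul_apply, smul_eq_C_mul, smul_eq_C_mul, map_mul, h0,
      Matrix.mul_apply, Matrix.mul_apply, map_sum]
    congr 1
    · refine Finset.sum_congr rfl fun l _ => ?_
      rw [map_mul, h1, h2, mul_comm]
    · simp [conjPoly]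

theorem integral_norm_sq_eval {σ ι : Type*} [Fintype ι] (L : σ → ι → ℂ) (ζ : σ → ℂ)
    (p : MvPolynomial σ ℂ) :
    Integrable (fun g => ‖eval (fun s => ζ s + ∑ i, L s i * (g i : ℂ)) p‖ ^ 2) (stdGaussian ι) ∧
    ∫ g, ‖eval (fun s => ζ s + ∑ i, L s i * (g i : ℂ)) p‖ ^ 2 ∂(stdGaussian ι) =
      (gaussianForm L ζ p p).re := by
  have e : ∀ g : ι → ℝ, ((‖eval (fun s => ζ s + ∑ i, L s i * (g i : ℂ)) p‖ ^ 2 : ℝ) : ℂ) =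
      realEval g (linSubst L ζ p * conjPoly (linSubst L ζ p)) := by
    intro g
    rw [map_mul, realEval_conjPoly, realEval_linSubst, Complex.mul_conj, Complex.normSq_eq_norm_sq]
  constructor
  · have := (integrable_realEval (linSubst L ζ p * conjPoly (linSubst L ζ p))).re
    refine this.congr (ae_of_all _ fun g => ?_)
    simp only [← e]
    exact Complex.ofReal_re _
  · rw [gaussianForm_apply, gexp_apply]
    simp only [← e]
    rw [integral_complex_ofReal, Complex.ofReal_re]

/-- The centred trace of a Dickson polynomial. -/
def centredTrace (n : ℕ) (t : ℝ) (k : ℕ) (M : Matrix (Fin n) (Fin n) ℂ) : ℂ :=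
  (Polynomial.aeval M (Polynomial.dickson 1 (t : ℂ) k)).trace + if k = 2 then (n * t : ℂ) else 0

/-- The polynomial whose value at a matrix is `centredTrace`. -/
def centredTracePoly (n : ℕ) (t : ℝ) (k : ℕ) : MvPolynomial (Fin n × Fin n) ℂ :=
  (Polynomial.aeval (genericMat n) (Polynomial.dickson 1 (t : ℂ) k)).trace +
    C (if k = 2 then (n * t : ℂ) else 0)

theorem eval_centredTracePoly (k : ℕ) (g : (Fin n × Fin n) ⊕ (Fin n × Fin n) → ℝ) :
    eval (fun s : Fin n × Fin n => 0 + ∑ i, letterCoef n t true s.1 s.2 i * (g i : ℂ))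
      (centredTracePoly n t k) = centredTrace n t k (ellMat n t g) := by
  rw [centredTracePoly, centredTrace, map_add, eval_C]
  congr 1
  rw [← coe_aeval_eq_eval, RingHom.coe_coe, Matrix.trace, Matrix.trace, map_sum]
  refine Finset.sum_congr rfl fun i _ => ?_
  have h := map_aeval_matrix (aeval fun s : Fin n × Fin n =>
    0 + ∑ i, letterCoef n t true s.1 s.2 i * (g i : ℂ)) (genericMat n)
    (Polynomial.dickson 1 (t : ℂ) k)
  have h2 : (genericMat n).map (aeval fun s : Fin n × Fin n =>
    0 + ∑ i, letterCoef n t true s.1 s.2 i * (g i : ℂ)) = ellMat n t g := by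
    ext i j; simp [genericMat, ellMat]
  rw [h2] at h
  exact congrFun (congrFun h i) i

theorem linSubst_aeval_genericMat (p : Polynomial ℂ) (i j : Fin n) :
    linSubst (fun s : Fin n × Fin n => letterCoef n t true s.1 s.2) (fun _ => 0)
      (Polynomial.aeval (genericMat n) p i j) = Polynomial.aeval (letter n t true) p i j := by
  have h := map_aeval_matrix (linSubst (fun s : Fin n × Fin n => letterCoef n t true s.1 s.2)
    (fun _ => 0)) (genericMat n) p
  have h2 : (genericMat n).map (linSubst (fun s : Fin n × Fin n => letterCoef n t true s.1 s.2)
    (fun _ => 0)) = letter n t true := by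
    ext i j; simp [genericMat, letter, linSubst]
  rw [h2] at h
  exact congrFun (congrFun h i) j

theorem isGaussianForm_letterCoef (ht : t ∈ Set.Icc (0 : ℝ) 1) :
    IsGaussianForm (gaussianForm (fun s : Fin n × Fin n => letterCoef n t true s.1 s.2)
      fun _ => 0) Prod.swap (fun _ => 0) (t / n) (1 / n) := by
  refine isGaussianForm_gaussianForm (fun s r => ?_) (fun s r => ?_)
  · rw [sum_letterCoef_mul ht]
    have e : (s.1 = r.2 ∧ s.2 = r.1) ↔ r = s.swap := by
      rw [Prod.ext_iff]; simp only [Prod.fst_swap, Prod.snd_swap]; tauto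
    simp only [e, letterCov, if_true]
  · have : ∀ i, conj (letterCoef n t true r.1 r.2 i) = letterCoef n t false r.2 r.1 i := by
      intro i; simp [letterCoef]
    simp only [this]
    rw [sum_letterCoef_mul ht]
    have e : (s.1 = r.1 ∧ s.2 = r.2) ↔ r = s := by
      rw [Prod.ext_iff]; tauto
    simp only [e, letterCov, reduceCtorEq, if_false]

open ComplexOrder in
theorem centredTracePoly_le (ht : t ∈ Set.Icc (0 : ℝ) 1) (hn : n ≠ 0) (k : ℕ) :
    (gaussianForm (fun s : Fin n × Fin n => letterCoef n t true s.1 s.2) (fun _ => 0)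
      (centredTracePoly n t (k + 1)) (centredTracePoly n t (k + 1))).re ≤
      ‖n * gexp (C ((n : ℂ)⁻¹) * (Polynomial.aeval (letter n t true)
        (Polynomial.dickson 1 (t : ℂ) (k + 1))).trace) + if k + 1 = 2 then (n * t : ℂ) else 0‖ ^ 2 +
      (k + 1) ^ 2 * (gexp (C ((n : ℂ)⁻¹) *
        (Polynomial.aeval (letter n t true) (Polynomial.dickson 2 (t : ℂ) k) *
          Polynomial.aeval (letter n t false) (Polynomial.dickson 2 (t : ℂ) k)).trace)).re := by
  have hn' : (n : ℂ) ≠ 0 := by exact_mod_cast hn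
  -- With `β = 1 / n` and the gradient `(k + 1) U_k(M)`, transposed, the right side becomes `(k +
  -- 1)²` times the expected normalised trace of `U_k(M) U_k(M)⋆`.
  have h := (isGaussianForm_letterCoef (n := n) ht).poincare
    (by rw [one_div, ← Complex.ofReal_natCast, ← Complex.ofReal_inv]
        exact_mod_cast inv_nonneg.mpr (Nat.cast_nonneg (α := ℝ) n))
    (centredTracePoly n t (k + 1))
  set L := fun s : Fin n × Fin n => letterCoef n t true s.1 s.2 with hL
  have e1 : gaussianForm L (fun _ => 0) (centredTracePoly n t (k + 1)) 1 =
      n * gexp (C ((n : ℂ)⁻¹) * (Polynomial.aeval (letter n t true)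
        (Polynomial.dickson 1 (t : ℂ) (k + 1))).trace) +
          if k + 1 = 2 then (n * t : ℂ) else 0 := by
    rw [gaussianForm_apply, map_one, map_one, mul_one, centredTracePoly, map_add, map_add,
      ← smul_eq_C_mul, map_smul, smul_eq_mul, mul_inv_cancel_left₀ hn']
    congr 1
    · rw [Matrix.trace, map_sum]
      simp only [Matrix.diag_apply, hL, linSubst_aeval_genericMat]
      rfl
    · rw [← mul_one (C _), ← smul_eq_C_mul, map_smul, map_smul, map_one, gexp_one]; simp
  have e2 : ∑ s, gaussianForm L (fun _ => 0) (pderiv s (centredTracePoly n t (k + 1)))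
      (pderiv s (centredTracePoly n t (k + 1))) = (k + 1) ^ 2 * (n * gexp (C ((n : ℂ)⁻¹) *
        (Polynomial.aeval (letter n t true) (Polynomial.dickson 2 (t : ℂ) k) *
          Polynomial.aeval (letter n t false) (Polynomial.dickson 2 (t : ℂ) k)).trace)) := by
    have e3 : ∀ s, pderiv s (centredTracePoly n t (k + 1)) = ((k + 1 : ℕ) : ℂ) •
        Polynomial.aeval (genericMat n) (Polynomial.dickson 2 (t : ℂ) k) s.2 s.1 := by
      intro s
      rw [centredTracePoly, map_add, pderiv_C, add_zero, pderiv_trace_aeval_genericMat,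
        derivative_dickson_one, ← nsmul_eq_mul, map_nsmul, Matrix.smul_apply,
        Nat.cast_smul_eq_nsmul]
    have e4 : ∀ s, gaussianForm L (fun _ => 0) (pderiv s (centredTracePoly n t (k + 1)))
        (pderiv s (centredTracePoly n t (k + 1))) = (k + 1) ^ 2 *
        gexp (Polynomial.aeval (letter n t true) (Polynomial.dickson 2 (t : ℂ) k) s.2 s.1 *
          Polynomial.aeval (letter n t false) (Polynomial.dickson 2 (t : ℂ) k) s.1 s.2) := by
      intro s
      rw [e3, map_smulₛₗ, map_smul, LinearMap.smul_apply, gaussianForm_apply,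
        hL, linSubst_aeval_genericMat, conjPoly_aeval_letter]
      simp only [map_natCast, smul_eq_mul]
      push_cast
      ring
    rw [Finset.sum_congr rfl fun s _ => e4 s, ← Finset.mul_sum, ← smul_eq_C_mul, map_smul,
      smul_eq_mul, mul_inv_cancel_left₀ hn', ← map_sum, Fintype.sum_prod_type, Finset.sum_comm]
    rfl
  rw [e1, e2, Complex.mul_conj, Complex.normSq_eq_norm_sq] at h
  have e5 : (1 : ℂ) / n * ((k + 1) ^ 2 * (n * gexp (C ((n : ℂ)⁻¹) *
        (Polynomial.aeval (letter n t true) (Polynomial.dickson 2 (t : ℂ) k) *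
          Polynomial.aeval (letter n t false) (Polynomial.dickson 2 (t : ℂ) k)).trace))) =
      ((((k : ℝ) + 1) ^ 2 : ℝ) : ℂ) * gexp (C ((n : ℂ)⁻¹) *
        (Polynomial.aeval (letter n t true) (Polynomial.dickson 2 (t : ℂ) k) *
          Polynomial.aeval (letter n t false) (Polynomial.dickson 2 (t : ℂ) k)).trace) := by
    push_cast
    field_simp
  rw [e5] at h
  have h' := (Complex.le_def.mp h).1
  rw [Complex.sub_re, Complex.ofReal_re, Complex.re_ofReal_mul] at h'
  linarith

theorem limitMoment_dickson_one (k : ℕ) :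
    limitMoment t true (Polynomial.dickson 1 (t : ℂ) (k + 1)) = -if k + 1 = 2 then (t : ℂ) else 0 := by
  match k with
  | 0 =>
    have := limitMoment_dickson t true 1
    simpa using this
  | k + 1 =>
    rw [dickson_one_add_two, map_sub, ← Polynomial.smul_eq_C_mul, map_smul, limitMoment_dickson,
      limitMoment_dickson]
    simp

theorem centredTrace_second_moment (ht : t ∈ Set.Icc (0 : ℝ) 1) (k : ℕ) : ∀ᶠ n : ℕ in atTop,
    Integrable (fun g => ‖centredTrace n t (k + 1) (ellMat n t g)‖ ^ 2) (stdGaussian _) ∧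
    ∫ g, ‖centredTrace n t (k + 1) (ellMat n t g)‖ ^ 2 ∂(stdGaussian _) ≤ 2 * (k + 1) ^ 2 := by
  have h0 : Tendsto (fun n : ℕ => ((n : ℝ) ^ 2)⁻¹) atTop (𝓝 0) :=
    tendsto_inv_atTop_zero.comp
      ((tendsto_pow_atTop two_ne_zero).comp tendsto_natCast_atTop_atTop)
  -- The rate matters here: the unnormalised trace multiplies the error `O(1 / n²)` by `n`. The only
  -- nonzero limiting moment, `-t` in degree 2, is removed by the centring.
  have h1 : Tendsto (fun n : ℕ => n * gexp (C ((n : ℂ)⁻¹) * (Polynomial.aeval (letter n t true)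
        (Polynomial.dickson 1 (t : ℂ) (k + 1))).trace) +
          if k + 1 = 2 then (n * t : ℂ) else 0) atTop (𝓝 0) := by
    have hO := (isBigO_moment ht true (Polynomial.dickson 1 (t : ℂ) (k + 1)))
    have hO2 := (Asymptotics.isBigO_of_le atTop (f := fun n : ℕ => (n : ℂ))
      (g := fun n : ℕ => (n : ℝ)) fun n => by simp).mul hO
    have h3 : Tendsto (fun n : ℕ => (n : ℝ) * ((n : ℝ) ^ 2)⁻¹) atTop (𝓝 0) := by
      refine (tendsto_inv_atTop_zero.comp tendsto_natCast_atTop_atTop).congr fun n => ?_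
      rcases eq_or_ne n 0 with rfl | hn
      · simp
      · have : (n : ℝ) ≠ 0 := by exact_mod_cast hn
        simp only [Function.comp]; field_simp
    have h4 : Tendsto (fun n : ℕ => (n : ℂ) * (gexp (C ((n : ℂ)⁻¹) *
        (Polynomial.aeval (letter n t true) (Polynomial.dickson 1 (t : ℂ) (k + 1))).trace) -
          limitMoment t true (Polynomial.dickson 1 (t : ℂ) (k + 1)))) atTop (𝓝 0) := by
      refine Asymptotics.IsBigO.trans_tendsto hO2 h3
    refine h4.congr fun n => ?_
    rw [limitMoment_dickson_one]
    split_ifs <;> ring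
  have h2 := (isBigO_pair ht (Polynomial.dickson 2 (t : ℂ) k)
    (Polynomial.dickson 2 (t : ℂ) k)).trans_tendsto h0
  rw [limitPair_dickson, if_pos rfl] at h2
  have h3 := (h2.add_const 1)
  simp only [sub_add_cancel, zero_add] at h3
  have h5 := ((h1.norm.pow 2).add
    (((Complex.continuous_re.tendsto _).comp h3).const_mul (((k : ℝ) + 1) ^ 2)))
  have h6 : ‖(0 : ℂ)‖ ^ 2 + ((k : ℝ) + 1) ^ 2 * (1 : ℂ).re < 2 * (k + 1) ^ 2 := by
    have : (0 : ℝ) < ((k : ℝ) + 1) ^ 2 := by positivity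
    simp
    linarith
  filter_upwards [h5.eventually_lt_const h6, eventually_ne_atTop 0] with n hn hn0
  obtain ⟨hi, he⟩ := integral_norm_sq_eval (fun s : Fin n × Fin n => letterCoef n t true s.1 s.2)
    (fun _ => 0) (centredTracePoly n t (k + 1))
  simp only [eval_centredTracePoly] at hi he
  refine ⟨hi, ?_⟩
  rw [he]
  exact (centredTracePoly_le ht hn0 k).trans hn.le

end TraceMoments
end EllipticGinibre

namespace EllipticGinibre

/-! ### Nonvanishing of the characteristic polynomial -/

section EntireBound

open Asymptotics

theorem circleMean_le {f : ℂ → ℂ} {ρ b : ℝ} (h : ∀ θ, ‖f (circleMap 0 ρ θ)‖ ≤ b)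
    (hf : Continuous f) :
    (2 * Real.pi)⁻¹ * ∫ θ in 0..2 * Real.pi, ‖f (circleMap 0 ρ θ)‖ ≤ b := by
  have hpi := Real.pi_pos
  have h1 : ∫ θ in 0..2 * Real.pi, ‖f (circleMap 0 ρ θ)‖ ≤ ∫ θ in 0..2 * Real.pi, b := by
    refine intervalIntegral.integral_mono_on (by positivity) ?_ ?_ fun θ _ => h θ
    · exact ((hf.comp (continuous_circleMap 0 ρ)).norm).intervalIntegrable _ _
    · exact intervalIntegrable_const
  rw [intervalIntegral.integral_const, smul_eq_mul, sub_zero] at h1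
  rw [inv_mul_le_iff₀ (by positivity)]
  exact h1

theorem iteratedDeriv_eq_zero_of_isBigO {f : ℂ → ℂ} (hf : Differentiable ℂ f) {K m : ℕ}
    (hO : f =O[𝓝 0] fun s => s ^ (K + 1)) (hm : m ≤ K) : iteratedDeriv m f 0 = 0 := by
  obtain ⟨c, hc0, hc⟩ := hO.exists_nonneg
  rw [IsBigOWith_def, Metric.eventually_nhds_iff] at hc
  obtain ⟨ε, hε, hc⟩ := hc
  have key : ∀ᶠ ρ : ℝ in 𝓝[>] 0, ‖iteratedDeriv m f 0‖ / m.factorial ≤ c * ρ := by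
    filter_upwards [Ioo_mem_nhdsGT (lt_min hε one_pos)] with ρ hρ
    have hρ0 : 0 < ρ := hρ.1
    have hρε : ρ < ε := hρ.2.trans_le (min_le_left _ _)
    have hρ1 : ρ ≤ 1 := (hρ.2.trans_le (min_le_right _ _)).le
    have hnorm : ∀ θ, ‖circleMap 0 ρ θ‖ = ρ := fun θ => by simp [abs_of_pos hρ0]
    refine (norm_iteratedDeriv_le_circle hf hρ0 m).trans ?_
    have h1 := circleMean_le (f := f) (ρ := ρ) (b := c * ρ ^ (K + 1)) (fun θ => by
      have := hc (y := circleMap 0 ρ θ) (by rw [dist_zero_right, hnorm]; exact hρε)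
      rwa [norm_pow, hnorm] at this) hf.continuous
    calc _ ≤ c * ρ ^ (K + 1) * ρ⁻¹ ^ m := by gcongr
      _ = c * ρ ^ (K + 1 - m) := by
        rw [mul_assoc, inv_pow, ← div_eq_mul_inv, pow_sub₀ _ hρ0.ne' (by omega), div_eq_mul_inv]
      _ ≤ c * ρ ^ 1 := by
        gcongr c * ?_
        exact pow_le_pow_of_le_one hρ0.le hρ1 (by omega)
      _ = c * ρ := by rw [pow_one]
  have hlim : Tendsto (fun ρ : ℝ => c * ρ) (𝓝[>] 0) (𝓝 (c * 0)) :=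
    (tendsto_id.const_mul c).mono_left nhdsWithin_le_nhds
  have h2 := ge_of_tendsto hlim key
  rw [mul_zero] at h2
  have h3 : (0 : ℝ) < m.factorial := by exact_mod_cast m.factorial_pos
  have h4 : ‖iteratedDeriv m f 0‖ ≤ 0 := by
    rw [div_le_iff₀ h3, zero_mul] at h2; exact h2
  exact norm_le_zero_iff.mp h4

/-- The Taylor series starts at order `K + 1` and its `m`-th coefficient is at most `b r^(-m)`; what
remains is the tail of a geometric series. -/
theorem norm_le_of_isBigO {f : ℂ → ℂ} (hf : Differentiable ℂ f) {K : ℕ} {r r₀ b : ℝ}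
    (hr0 : 0 ≤ r₀) (hr : r₀ < r) (hO : f =O[𝓝 0] fun s => s ^ (K + 1))
    (hb : (2 * Real.pi)⁻¹ * ∫ θ in 0..2 * Real.pi, ‖f (circleMap 0 r θ)‖ ≤ b) {s : ℂ}
    (hs : ‖s‖ ≤ r₀) : ‖f s‖ ≤ b * (r₀ / r) ^ (K + 1) * (1 - r₀ / r)⁻¹ := by
  have hrp : 0 < r := hr0.trans_lt hr
  have hq0 : 0 ≤ r₀ / r := by positivity
  have hq1 : r₀ / r < 1 := (div_lt_one hrp).mpr hr
  have hb0 : 0 ≤ b := le_trans (mul_nonneg (by positivity)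
    (intervalIntegral.integral_nonneg (by positivity) fun _ _ => norm_nonneg _)) hb
  have hsum := Complex.hasSum_taylorSeries_of_entire hf 0 s
  rw [← hasSum_nat_add_iff' (K + 1), Finset.sum_eq_zero] at hsum
  · simp only [sub_zero] at hsum
    have hg : HasSum (fun m : ℕ => b * (r₀ / r) ^ (K + 1) * (r₀ / r) ^ m)
        (b * (r₀ / r) ^ (K + 1) * (1 - r₀ / r)⁻¹) :=
      (hasSum_geometric_of_lt_one hq0 hq1).mul_left _
    refine hsum.norm_le_of_bounded hg fun m => ?_
    rw [norm_smul, norm_smul, norm_inv, norm_pow, Complex.norm_natCast]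
    have h1 := norm_iteratedDeriv_le_circle hf hrp (m + (K + 1))
    calc _ = ‖s‖ ^ (m + (K + 1)) *
          (‖iteratedDeriv (m + (K + 1)) f 0‖ / (m + (K + 1)).factorial) := by ring
      _ ≤ r₀ ^ (m + (K + 1)) * (b * r⁻¹ ^ (m + (K + 1))) := by
        gcongr
        exact h1.trans (by gcongr)
      _ = _ := by rw [div_eq_mul_inv, mul_pow, mul_pow, pow_add, pow_add]; ring
  · intro m hm
    rw [iteratedDeriv_eq_zero_of_isBigO hf hO (by simpa [Nat.lt_succ_iff] using hm)]
    simp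

end EntireBound

/-! ### Truncated Weierstrass factors -/

section ElementaryFactor

open Asymptotics

/-- The Weierstrass elementary factor. -/
def elementaryFactor (K : ℕ) (z : ℂ) : ℂ :=
  (1 - z) * Complex.exp (∑ k ∈ Finset.range (K + 1), z ^ k / k)

/-- Near `0` the factor is the exponential of the Taylor remainder of `log(1 - z)`. The term `k = 0`
of the sum is `0`, since division by zero gives zero. -/
theorem elementaryFactor_sub_one_isBigO (K : ℕ) :
    (fun z => elementaryFactor K z - 1) =O[𝓝 0] fun z => z ^ (K + 1) := by
  have h1 : (fun z : ℂ => Complex.log (1 + -z) - Complex.logTaylor (K + 1) (-z)) =O[𝓝 0]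
      fun z => z ^ (K + 1) := by
    refine IsBigO.of_bound 2 ?_
    filter_upwards [Metric.ball_mem_nhds (0 : ℂ) (by norm_num : (0 : ℝ) < 1 / 2)] with z hz
    rw [mem_ball_zero_iff] at hz
    refine (Complex.norm_log_sub_logTaylor_le K (by rw [norm_neg]; linarith)).trans ?_
    rw [norm_neg, norm_pow]
    have h2 : (1 - ‖z‖)⁻¹ ≤ 2 := by
      rw [inv_le_comm₀ (by linarith) (by norm_num)]; linarith
    calc _ ≤ ‖z‖ ^ (K + 1) * 2 / 1 := by
          gcongr
          linarith [Nat.cast_nonneg (α := ℝ) K]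
      _ = _ := by ring
  have h2 : Tendsto (fun z : ℂ => Complex.log (1 + -z) - Complex.logTaylor (K + 1) (-z)) (𝓝 0)
      (𝓝 0) := by
    refine h1.trans_tendsto ?_
    have : Tendsto (fun z : ℂ => z ^ (K + 1)) (𝓝 0) (𝓝 (0 ^ (K + 1))) :=
      (continuous_pow (K + 1)).tendsto 0
    simpa using this
  have h3 : (fun w : ℂ => Complex.exp w - 1) =O[𝓝 0] fun w => w := by
    refine IsBigO.of_bound 2 ?_
    filter_upwards [Metric.ball_mem_nhds (0 : ℂ) one_pos] with w hw
    rw [mem_ball_zero_iff] at hw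
    exact Complex.norm_exp_sub_one_le hw.le
  refine ((h3.comp_tendsto h2).trans h1).congr' ?_ EventuallyEq.rfl
  filter_upwards [Metric.ball_mem_nhds (0 : ℂ) one_pos] with z hz
  rw [mem_ball_zero_iff] at hz
  have hz1 : 1 + -z ≠ 0 := by
    intro h
    have : z = 1 := by linear_combination -h
    rw [this] at hz; simp at hz
  have h4 : Complex.logTaylor (K + 1) (-z) = -∑ k ∈ Finset.range (K + 1), z ^ k / k := by
    rw [Complex.logTaylor, ← Finset.sum_neg_distrib]
    refine Finset.sum_congr rfl fun k _ => ?_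
    rw [neg_pow z, ← mul_assoc, ← pow_add, show k + 1 + k = 2 * k + 1 by ring, pow_succ, pow_mul]
    simp [neg_div]
  simp only [Function.comp, elementaryFactor]
  rw [h4, sub_neg_eq_add, Complex.exp_add, Complex.exp_log hz1, sub_eq_add_neg (1 : ℂ) z]

theorem mul_sub_one_isBigO {f g : ℂ → ℂ} {K : ℕ}
    (hf : (fun s => f s - 1) =O[𝓝 0] fun s => s ^ (K + 1))
    (hg : (fun s => g s - 1) =O[𝓝 0] fun s => s ^ (K + 1)) :
    (fun s => f s * g s - 1) =O[𝓝 0] fun s => s ^ (K + 1) := by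
  have h0 : (fun s : ℂ => s ^ (K + 1)) =O[𝓝 0] fun _ => (1 : ℂ) :=
    ((continuous_pow (K + 1)).tendsto (0 : ℂ)).isBigO_one ℂ
  have hg1 : g =O[𝓝 0] fun _ => (1 : ℂ) := by
    have := (hg.trans h0).add (isBigO_refl (fun _ => (1 : ℂ)) (𝓝 0))
    simpa using this
  have := (hf.mul hg1).add (hg.trans (by simpa using isBigO_refl _ _ : _ =O[𝓝 0] fun s : ℂ => s ^ (K + 1) * 1))
  refine (this.congr_left fun s => ?_).congr_right fun s => mul_one _
  ring

theorem multiset_prod_sub_one_isBigO {ι : Type*} (S : Multiset ι) (f : ι → ℂ → ℂ) {K : ℕ}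
    (hf : ∀ i, (fun s => f i s - 1) =O[𝓝 0] fun s => s ^ (K + 1)) :
    (fun s => (S.map fun i => f i s).prod - 1) =O[𝓝 0] fun s => s ^ (K + 1) := by
  induction S using Multiset.induction_on with
  | empty => simpa using isBigO_zero _ _
  | cons a S ih =>
    simp only [Multiset.map_cons, Multiset.prod_cons]
    exact mul_sub_one_isBigO (hf a) ih

/-- Write `1 + a s² - s l = (1 - s w)(1 - s v)` with `w + v = l` and `w v = a`. The power sums `w^k
+ v^k` in the product of the two elementary factors are the Dickson values at `l`. -/
theorem quadraticFactor_sub_one_isBigO (a l : ℂ) (K : ℕ) :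
    (fun s => (1 + a * s ^ 2 - s * l) * Complex.exp (∑ k ∈ Finset.range (K + 1),
      (Polynomial.dickson 1 a k).eval l * s ^ k / k) - 1) =O[𝓝 0] fun s => s ^ (K + 1) := by
  obtain ⟨d, hd⟩ := IsAlgClosed.exists_pow_nat_eq (l ^ 2 - 4 * a) (n := 2) (by norm_num)
  set w := (l + d) / 2
  set v := (l - d) / 2
  have hwv : w * v = a := by
    simp only [w, v]; linear_combination (-1 / 4) * hd
  have hl : w + v = l := by simp only [w, v]; ring
  have hE : ∀ c : ℂ, (fun s => elementaryFactor K (s * c) - 1) =O[𝓝 0] fun s => s ^ (K + 1) := by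
    intro c
    have ht : Tendsto (fun s : ℂ => s * c) (𝓝 0) (𝓝 0) := by
      simpa using (continuous_mul_const c).tendsto (0 : ℂ)
    refine ((elementaryFactor_sub_one_isBigO K).comp_tendsto ht).trans ?_
    refine IsBigO.of_bound (‖c‖ ^ (K + 1)) (Eventually.of_forall fun s => ?_)
    simp only [Function.comp, norm_pow, norm_mul, mul_pow]
    rw [mul_comm]
  refine (mul_sub_one_isBigO (hE w) (hE v)).congr_left fun s => ?_
  congr 1
  rw [elementaryFactor, elementaryFactor, mul_mul_mul_comm, ← Complex.exp_add,
    ← Finset.sum_add_distrib]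
  congr 1
  · rw [← hl, ← hwv]; ring
  · congr 1
    refine Finset.sum_congr rfl fun k _ => ?_
    rw [← hl, eval_dickson_one a w v hwv, mul_pow, mul_pow]
    ring

end ElementaryFactor

/-! ### Spectral mapping with multiplicities -/

section Roots

open Polynomial

variable {n : ℕ} (M : Matrix (Fin n) (Fin n) ℂ)

theorem det_aeval (q : ℂ[X]) :
    (aeval M q).det = (M.charpoly.roots.map fun l => q.eval l).prod := by
  have hcard : M.charpoly.roots.card = n := by
    rw [← (IsAlgClosed.splits M.charpoly).natDegree_eq_card_roots, Matrix.charpoly_natDegree_eq_dim,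
      Fintype.card_fin]
  have hC : ∀ c : ℂ, (aeval M (C c)).det = (M.charpoly.roots.map fun l => (C c).eval l).prod := by
    intro c
    simp [hcard, Algebra.algebraMap_eq_smul_one]
  have hX : ∀ r : ℂ, (aeval M (X - C r)).det =
      (M.charpoly.roots.map fun l => (X - C r).eval l).prod := by
    intro r
    have h1 := Matrix.eval_charpoly M r
    rw [(IsAlgClosed.splits M.charpoly).eq_prod_roots_of_monic M.charpoly_monic,
      eval_multiset_prod, Multiset.map_map] at h1
    have h2 : aeval M (X - C r) = -(Matrix.scalar _ r - M) := by
      rw [map_sub, aeval_X, aeval_C, neg_sub]; rfl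
    rw [h2, Matrix.det_neg, ← h1, Fintype.card_fin]
    have h3 : (-1 : ℂ) ^ n = (M.charpoly.roots.map fun _ => (-1 : ℂ)).prod := by simp [hcard]
    rw [h3, ← Multiset.prod_map_mul]
    simp
  rw [(IsAlgClosed.splits q).eq_prod_roots]
  generalize q.roots = S
  generalize q.leadingCoeff = c
  induction S using Multiset.induction_on with
  | empty => simpa using hC c
  | cons r S ih =>
    rw [Multiset.map_cons, Multiset.prod_cons, mul_left_comm, map_mul, Matrix.det_mul, ih, hX,
      ← Multiset.prod_map_mul]
    simp only [eval_mul]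

theorem trace_aeval (p : ℂ[X]) :
    (aeval M p).trace = (M.charpoly.roots.map fun l => p.eval l).sum := by
  have h : (aeval M p).charpoly = ((M.charpoly.roots.map fun l => p.eval l).map
      fun a => X - C a).prod := by
    refine Polynomial.funext fun c => ?_
    rw [Matrix.eval_charpoly, eval_multiset_prod, Multiset.map_map, Multiset.map_map]
    have := det_aeval M (C c - p)
    rw [map_sub, aeval_C] at this
    refine Eq.trans this ?_
    simp
  rw [Matrix.trace_eq_sum_roots_charpoly, h, roots_multiset_prod_X_sub_C]

theorem det_smul_one_sub (c s : ℂ) :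
    (c • (1 : Matrix (Fin n) (Fin n) ℂ) - s • M).det =
      (M.charpoly.roots.map fun l => c - s * l).prod := by
  have := det_aeval M (C c - C s * X)
  simpa [Algebra.algebraMap_eq_smul_one] using this

end Roots

/-! ### From controlled traces to absence of zeros -/

section Nonvanishing

open Asymptotics

/-- The normalised reversed characteristic polynomial. -/
def normDet {n : ℕ} (t : ℝ) (M : Matrix (Fin n) (Fin n) ℂ) (s : ℂ) : ℂ :=
  ((1 + t * s ^ 2) • (1 : Matrix (Fin n) (Fin n) ℂ) - s • M).det *
    Complex.exp (-(n * (t * s ^ 2) / 2))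

theorem differentiable_normDet {n : ℕ} (t : ℝ) (M : Matrix (Fin n) (Fin n) ℂ) :
    Differentiable ℂ (normDet t M) := by
  have h : normDet t M = fun s => (((M.charpoly.roots.toList).map
      fun l => 1 + (t : ℂ) * s ^ 2 - s * l)).prod * Complex.exp (-(n * (t * s ^ 2) / 2)) := by
    ext s
    rw [normDet, det_smul_one_sub]
    conv_lhs => rw [← Multiset.coe_toList M.charpoly.roots]
    rw [Multiset.map_coe, Multiset.prod_coe]
  rw [h]
  refine Differentiable.mul ?_ (by fun_prop)
  induction M.charpoly.roots.toList with
  | nil => simp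
  | cons a l ih =>
    simp only [List.map_cons, List.prod_cons]
    exact Differentiable.mul (by fun_prop) ih

/-- The product of the quadratic factors over the eigenvalues. The Gaussian factor of `normDet`
matches the shift `n t` in `centredTrace` at `k = 2`, so `K ≥ 2` is required. -/
theorem normDet_mul_exp_sub_one_isBigO {n : ℕ} (t : ℝ) (M : Matrix (Fin n) (Fin n) ℂ) {K : ℕ}
    (hK : 2 ≤ K) :
    (fun s => normDet t M s * Complex.exp (∑ k ∈ Finset.range (K + 1),
      (if k = 0 then 0 else centredTrace n t k M) * s ^ k / k) - 1) =O[𝓝 0]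
        fun s => s ^ (K + 1) := by
  have h := multiset_prod_sub_one_isBigO M.charpoly.roots _
    fun l => quadraticFactor_sub_one_isBigO (t : ℂ) l K
  refine h.congr_left fun s => ?_
  congr 1
  rw [Multiset.prod_map_mul, normDet, det_smul_one_sub, mul_assoc, ← Complex.exp_add]
  congr 1
  have h1 : (M.charpoly.roots.map fun l => Complex.exp (∑ k ∈ Finset.range (K + 1),
      (Polynomial.dickson 1 (t : ℂ) k).eval l * s ^ k / k)).prod =
      Complex.exp ((M.charpoly.roots.map fun l => (∑ k ∈ Finset.range (K + 1),
      (Polynomial.dickson 1 (t : ℂ) k).eval l * s ^ k / k)).sum) := by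
    rw [Complex.exp_multiset_sum, Multiset.map_map]; rfl
  rw [h1]
  congr 1
  rw [Multiset.sum_map_sum]
  have h2 : ∀ k ∈ Finset.range (K + 1), (M.charpoly.roots.map fun l =>
      (Polynomial.dickson 1 (t : ℂ) k).eval l * s ^ k / k).sum =
      (if k = 0 then 0 else centredTrace n t k M) * s ^ k / k -
        if k = 2 then n * (t * s ^ 2) / 2 else 0 := by
    intro k _
    rcases eq_or_ne k 0 with rfl | hk
    · simp
    · rw [if_neg hk, centredTrace, trace_aeval]
      simp only [mul_div_assoc]
      rw [Multiset.sum_map_mul_right]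
      split_ifs with h2
      · subst h2; push_cast; ring
      · ring
  rw [Finset.sum_congr rfl h2, Finset.sum_sub_distrib, Finset.sum_ite_eq', if_pos (by simp; omega)]
  ring

/-- The corrected function minus one vanishes to order `K + 1`. Because `ρ r < 1`, its circle mean
is at most `b exp(b / (1 - ρ r)) + 1` whatever `K` is. Once `K` makes the resulting bound on the
disc smaller than 1, a zero of the determinant, where the value is `-1`, is impossible. `K` depends
only on `b` and the radii, not on the matrix or its size. -/
theorem exists_forall_det_ne_zero {r r₀ ρ b : ℝ} (hr0 : 0 ≤ r₀) (hr : r₀ < r) (hρ0 : 0 ≤ ρ)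
    (hρ : ρ * r < 1) : ∃ K : ℕ, ∀ (t : ℝ) (n : ℕ) (M : Matrix (Fin n) (Fin n) ℂ),
      ((2 * Real.pi)⁻¹ * ∫ θ in 0..2 * Real.pi, ‖normDet t M (circleMap 0 r θ)‖ ≤ b) →
      (∀ k < K, ‖centredTrace n t (k + 1) M‖ ≤ b * (k + 1) * ρ ^ (k + 1)) →
      ∀ s : ℂ, ‖s‖ ≤ r₀ → ((1 + t * s ^ 2) • (1 : Matrix (Fin n) (Fin n) ℂ) - s • M).det ≠ 0 := by
  have hrp : 0 < r := hr0.trans_lt hr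
  have hq0 : 0 ≤ r₀ / r := by positivity
  have hq1 : r₀ / r < 1 := (div_lt_one hrp).mpr hr
  have hlim : Tendsto (fun K : ℕ => (b * Real.exp (b * (1 - ρ * r)⁻¹) + 1) * (r₀ / r) ^ (K + 1) *
      (1 - r₀ / r)⁻¹) atTop (𝓝 0) := by
    have := (((tendsto_pow_atTop_nhds_zero_of_lt_one hq0 hq1).comp (tendsto_add_atTop_nat 1)).const_mul
      (b * Real.exp (b * (1 - ρ * r)⁻¹) + 1)).mul_const (1 - r₀ / r)⁻¹
    simpa using this
  obtain ⟨K, hK1, hK2⟩ := ((hlim.eventually_lt_const one_pos).and (eventually_ge_atTop 2)).exists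
  refine ⟨K, fun t n M hM hc s hs hdet => ?_⟩
  set e : ℂ → ℂ := fun s => Complex.exp (∑ k ∈ Finset.range (K + 1),
      (if k = 0 then 0 else centredTrace n t k M) * s ^ k / k) with he
  have hb0 : 0 ≤ b := le_trans (mul_nonneg (by positivity)
    (intervalIntegral.integral_nonneg (by positivity) fun _ _ => norm_nonneg _)) hM
  have hed : Differentiable ℂ e := by simp only [he]; fun_prop
  have hnd := differentiable_normDet t M
  have hO := normDet_mul_exp_sub_one_isBigO t M hK2
  have hnorm : ∀ θ, ‖circleMap 0 r θ‖ = r := fun θ => by simp [abs_of_pos hrp]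
  have hen : ∀ θ, ‖e (circleMap 0 r θ)‖ ≤ Real.exp (b * (1 - ρ * r)⁻¹) := by
    intro θ
    rw [he]
    refine (Complex.norm_exp_le_exp_norm _).trans (Real.exp_le_exp.mpr ?_)
    have hg := (hasSum_geometric_of_lt_one (by positivity : 0 ≤ ρ * r) hρ).mul_left b
    refine (norm_sum_le _ _).trans ((Finset.sum_le_sum fun k hk => ?_).trans
      (sum_le_hasSum (Finset.range (K + 1)) (fun k _ => by positivity) hg))
    match k with
    | 0 => simp; exact hb0
    | k + 1 =>
      rw [if_neg k.succ_ne_zero, norm_div, norm_mul, norm_pow, hnorm, Complex.norm_natCast,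
        div_le_iff₀ (by positivity)]
      calc _ ≤ b * (k + 1) * ρ ^ (k + 1) * r ^ (k + 1) := by
            gcongr
            exact hc k (by simpa using hk)
        _ = _ := by push_cast; rw [mul_pow]; ring
  have hmean : (2 * Real.pi)⁻¹ * ∫ θ in 0..2 * Real.pi,
      ‖normDet t M (circleMap 0 r θ) * e (circleMap 0 r θ) - 1‖ ≤
      b * Real.exp (b * (1 - ρ * r)⁻¹) + 1 := by
    have hpi := Real.pi_pos
    have hcirc := continuous_circleMap 0 r
    have c1 : Continuous fun θ => ‖normDet t M (circleMap 0 r θ)‖ :=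
      (hnd.continuous.comp hcirc).norm
    have c2 : Continuous fun θ => ‖normDet t M (circleMap 0 r θ)‖ *
        Real.exp (b * (1 - ρ * r)⁻¹) := c1.mul continuous_const
    have h1 : ∫ θ in 0..2 * Real.pi, ‖normDet t M (circleMap 0 r θ) * e (circleMap 0 r θ) - 1‖ ≤
        ∫ θ in 0..2 * Real.pi, (‖normDet t M (circleMap 0 r θ)‖ *
          Real.exp (b * (1 - ρ * r)⁻¹) + 1) := by
      refine intervalIntegral.integral_mono_on (by positivity) ?_ ?_ fun θ _ => ?_
      · exact ((((hnd.continuous.comp hcirc).mul (hed.continuous.comp hcirc)).sub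
          continuous_const).norm).intervalIntegrable _ _
      · exact (c2.add continuous_const).intervalIntegrable _ _
      · refine (norm_sub_le _ _).trans ?_
        rw [norm_mul, norm_one]
        gcongr
        exact hen θ
    rw [intervalIntegral.integral_add (c2.intervalIntegrable _ _)
      intervalIntegrable_const, intervalIntegral.integral_mul_const,
      intervalIntegral.integral_const, smul_eq_mul, sub_zero, mul_one] at h1
    calc _ ≤ (2 * Real.pi)⁻¹ * _ := mul_le_mul_of_nonneg_left h1 (by positivity)
      _ = ((2 * Real.pi)⁻¹ * ∫ θ in 0..2 * Real.pi, ‖normDet t M (circleMap 0 r θ)‖) *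
          Real.exp (b * (1 - ρ * r)⁻¹) + 1 := by field_simp
      _ ≤ _ := by gcongr
  have hfin := norm_le_of_isBigO (f := fun s => normDet t M s * e s - 1)
    ((hnd.mul hed).sub_const 1) hr0 hr hO hmean hs
  simp only [normDet, hdet] at hfin
  simp at hfin
  linarith

end Nonvanishing
end EllipticGinibre

namespace EllipticGinibre

/-! ### The complement of the ellipse -/

section Geometry

variable {t : ℝ}

/-- With `R = ‖w‖²`, the circle of radius `√R` is mapped to an ellipse; both of its semi-axes are
small enough as soon as `(1 - R)(R - t²) ≥ 0`, which follows from `t² ≤ t ≤ R ≤ 1`. -/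
theorem add_div_mem_limitingEllipse (ht : t ∈ Set.Icc (0 : ℝ) 1) {w : ℂ} (hw : ‖w‖ ≤ 1)
    (hwt : t ≤ ‖w‖ ^ 2) : w + t * w⁻¹ ∈ limitingEllipse t := by
  obtain ⟨ht0, ht1⟩ := ht
  set R := ‖w‖ ^ 2 with hR
  have hR1 : R ≤ 1 := pow_le_one₀ (norm_nonneg w) hw
  have hR0 : 0 ≤ R := by positivity
  have hRe : R = w.re ^ 2 + w.im ^ 2 := by
    rw [hR, ← Complex.normSq_eq_norm_sq, Complex.normSq_apply]; ring
  have hre : (w + t * w⁻¹).re = w.re * (1 + t / R) := by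
    simp only [Complex.add_re, Complex.re_ofReal_mul, Complex.inv_re, Complex.normSq_eq_norm_sq,
      ← hR]
    ring
  have him : (w + t * w⁻¹).im = w.im * (1 - t / R) := by
    simp only [Complex.add_im, Complex.im_ofReal_mul, Complex.inv_im, Complex.normSq_eq_norm_sq,
      ← hR]
    ring
  unfold limitingEllipse
  rcases hR0.eq_or_lt with h0 | hpos
  · have hw0 : w = 0 := by
      have : ‖w‖ = 0 := by rw [← h0] at hR; exact pow_eq_zero_iff two_ne_zero |>.mp hR.symm
      exact norm_eq_zero.mp this
    subst hw0
    split_ifs <;> simp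
  split_ifs with h1
  · have hR' : R = 1 := le_antisymm hR1 (h1 ▸ hwt)
    rw [Set.mem_ofPred_eq, him, hre, hR', h1]
    have hb : |w.re| ≤ 1 := (Complex.abs_re_le_norm w).trans hw
    rw [abs_le] at hb
    refine ⟨by norm_num, ?_, ?_⟩ <;> linarith [hb.1, hb.2]
  · have ht1' : 0 < 1 - t := by
      rcases ht1.lt_or_eq with h | h
      · linarith
      · exact absurd h h1
    have key : 0 ≤ (1 - R) * (R - t ^ 2) := mul_nonneg (by linarith) (by nlinarith)
    have e1 : (1 + t / R) ^ 2 * R ≤ (1 + t) ^ 2 := by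
      have : (1 + t / R) ^ 2 * R = (R + t) ^ 2 / R := by field_simp
      rw [this, div_le_iff₀ hpos]; nlinarith
    have e2 : (1 - t / R) ^ 2 * R ≤ (1 - t) ^ 2 := by
      have : (1 - t / R) ^ 2 * R = (R - t) ^ 2 / R := by field_simp
      rw [this, div_le_iff₀ hpos]; nlinarith
    have f1 : (w.re * (1 + t / R) / (1 + t)) ^ 2 ≤ w.re ^ 2 / R := by
      rw [div_pow, div_le_div_iff₀ (by positivity) hpos]
      nlinarith [mul_le_mul_of_nonneg_left e1 (sq_nonneg w.re)]
    have f2 : (w.im * (1 - t / R) / (1 - t)) ^ 2 ≤ w.im ^ 2 / R := by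
      rw [div_pow, div_le_div_iff₀ (by positivity) hpos]
      nlinarith [mul_le_mul_of_nonneg_left e2 (sq_nonneg w.im)]
    rw [Set.mem_ofPred_eq, him, hre]
    calc _ ≤ w.re ^ 2 / R + w.im ^ 2 / R := add_le_add f1 f2
      _ = 1 := by rw [← add_div, ← hRe, div_self hpos.ne']

/-- Take the larger root of `w² - z w + t`. The roots have product `t`, so `t ≤ ‖w‖²`, and `‖w‖ ≤ 1`
would put `z` in the ellipse. -/
theorem exists_add_div_eq (ht : t ∈ Set.Icc (0 : ℝ) 1) {z : ℂ} (hz : z ∉ limitingEllipse t) :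
    ∃ w : ℂ, 1 < ‖w‖ ∧ w + t * w⁻¹ = z := by
  obtain ⟨d, hd⟩ := IsAlgClosed.exists_pow_nat_eq (z ^ 2 - 4 * t) (n := 2) (by norm_num)
  have key : ∀ w v : ℂ, w * v = t → w + v = z → ‖v‖ ≤ ‖w‖ → ∃ w : ℂ, 1 < ‖w‖ ∧ w + t * w⁻¹ = z := by
    intro w v h1 h2 h3
    have hwt : t ≤ ‖w‖ ^ 2 := by
      have : ‖w‖ * ‖v‖ = t := by
        rw [← norm_mul, h1, Complex.norm_real, Real.norm_of_nonneg ht.1]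
      nlinarith [norm_nonneg w]
    have hz' : w + t * w⁻¹ = z := by
      rcases eq_or_ne w 0 with rfl | hw
      · have : v = 0 := by simpa using h3
        simp [← h2, this]
      · rw [← h1, ← h2]; field_simp
    refine ⟨w, ?_, hz'⟩
    by_contra hle
    exact hz (hz' ▸ add_div_mem_limitingEllipse ht (not_lt.mp hle) hwt)
  have h1 : (z + d) / 2 * ((z - d) / 2) = t := by linear_combination (-1 / 4) * hd
  rcases le_total ‖(z - d) / 2‖ ‖(z + d) / 2‖ with h | h
  · exact key _ _ h1 (by ring) h
  · exact key _ _ (by rw [mul_comm]; exact h1) (by ring) h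

theorem exists_radius (ht : t ∈ Set.Icc (0 : ℝ) 1) {C : Set ℂ} (hC : IsClosed C)
    (hdisj : Disjoint C (limitingEllipse t)) :
    ∃ r₀ : ℝ, 0 < r₀ ∧ r₀ < 1 ∧ ∀ z ∈ C, ∃ s : ℂ, s ≠ 0 ∧ ‖s‖ ≤ r₀ ∧ s⁻¹ + t * s = z := by
  have hC' : ∀ z ∈ C, z ∉ limitingEllipse t := fun z hz hz' => Set.disjoint_left.mp hdisj hz hz'
  -- `C` may be unbounded, so compactness is used only for `‖w‖ ≤ 2`, an arbitrary cut-off. On `W`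
  -- the norm attains a minimum, which exceeds 1 because unit vectors are mapped into the ellipse.
  set W : Set ℂ := (Metric.closedBall 0 2 ∩ {w | 1 ≤ ‖w‖}) ∩ (fun w => w + t * w⁻¹) ⁻¹' C with hW
  have hclosed : IsClosed W := by
    refine ContinuousOn.preimage_isClosed_of_isClosed ?_
      (Metric.isClosed_closedBall.inter (isClosed_le continuous_const continuous_norm)) hC
    refine continuousOn_id.add (continuousOn_const.mul (continuousOn_id.inv₀ fun w hw h => ?_))
    have : (1 : ℝ) ≤ ‖w‖ := hw.2
    simp only [id] at h
    rw [h, norm_zero] at this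
    linarith
  have hcomp : IsCompact W := (isCompact_closedBall (0 : ℂ) 2).of_isClosed_subset hclosed
    fun w hw => hw.1.1
  obtain ⟨m, hm1, hm⟩ : ∃ m : ℝ, 1 < m ∧ ∀ w ∈ W, m ≤ ‖w‖ := by
    rcases W.eq_empty_or_nonempty with he | hne
    · exact ⟨2, by norm_num, fun w hw => by simp [he] at hw⟩
    · obtain ⟨w₀, hw₀, hmin⟩ := hcomp.exists_isMinOn hne continuous_norm.continuousOn
      refine ⟨‖w₀‖, ?_, fun w hw => hmin hw⟩
      have h1 : 1 ≤ ‖w₀‖ := hw₀.1.2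
      rcases h1.lt_or_eq with h | h
      · exact h
      · exact absurd (add_div_mem_limitingEllipse ht h.ge (by rw [← h]; simpa using ht.2))
          (hC' _ hw₀.2)
  have hm2 : 1 < min m 2 := lt_min hm1 (by norm_num)
  refine ⟨(min m 2)⁻¹, by positivity, inv_lt_one_of_one_lt₀ hm2, fun z hz => ?_⟩
  obtain ⟨w, hw1, hwz⟩ := exists_add_div_eq ht (hC' z hz)
  have hw0 : w ≠ 0 := by rintro rfl; rw [norm_zero] at hw1; linarith
  refine ⟨w⁻¹, inv_ne_zero hw0, ?_, by rw [inv_inv, hwz]⟩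
  rw [norm_inv]
  refine inv_anti₀ (by positivity) ?_
  rcases le_or_gt ‖w‖ 2 with h | h
  · exact (min_le_left _ _).trans (hm w ⟨⟨by simpa using h, hw1.le⟩, by
      rw [Set.mem_preimage, hwz]; exact hz⟩)
  · exact (min_le_right _ _).trans h.le

end Geometry

/-! ### Second moment of the determinant -/

section DetMoment

open MvPolynomial ComplexConjugate

variable {n : ℕ} {t : ℝ}

/-- With `a = t s²`, the matrix `(1 + a) - s M` is Gaussian with mean `(1 + a) • 1`, relation `a /
n` and covariance `r² / n`. Thus `det_le` produces the sum bounded in `sum_hermiteSeq_le`, and `‖a‖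
≤ r²`. -/
theorem integral_norm_sq_normDet_le (ht : t ∈ Set.Icc (0 : ℝ) 1) {r : ℝ} (hr0 : 0 ≤ r)
    (hr : r < 1) : ∃ K : ℝ, ∀ n : ℕ, n ≠ 0 → ∀ s : ℂ, ‖s‖ = r →
      Integrable (fun g => ‖normDet t (ellMat n t g) s‖ ^ 2) (stdGaussian _) ∧
      ∫ g, ‖normDet t (ellMat n t g) s‖ ^ 2 ∂(stdGaussian _) ≤ K := by
  obtain ⟨K, hK⟩ := sum_hermiteSeq_le hr0 hr
  refine ⟨K, fun n hn s hs => ?_⟩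
  set a : ℂ := t * s ^ 2 with ha
  have han : ‖a‖ ≤ r ^ 2 := by
    rw [ha, norm_mul, norm_pow, hs, Complex.norm_real, Real.norm_of_nonneg ht.1]
    exact mul_le_of_le_one_left (by positivity) ht.2
  set L := fun p : Fin n × Fin n => fun i => -s * letterCoef n t true p.1 p.2 i with hL
  have hform : IsGaussianForm (gaussianForm L fun p => if p.1 = p.2 then 1 + a else 0) Prod.swap
      (fun p => if p.1 = p.2 then 1 + a else 0) (a / n) ((r ^ 2 / n : ℝ) : ℂ) := by
    refine isGaussianForm_gaussianForm (fun p q => ?_) (fun p q => ?_)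
    · have h1 : ∀ i, L p i * L q i =
          s ^ 2 * (letterCoef n t true p.1 p.2 i * letterCoef n t true q.1 q.2 i) := fun i => by
        simp only [hL]; ring
      rw [Finset.sum_congr rfl fun i _ => h1 i, ← Finset.mul_sum, sum_letterCoef_mul ht]
      have e : (p.1 = q.2 ∧ p.2 = q.1) ↔ q = p.swap := by
        rw [Prod.ext_iff]; simp only [Prod.fst_swap, Prod.snd_swap]; tauto
      simp only [e, letterCov, if_true]
      split_ifs
      · rw [ha]; ring
      · simp
    · have h1 : ∀ i, L p i * conj (L q i) = (s * conj s) *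
          (letterCoef n t true p.1 p.2 i * letterCoef n t false q.2 q.1 i) := fun i => by
        have : conj (letterCoef n t true q.1 q.2 i) = letterCoef n t false q.2 q.1 i := by
          simp [letterCoef]
        simp only [hL, map_mul, map_neg, this]; ring
      rw [Finset.sum_congr rfl fun i _ => h1 i, ← Finset.mul_sum, sum_letterCoef_mul ht]
      have e : (p.1 = q.1 ∧ p.2 = q.2) ↔ q = p := by
        rw [Prod.ext_iff]; tauto
      simp only [e, letterCov, reduceCtorEq, if_false, Complex.mul_conj, Complex.normSq_eq_norm_sq,
        hs]
      split_ifs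
      · push_cast; ring
      · simp
  have hle := hform.det_le (by positivity)
  obtain ⟨hi, he⟩ := integral_norm_sq_eval L (fun p => if p.1 = p.2 then 1 + a else 0) (genDet n)
  have hev : ∀ g : (Fin n × Fin n) ⊕ (Fin n × Fin n) → ℝ,
      ‖normDet t (ellMat n t g) s‖ ^ 2 = ‖eval (fun p => (if p.1 = p.2 then 1 + a else 0) +
        ∑ i, L p i * (g i : ℂ)) (genDet n)‖ ^ 2 * Real.exp (-(n * a.re)) := by
    intro g
    rw [normDet, norm_mul, mul_pow, genDet, RingHom.map_det, Complex.norm_exp, ← Real.exp_nat_mul]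
    congr 2
    · congr 2
      ext i j
      have hpg : partialGeneric (fun _ : Fin n => none) i j = X (i, j) := by
        rw [partialGeneric_none (f := fun _ : Fin n => none) rfl]
      simp only [RingHom.mapMatrix_apply, Matrix.map_apply, hpg, eval_X,
        Matrix.sub_apply, Matrix.smul_apply, Matrix.one_apply, smul_eq_mul, mul_ite, mul_one,
        mul_zero, ellMat, Matrix.of_apply, hL, Finset.mul_sum, sub_eq_add_neg,
        ← Finset.sum_neg_distrib]
      congr 1
      exact Finset.sum_congr rfl fun p _ => by ring
    · rw [← ha]
      have : (-((n : ℂ) * a / 2)).re = -(n * a.re / 2) := by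
        rw [Complex.neg_re, Complex.div_ofNat_re, ← Complex.ofReal_natCast, Complex.re_ofReal_mul]
      rw [this]; push_cast; ring
  simp only [hev]
  refine ⟨hi.mul_const _, ?_⟩
  rw [integral_mul_const, he]
  refine le_trans ?_ (hK n hn a han)
  gcongr

end DetMoment

end EllipticGinibre

namespace EllipticGinibre

/-! ### The law of the ensemble -/

section Law

variable {n : ℕ} {t : ℝ}

instance instBorelSpaceMatrix (n : ℕ) : BorelSpace (Matrix (Fin n) (Fin n) ℂ) :=
  inferInstanceAs (BorelSpace (Fin n → Fin n → ℂ))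

theorem measurable_ellMat (n : ℕ) (t : ℝ) : Measurable (ellMat n t) := by
  refine measurable_pi_lambda _ fun i => measurable_pi_lambda _ fun j => ?_
  simp only [ellMat, Matrix.of_apply]
  fun_prop

theorem ellipticGinibreLaw_eq_map (hn : n ≠ 0) :
    ellipticGinibreLaw n t =
      (stdGaussian ((Fin n × Fin n) ⊕ (Fin n × Fin n))).map
        fun g => ((√(n : ℝ) : ℝ) : ℂ) • ellMat n t g := by
  have hm := measurable_hermitianOfArray n
  have hp := measurePreserving_sumPiEquivProdPi
    (fun _ : (Fin n × Fin n) ⊕ (Fin n × Fin n) => gaussianReal 0 1)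
  have hsq : ((√(n : ℝ) : ℝ) : ℂ) ≠ 0 := by
    rw [Complex.ofReal_ne_zero, Real.sqrt_ne_zero']
    exact_mod_cast Nat.pos_of_ne_zero hn
  rw [ellipticGinibreLaw, gueLaw, Measure.map_prod_map _ _ hm hm, ← hp.map_eq,
    Measure.map_map (hm.prodMap hm) hp.measurable,
    Measure.map_map (measurable_ellipticCombination n t) ((hm.prodMap hm).comp hp.measurable)]
  rw [stdGaussian]
  congr 1
  ext g i j
  have h := ellipticCombination_eq_sum t g i j
  refine h.trans ?_
  simp only [Matrix.smul_apply, ellMat, Matrix.of_apply, smul_eq_mul, Finset.mul_sum, letterCoef,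
    if_true]
  refine Finset.sum_congr rfl fun p _ => ?_
  field_simp

/-- The circle integral of the modulus of the normalised determinant. -/
def circleIntegralNormDet (t r : ℝ) (N : Matrix (Fin n) (Fin n) ℂ) : ENNReal :=
  ∫⁻ θ in Set.Ioc 0 (2 * Real.pi), ‖normDet t N (circleMap 0 r θ)‖ₑ

theorem measurable_normDet_circleMap (n : ℕ) (t r : ℝ) :
    Measurable fun p : Matrix (Fin n) (Fin n) ℂ × ℝ => normDet t p.1 (circleMap 0 r p.2) := by
  refine Continuous.measurable ?_
  have hc : Continuous fun p : Matrix (Fin n) (Fin n) ℂ × ℝ => circleMap 0 r p.2 :=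
    (continuous_circleMap 0 r).comp continuous_snd
  unfold normDet
  refine Continuous.mul (Continuous.matrix_det ?_) ?_
  · exact ((continuous_const.add (continuous_const.mul (hc.pow 2))).smul continuous_const).sub
      (hc.smul continuous_fst)
  · fun_prop

theorem measurable_circleIntegralNormDet (n : ℕ) (t r : ℝ) :
    Measurable (circleIntegralNormDet (n := n) t r) :=
  Measurable.lintegral_prod_right' (measurable_normDet_circleMap n t r).enorm

theorem continuous_centredTrace (n : ℕ) (t : ℝ) (k : ℕ) : Continuous (centredTrace n t k) := by
  unfold centredTrace
  exact ((Polynomial.continuous_aeval _).matrix_trace).add continuous_const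

/-- The matrices whose spectral statistics are not under control. -/
def badSet (n : ℕ) (t r ρ b : ℝ) (K : ℕ) : Set (Matrix (Fin n) (Fin n) ℂ) :=
  {N | ENNReal.ofReal (2 * Real.pi * b) ≤ circleIntegralNormDet t r N} ∪
    ⋃ k ∈ Finset.range K, {N | b * (k + 1) * ρ ^ (k + 1) ≤ ‖centredTrace n t (k + 1) N‖}

theorem measurableSet_badSet (n : ℕ) (t r ρ b : ℝ) (K : ℕ) :
    MeasurableSet (badSet n t r ρ b K) := by
  refine (measurableSet_le measurable_const (measurable_circleIntegralNormDet n t r)).union ?_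
  exact Finset.measurableSet_biUnion _ fun k _ =>
    measurableSet_le measurable_const (continuous_centredTrace n t (k + 1)).measurable.norm

theorem bounds_of_notMem_badSet {r ρ b : ℝ} {K : ℕ}
    {N : Matrix (Fin n) (Fin n) ℂ} (hN : N ∉ badSet n t r ρ b K) :
    (2 * Real.pi)⁻¹ * ∫ θ in 0..2 * Real.pi, ‖normDet t N (circleMap 0 r θ)‖ ≤ b ∧
    ∀ k < K, ‖centredTrace n t (k + 1) N‖ ≤ b * (k + 1) * ρ ^ (k + 1) := by
  have hpi := Real.pi_pos
  rw [badSet, Set.mem_union, not_or] at hN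
  refine ⟨?_, fun k hk => ?_⟩
  · have h1 := hN.1
    rw [Set.mem_ofPred_eq, not_le] at h1
    rw [inv_mul_le_iff₀ (by positivity), intervalIntegral.integral_of_le (by positivity)]
    rw [circleIntegralNormDet, ← ofReal_integral_norm_eq_lintegral_enorm,
      ENNReal.ofReal_lt_ofReal_iff_of_nonneg (integral_nonneg fun _ => norm_nonneg _)] at h1
    · exact h1.le
    · exact (((differentiable_normDet t N).continuous.comp
        (continuous_circleMap 0 r)).intervalIntegrable 0 (2 * Real.pi)).1
  · have h2 := hN.2
    simp only [Set.mem_iUnion, Finset.mem_range, not_exists, Set.mem_ofPred_eq, not_le] at h2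
    exact (h2 k hk).le

end Law

/-! ### Probability of losing spectral control -/

section TailBounds

variable {t : ℝ}

theorem measure_circleIntegralNormDet_le (ht : t ∈ Set.Icc (0 : ℝ) 1) {r : ℝ} (hr0 : 0 ≤ r)
    (hr : r < 1) : ∃ K : ℝ, ∀ n : ℕ, n ≠ 0 → ∀ b : ℝ, 0 < b →
      stdGaussian _ {g | ENNReal.ofReal (2 * Real.pi * b) ≤
        circleIntegralNormDet t r (ellMat n t g)} ≤ ENNReal.ofReal (K / b) := by
  obtain ⟨K, hK⟩ := integral_norm_sq_normDet_le ht hr0 hr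
  -- From `x ≤ 1 + x²` the first moment is at most `1 + K` on the whole circle; Tonelli and Markov
  -- conclude.
  refine ⟨1 + K, fun n hn b hb => ?_⟩
  have hpi := Real.pi_pos
  have hK0 : 0 ≤ K := le_trans (integral_nonneg fun _ => by positivity)
    (hK n hn (r : ℂ) (by simp [abs_of_nonneg hr0])).2
  have hmeas : Measurable fun p : ((Fin n × Fin n) ⊕ (Fin n × Fin n) → ℝ) × ℝ =>
      ‖normDet t (ellMat n t p.1) (circleMap 0 r p.2)‖ₑ :=
    ((measurable_normDet_circleMap n t r).comp
      (((measurable_ellMat n t).comp measurable_fst).prodMk measurable_snd)).enorm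
  have h1 : ∀ θ, ∫⁻ g, ‖normDet t (ellMat n t g) (circleMap 0 r θ)‖ₑ ∂(stdGaussian _) ≤
      ENNReal.ofReal (1 + K) := by
    intro θ
    obtain ⟨hi, hle⟩ := hK n hn (circleMap 0 r θ) (by simp [abs_of_nonneg hr0])
    calc _ ≤ ∫⁻ g, ENNReal.ofReal (1 + ‖normDet t (ellMat n t g) (circleMap 0 r θ)‖ ^ 2)
          ∂(stdGaussian _) := by
          refine lintegral_mono fun g => ?_
          rw [← ofReal_norm]
          refine ENNReal.ofReal_le_ofReal ?_
          nlinarith [sq_nonneg (‖normDet t (ellMat n t g) (circleMap 0 r θ)‖ - 1)]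
      _ = ENNReal.ofReal (∫ g, (1 + ‖normDet t (ellMat n t g) (circleMap 0 r θ)‖ ^ 2)
          ∂(stdGaussian _)) := by
          rw [ofReal_integral_eq_lintegral_ofReal (f := fun g => 1 +
            ‖normDet t (ellMat n t g) (circleMap 0 r θ)‖ ^ 2) ((integrable_const _).add hi)
            (ae_of_all _ fun g => by positivity)]
      _ ≤ _ := by
          refine ENNReal.ofReal_le_ofReal ?_
          rw [integral_add (integrable_const _) hi]
          simpa using hle
  have h2 : ∫⁻ g, circleIntegralNormDet t r (ellMat n t g) ∂(stdGaussian _) ≤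
      ENNReal.ofReal (1 + K) * ENNReal.ofReal (2 * Real.pi) := by
    unfold circleIntegralNormDet
    rw [lintegral_lintegral_swap hmeas.aemeasurable]
    calc _ ≤ ∫⁻ θ in Set.Ioc 0 (2 * Real.pi), ENNReal.ofReal (1 + K) := lintegral_mono h1
      _ = _ := by simp
  refine (meas_ge_le_lintegral_div ((measurable_circleIntegralNormDet n t r).comp
    (measurable_ellMat n t)).aemeasurable (by simpa using by positivity)
    ENNReal.ofReal_ne_top).trans ?_
  refine (ENNReal.div_le_div_right h2 _).trans_eq ?_
  rw [← ENNReal.ofReal_mul (by positivity), ← ENNReal.ofReal_div_of_pos (by positivity)]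
  congr 1
  field_simp

theorem measure_centredTrace_le (ht : t ∈ Set.Icc (0 : ℝ) 1) {ρ : ℝ} (hρ : 0 < ρ) (k : ℕ) :
    ∀ᶠ n : ℕ in atTop, ∀ b : ℝ, 0 < b →
      stdGaussian _ {g | b * (k + 1) * ρ ^ (k + 1) ≤ ‖centredTrace n t (k + 1) (ellMat n t g)‖} ≤
        ENNReal.ofReal (2 / b ^ 2 * (ρ⁻¹ ^ 2) ^ (k + 1)) := by
  filter_upwards [centredTrace_second_moment ht k] with n hn b hb
  obtain ⟨hi, hle⟩ := hn
  have h := mul_meas_ge_le_integral_of_nonneg (ae_of_all _ fun g => by positivity) hi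
    ((b * (k + 1) * ρ ^ (k + 1)) ^ 2)
  have hset : {g | (b * (k + 1) * ρ ^ (k + 1)) ^ 2 ≤ ‖centredTrace n t (k + 1) (ellMat n t g)‖ ^ 2} =
      {g | b * (k + 1) * ρ ^ (k + 1) ≤ ‖centredTrace n t (k + 1) (ellMat n t g)‖} := by
    ext g
    exact pow_le_pow_iff_left₀ (by positivity) (norm_nonneg _) two_ne_zero
  rw [hset] at h
  rw [← ofReal_measureReal]
  refine ENNReal.ofReal_le_ofReal ?_
  have h2 := h.trans hle
  rw [mul_comm, ← le_div_iff₀ (by positivity)] at h2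
  refine h2.trans_eq ?_
  have : ((k : ℝ) + 1) ≠ 0 := by positivity
  rw [← pow_mul, mul_comm 2 (k + 1), pow_mul, inv_pow]
  field_simp

/-- Since `ρ > 1`, the Chebyshev bounds for the traces sum to a geometric series, so one `b` serves
every `K`; only the threshold on `n` depends on `K`. This order allows `K` to be chosen later as a
function of `b`. -/
theorem exists_measure_badSet_le (ht : t ∈ Set.Icc (0 : ℝ) 1) {r ρ : ℝ} (hr0 : 0 ≤ r)
    (hr : r < 1) (hρ : 1 < ρ) {η : ℝ} (hη : 0 < η) : ∃ b : ℝ, 0 < b ∧ ∀ K : ℕ, ∀ᶠ n : ℕ in atTop,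
      stdGaussian _ (ellMat n t ⁻¹' badSet n t r ρ b K) ≤ ENNReal.ofReal η := by
  obtain ⟨C, hC⟩ := measure_circleIntegralNormDet_le ht hr0 hr
  have hρ0 : 0 < ρ := by linarith
  have hq0 : 0 ≤ ρ⁻¹ ^ 2 := by positivity
  have hq1 : ρ⁻¹ ^ 2 < 1 := pow_lt_one₀ (by positivity) (inv_lt_one_of_one_lt₀ hρ) two_ne_zero
  have hlim : Tendsto (fun b : ℝ => max C 0 / b + 2 / b ^ 2 * (1 - ρ⁻¹ ^ 2)⁻¹) atTop (𝓝 0) := by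
    have h1 : Tendsto (fun b : ℝ => max C 0 / b) atTop (𝓝 0) :=
      tendsto_const_nhds.div_atTop tendsto_id
    have h2 : Tendsto (fun b : ℝ => 2 / b ^ 2) atTop (𝓝 0) :=
      tendsto_const_nhds.div_atTop (tendsto_pow_atTop two_ne_zero)
    have h3 := h1.add (h2.mul_const (1 - ρ⁻¹ ^ 2)⁻¹)
    rwa [zero_mul, add_zero] at h3
  obtain ⟨b, hb, hb0⟩ := ((hlim.eventually_lt_const hη).and (eventually_gt_atTop 0)).exists
  refine ⟨b, hb0, fun K => ?_⟩
  have hev : ∀ᶠ n : ℕ in atTop, ∀ k ∈ Finset.range K, ∀ b : ℝ, 0 < b →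
      stdGaussian _ {g | b * (k + 1) * ρ ^ (k + 1) ≤ ‖centredTrace n t (k + 1) (ellMat n t g)‖} ≤
        ENNReal.ofReal (2 / b ^ 2 * (ρ⁻¹ ^ 2) ^ (k + 1)) :=
    (Finset.eventually_all _).mpr fun k _ => measure_centredTrace_le ht hρ0 k
  filter_upwards [hev, eventually_ne_atTop 0] with n hn hn0
  rw [badSet, Set.preimage_union, Set.preimage_iUnion₂]
  calc _ ≤ ENNReal.ofReal (max C 0 / b) +
        ∑ k ∈ Finset.range K, ENNReal.ofReal (2 / b ^ 2 * (ρ⁻¹ ^ 2) ^ (k + 1)) := by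
        refine (measure_union_le _ _).trans (add_le_add ?_ ?_)
        · refine (hC n hn0 b hb0).trans (ENNReal.ofReal_le_ofReal ?_)
          gcongr
          exact le_max_left _ _
        · exact (measure_biUnion_finset_le _ _).trans
            (Finset.sum_le_sum fun k hk => hn k hk b hb0)
    _ = ENNReal.ofReal (max C 0 / b + 2 / b ^ 2 * ∑ k ∈ Finset.range K, (ρ⁻¹ ^ 2) ^ (k + 1)) := by
        rw [← ENNReal.ofReal_sum_of_nonneg (fun k _ => by positivity),
          ← ENNReal.ofReal_add (by positivity) (Finset.sum_nonneg fun k _ => by positivity),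
          Finset.mul_sum]
    _ ≤ ENNReal.ofReal η := by
        refine ENNReal.ofReal_le_ofReal (le_trans ?_ hb.le)
        gcongr
        have hg := hasSum_geometric_of_lt_one hq0 hq1
        refine le_trans (Finset.sum_le_sum fun k _ => ?_)
          (sum_le_hasSum (Finset.range K) (fun k _ => by positivity) hg)
        exact pow_le_pow_of_le_one hq0 hq1.le (Nat.le_succ k)

theorem eigenvalueCount_eq_zero {n : ℕ} {C : Set ℂ} {r₀ : ℝ} (A : Matrix (Fin n) (Fin n) ℂ)
    (hgeo : ∀ z ∈ C, ∃ s : ℂ, s ≠ 0 ∧ ‖s‖ ≤ r₀ ∧ s⁻¹ + t * s = z)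
    (hdet : ∀ s : ℂ, ‖s‖ ≤ r₀ → ((1 + t * s ^ 2) • (1 : Matrix (Fin n) (Fin n) ℂ) -
      s • ((((√(n : ℝ) : ℝ) : ℂ))⁻¹ • A)).det ≠ 0) : eigenvalueCount A C = 0 := by
  classical
  rw [eigenvalueCount, Multiset.countP_eq_zero]
  intro z hz hzC
  obtain ⟨s, hs0, hs, hsz⟩ := hgeo _ hzC
  refine hdet s hs ?_
  rw [smul_smul, det_smul_one_sub]
  refine Multiset.prod_eq_zero (Multiset.mem_map.mpr ⟨z, hz, ?_⟩)
  rw [mul_assoc, ← div_eq_inv_mul, ← hsz]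
  field_simp
  ring

end TailBounds

end EllipticGinibre

theorem mainTheorem2 (t : ℝ) (ht : t ∈ Set.Icc (0 : ℝ) 1)
    {Ω : ℕ → Type*} [∀ n, MeasurableSpace (Ω n)] (P : ∀ n, Measure (Ω n))
    [∀ n, IsProbabilityMeasure (P n)]
    (A : ∀ n, Ω n → Matrix (Fin n) (Fin n) ℂ)
    (hA : ∀ n, 1 ≤ n → HasLaw (A n) (EllipticGinibre.ellipticGinibreLaw n t) (P n))
    (C : Set ℂ) (hC : IsClosed C) (hdisj : Disjoint C (EllipticGinibre.limitingEllipse t)) :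
    ∀ ε : ℝ, 0 < ε →
      Tendsto (fun n => P n {ω | ε ≤ |(EllipticGinibre.eigenvalueCount (A n ω) C : ℝ) - 0|})
        atTop (𝓝 0) := by
  intro ε hε
  obtain ⟨r₀, hr00, hr01, hgeo⟩ := EllipticGinibre.exists_radius ht hC hdisj
  obtain ⟨r, hr, hr1⟩ := exists_between hr01
  have hr0 : 0 < r := hr00.trans hr
  -- `ρ > 1` makes the tail bounds summable, and `ρ < 1 / r` keeps the exponent bounded on the
  -- circle of radius `r`.
  obtain ⟨ρ, hρ, hρ1⟩ := exists_between ((one_lt_inv₀ hr0).mpr hr1)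
  have hρr : ρ * r < 1 := by rwa [lt_inv_comm₀ (by linarith) hr0, ← one_div,
    lt_div_iff₀ (by linarith), mul_comm] at hρ1
  refine ENNReal.tendsto_nhds_zero.mpr fun δ hδ => ?_
  obtain ⟨η, hη, hηδ⟩ : ∃ η : ℝ, 0 < η ∧ ENNReal.ofReal η ≤ δ := by
    rcases eq_or_ne δ ⊤ with rfl | h
    · exact ⟨1, one_pos, le_top⟩
    · exact ⟨δ.toReal, ENNReal.toReal_pos hδ.ne' h, ENNReal.ofReal_toReal_le⟩
  obtain ⟨b, hb, hbad⟩ := EllipticGinibre.exists_measure_badSet_le ht hr0.le hr1 hρ hη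
  obtain ⟨K, hK⟩ := EllipticGinibre.exists_forall_det_ne_zero (b := b) hr00.le hr
    (by linarith : (0 : ℝ) ≤ ρ) hρr
  filter_upwards [hbad K, eventually_ge_atTop 1] with n hn hn1
  have hn0 : n ≠ 0 := by omega
  have hsq : ((√(n : ℝ) : ℝ) : ℂ) ≠ 0 := by
    rw [Complex.ofReal_ne_zero, Real.sqrt_ne_zero']
    exact_mod_cast hn1
  set B : Set (Matrix (Fin n) (Fin n) ℂ) :=
    (fun M => (((√(n : ℝ) : ℝ) : ℂ))⁻¹ • M) ⁻¹' EllipticGinibre.badSet n t r ρ b K with hB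
  have hBm : MeasurableSet B :=
    (continuous_const_smul _).measurable (EllipticGinibre.measurableSet_badSet n t r ρ b K)
  -- Outside the bad event the count is exactly zero. The inclusion also avoids any measurability
  -- question about the count: only `B` has to be measurable.
  have hsub : {ω | ε ≤ |(EllipticGinibre.eigenvalueCount (A n ω) C : ℝ) - 0|} ⊆ A n ⁻¹' B := by
    intro ω hω
    by_contra hnB
    have hnB' : (((√(n : ℝ) : ℝ) : ℂ))⁻¹ • A n ω ∉ EllipticGinibre.badSet n t r ρ b K := by
      rwa [Set.mem_preimage, hB, Set.mem_preimage] at hnB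
    obtain ⟨h1, h2⟩ := EllipticGinibre.bounds_of_notMem_badSet hnB'
    have h3 := EllipticGinibre.eigenvalueCount_eq_zero (A n ω) hgeo (hK t n _ h1 h2)
    rw [Set.mem_ofPred_eq, h3, Nat.cast_zero, sub_zero, abs_zero] at hω
    linarith
  refine (measure_mono hsub).trans ?_
  have hmeas : Measurable fun g : (Fin n × Fin n) ⊕ (Fin n × Fin n) → ℝ =>
      ((√(n : ℝ) : ℝ) : ℂ) • EllipticGinibre.ellMat n t g :=
    (continuous_const_smul _).measurable.comp (EllipticGinibre.measurable_ellMat n t)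
  rw [← Measure.map_apply_of_aemeasurable (hA n hn1).aemeasurable hBm, (hA n hn1).map_eq,
    EllipticGinibre.ellipticGinibreLaw_eq_map hn0, Measure.map_apply hmeas hBm, hB,
    ← Set.preimage_comp]
  have hcomp : ((fun M : Matrix (Fin n) (Fin n) ℂ => (((√(n : ℝ) : ℝ) : ℂ))⁻¹ • M) ∘
      fun g => ((√(n : ℝ) : ℝ) : ℂ) • EllipticGinibre.ellMat n t g) =
      EllipticGinibre.ellMat n t := by
    ext1 g
    simp only [Function.comp, smul_smul, inv_mul_cancel₀ hsq, one_smul]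
  rw [hcomp]
  exact hn.trans hηδ
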